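/- Let $d\ge 1$, $c>0$, $\alpha\in(0,2]$, and let $E=B_c(0)\setminus\{0\}\subset\mathbb R^d$. Let $(\Omega,\mathcal F,\{\mathcal F_t\}_{t\ge0},\mathbb P)$ be a filtered probability space and let $\nu$ be a Lévy measure on $E$, i.e. $\int_E 1\wedge|v|^2\,\nu(dv)<\infty$. Let $N$ be a time homogeneous Poisson random measure on $E\times[0,\infty)$ with intensity $\nu\times\lambda$ ($\lambda$ Lebesgue measure): a random $\sigma$-finite measure, independently scattered, such that $N(B\times I)$ is Poisson distributed with parameter $\nu(B)\lambda(I)$ whenever this is meaningful, and such that for every Borel $U\subseteq E$ the process $t\mapsto N(U\times(0,t])$ is $\{\mathcal F_t\}$-adapted with increments independent of the past. Let $\tilde N=N-\nu\times\lambda$. For adapted $f$, $\int_{(0,t]}\int_E f(r,v)\,\tilde N(dr,dv)$ denotes the $L^1(\Omega)$-limit of the elementary integrals of simple predictable integrands $\sum_i\xi_i 1_{(a_i,b_i]}(r)1_{A_i}(v)$ ($\xi_i$ bounded and $\mathcal F_{a_i}$-measurable, $\nu(A_i)<\infty$) that converge to $f$ in $L^1(\Omega\times(0,t]\times E)$.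 Let $K(t,x)=(2\pi)^{-d}\int_{\mathbb R^d}e^{ix\cdot\xi-t|\xi|^\alpha}\,d\xi$ be the heat kernel of $\partial_t u=\Delta^{\alpha/2}u:=-(-\Delta)^{\alpha/2}u$ on $\mathbb R^d$ (with $K(0,\cdot)=\delta_0$). Let $g:[0,\infty)\times E\times\mathbb R^d\times\Omega\to\mathbb R$ be jointly measurable with $$\mathbb E\int_0^T\!\!\int_E\|g(r,v,\cdot)\|_{L^\infty(\mathbb R^d)}\,\nu(dv)\,dr<\infty\quad\text{for all }T\ge 0,$$ and such that, for all $t,v,x$, the random variable $g(t,v,x)$ is $\mathbb P$-a.s. equal to an $\mathcal F_t$-measurable one. Consider $$u(t,x)=\int_{(0,t]}\int_E\big(K(t-r,\cdot)\ast g(r,v,\cdot)\big)(x)\,\tilde N(dr,dv),\qquad t\ge 0,\ x\in\mathbb R^d. \tag{1}$$ A realization of (1) is a jointly measurable function $u(t,x,\omega)$ such that for each $(t,x)$ the random variable $u(t,x)$ is a version of the stochastic integral in (1). Then there is an absolute constant $C$ such that: (a) There is a realization $u$ of (1) such that for every $T\ge0$ $$\mathbb E\,\sup_{0\le t\le T}\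 \operatorname*{ess\,sup}_{x\in\mathbb R^d}|u(t,x)|\ \le\ C\,\mathbb E\int_0^T\!\!\int_E\|g(r,v,\cdot)\|_{L^\infty(\mathbb R^d)}\,\nu(dv)\,dr\ <\ \infty .$$ (b) For every realization $u$ of (1) and every $T\ge0$ $$\mathbb E\,\operatorname*{ess\,sup}_{0\le t\le T}\ \operatorname*{ess\,sup}_{x\in\mathbb R^d}|u(t,x)|\ \le\ C\,\mathbb E\int_0^T\!\!\int_E\|g(r,v,\cdot)\|_{L^\infty(\mathbb R^d)}\,\nu(dv)\,dr\ <\ \infty ,$$ that is, $u\in L^1(\Omega;L^\infty_{loc}([0,\infty);L^\infty(\mathbb R^d)))$. Here $\mathbb E$ of a possibly non-measurable nonnegative function is its upper expectation (the infimum of the expectations of the random variables above it), which is the usual expectation if the function is measurable. -/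

import Mathlib

open MeasureTheory ProbabilityTheory Set Filter
open scoped ENNReal NNReal Topology

noncomputable section

namespace PoissonHeat

/-- The Euclidean space `ℝᵈ`. -/
abbrev Space (d : ℕ) : Type := EuclideanSpace ℝ (Fin d)

/-- The mark space `E = B_c(0) \ {0} ⊆ ℝᵈ`, with its Borel σ-algebra. -/
abbrev Mark (d : ℕ) (c : ℝ) : Type := ↥(Metric.ball (0 : Space d) c \ {0})

/-- Lebesgue measure on `ℝ₊ = [0,∞)`: the image of Lebesgue measure on `[0,∞) ⊆ ℝ` under the
identification of this set with `ℝ≥0`. -/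
def lebesgue : Measure ℝ≥0 := (volume.restrict (Ici (0 : ℝ))).map Real.toNNReal

/-- `ν` is a Lévy measure on `E`: `∫_E (1 ∧ |v|²) ν(dv) < ∞`. -/
def IsLevyMeasure {d : ℕ} {c : ℝ} (ν : Measure (Mark d c)) : Prop :=
  ∫⁻ v, ENNReal.ofReal (min 1 (‖(v : Space d)‖ ^ 2)) ∂ν < ∞

/-- `N` is a time homogeneous Poisson random measure on `E × ℝ₊` over the filtered probability
space `(Ω, ℱ, P)`, with intensity measure `ν × λ` (`λ` is Lebesgue measure on `ℝ₊`).
For sets of infinite intensity the value of `N` is forced by countable additivity, so its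
distribution is only prescribed on rectangles of finite intensity. -/
structure IsPoissonRandomMeasure {d : ℕ} {c : ℝ} {Ω : Type*} {m : MeasurableSpace Ω}
    (P : Measure Ω) (ℱ : Filtration ℝ≥0 m) (ν : Measure (Mark d c))
    (N : Ω → Measure (Mark d c × ℝ≥0)) : Prop where
  measurable : Measurable N
  sigmaFinite : ∀ ω, SigmaFinite (N ω)
  /-- `N(B × I)` has the Poisson distribution with parameter `ν(B) λ(I)`. -/
  poisson : ∀ (B : Set (Mark d c)) (I : Set ℝ≥0), MeasurableSet B → MeasurableSet I →
    ν B < ∞ → lebesgue I < ∞ →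
    P.map (fun ω => N ω (B ×ˢ I)) =
      (poissonMeasure (ν B * lebesgue I).toNNReal).map (fun k : ℕ => (k : ℝ≥0∞))
  /-- `N` is independently scattered. -/
  indep : ∀ (n : ℕ) (B : Fin n → Set (Mark d c)) (I : Fin n → Set ℝ≥0),
    (∀ j, MeasurableSet (B j)) → (∀ j, MeasurableSet (I j)) →
    Pairwise (fun i j => Disjoint (B i ×ˢ I i) (B j ×ˢ I j)) →
    iIndepFun (fun j ω => N ω (B j ×ˢ I j)) P
  /-- `t ↦ N((0,t] × U)` is adapted. -/
  adapted : ∀ (U : Set (Mark d c)), MeasurableSet U → ∀ t : ℝ≥0,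
    Measurable[ℱ t] (fun ω => N ω (U ×ˢ Ioc 0 t))
  /-- The increments of `t ↦ N((0,t] × U)` are independent of the past. -/
  indep_past : ∀ (U : Set (Mark d c)), MeasurableSet U → ∀ s t : ℝ≥0, s ≤ t →
    Indep (MeasurableSpace.comap (fun ω => N ω (U ×ˢ Ioc s t)) inferInstance) (ℱ s) P

/-- The compensated measure `Ñ(B × I) = N(B × I) - ν(B) λ(I)`, for `B`, `I` of finite measure. -/
def compensated {d : ℕ} {c : ℝ} {Ω : Type*} (ν : Measure (Mark d c))
    (N : Ω → Measure (Mark d c × ℝ≥0)) (B : Set (Mark d c)) (I : Set ℝ≥0) (ω : Ω) : ℝ :=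
  (N ω (B ×ˢ I)).toReal - (ν B * lebesgue I).toReal

/-- A simple predictable integrand `∑ᵢ ξᵢ(ω) 1_{(aᵢ,bᵢ]}(r) 1_{Aᵢ}(v)`, where `ξᵢ` is bounded and
`ℱ_{aᵢ}`-measurable, and `ν(Aᵢ) < ∞`. -/
structure SimpleIntegrand {d : ℕ} {c : ℝ} {Ω : Type*} {m : MeasurableSpace Ω}
    (ℱ : Filtration ℝ≥0 m) (ν : Measure (Mark d c)) where
  n : ℕ
  a : Fin n → ℝ≥0
  b : Fin n → ℝ≥0
  A : Fin n → Set (Mark d c)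
  ξ : Fin n → Ω → ℝ
  le : ∀ i, a i ≤ b i
  measurableSet : ∀ i, MeasurableSet (A i)
  finite : ∀ i, ν (A i) < ∞
  measurable : ∀ i, Measurable[ℱ (a i)] (ξ i)
  bounded : ∃ M : ℝ, ∀ i ω, |ξ i ω| ≤ M

namespace SimpleIntegrand

variable {d : ℕ} {c : ℝ} {Ω : Type*} {m : MeasurableSpace Ω}
  {ℱ : Filtration ℝ≥0 m} {ν : Measure (Mark d c)}

/-- The value at `(r, v, ω)`. -/
def eval (φ : SimpleIntegrand ℱ ν) (r : ℝ≥0) (v : Mark d c) (ω : Ω) : ℝ :=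
  ∑ i, φ.ξ i ω * (φ.A i ×ˢ Ioc (φ.a i) (φ.b i)).indicator (fun _ => (1 : ℝ)) (v, r)

/-- The elementary integral `∫_{(0,t]} ∫_E φ(r,v) Ñ(dr,dv) = ∑ᵢ ξᵢ Ñ(((aᵢ,bᵢ] ∩ (0,t]) × Aᵢ)`. -/
def integral (φ : SimpleIntegrand ℱ ν) (N : Ω → Measure (Mark d c × ℝ≥0)) (t : ℝ≥0) (ω : Ω) : ℝ :=
  ∑ i, φ.ξ i ω * compensated ν N (φ.A i) (Ioc (φ.a i) (min (φ.b i) t)) ω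

end SimpleIntegrand

/-- `I` is a version of the stochastic integral `∫_{(0,t]} ∫_E f(r,v) Ñ(dr,dv)`:
there are simple predictable integrands `φₙ` that converge to `f` in `L¹(Ω × (0,t] × E)` and whose
elementary integrals converge to `I` in `L¹(Ω)`. -/
def IsStochasticIntegral {d : ℕ} {c : ℝ} {Ω : Type*} {m : MeasurableSpace Ω}
    (P : Measure Ω) (ℱ : Filtration ℝ≥0 m) (ν : Measure (Mark d c))
    (N : Ω → Measure (Mark d c × ℝ≥0)) (t : ℝ≥0) (f : ℝ≥0 → Mark d c → Ω → ℝ) (I : Ω → ℝ) :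
    Prop :=
  AEMeasurable I P ∧ ∃ φ : ℕ → SimpleIntegrand ℱ ν,
    Tendsto (fun n => ∫⁻ ω, ∫⁻ r in Ioc 0 t, ∫⁻ v, ‖(φ n).eval r v ω - f r v ω‖ₑ ∂ν ∂lebesgue ∂P)
      atTop (𝓝 0) ∧
    Tendsto (fun n => ∫⁻ ω, ‖(φ n).integral N t ω - I ω‖ₑ ∂P) atTop (𝓝 0)

/-- The heat kernel of `∂ₜ u = Δ^{α/2} u` on `ℝᵈ`, for `t > 0`: the inverse Fourier transform of
`exp(-t|ξ|^α)`, i.e. `K(t,x) = (2π)^{-d} ∫ cos(x·ξ) exp(-t|ξ|^α) dξ`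
(the imaginary part vanishes by symmetry). -/
def heatKernel (d : ℕ) (α t : ℝ) (x : Space d) : ℝ :=
  ((2 * Real.pi) ^ d)⁻¹ * ∫ ξ : Space d, Real.cos (inner ℝ x ξ) * Real.exp (-t * ‖ξ‖ ^ α)

/-- The convolution `(K(s,·) ∗ h)(x)`, where `K(0,·)` is the Dirac mass at the origin. -/
def heatConv {d : ℕ} (α : ℝ) (s : ℝ≥0) (h : Space d → ℝ) (x : Space d) : ℝ :=
  if s = 0 then h x else ∫ y, heatKernel d α s (x - y) * h y

/-- `u` is a jointly measurable realization of
`u(t,x) = ∫_{(0,t]} ∫_E (K(t-r,·) ∗ g(r,v,·))(x) Ñ(dr,dv)`. -/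
def IsRealization {d : ℕ} {c : ℝ} {Ω : Type*} {m : MeasurableSpace Ω}
    (P : Measure Ω) (ℱ : Filtration ℝ≥0 m) (ν : Measure (Mark d c))
    (N : Ω → Measure (Mark d c × ℝ≥0)) (α : ℝ) (g : ℝ≥0 → Mark d c → Space d → Ω → ℝ)
    (u : ℝ≥0 → Space d → Ω → ℝ) : Prop :=
  Measurable (fun p : ℝ≥0 × Space d × Ω => u p.1 p.2.1 p.2.2) ∧
  ∀ (t : ℝ≥0) (x : Space d), IsStochasticIntegral P ℱ ν N t
    (fun r v ω => heatConv α (t - r) (fun y => g r v y ω) x) (u t x)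

/-- `E ∫_0^T ∫_E ‖g(r,v)‖_{L^∞(ℝᵈ)} ν(dv) dr`. -/
def sourceNorm {d : ℕ} {c : ℝ} {Ω : Type*} {m : MeasurableSpace Ω}
    (P : Measure Ω) (ν : Measure (Mark d c)) (g : ℝ≥0 → Mark d c → Space d → Ω → ℝ)
    (T : ℝ≥0) : ℝ≥0∞ :=
  ∫⁻ ω, ∫⁻ r in Ioc 0 T, ∫⁻ v, eLpNorm (fun x => g r v x ω) ∞ volume ∂ν ∂lebesgue ∂P

/-- The upper expectation of `X ≥ 0`: the infimum of the expectations of the random variables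
above `X`. It is `E X` if `X` is measurable (and `∫⁻`, a lower integral, otherwise says less). -/
def upperExpectation {Ω : Type*} {m : MeasurableSpace Ω} (P : Measure Ω) (X : Ω → ℝ≥0∞) : ℝ≥0∞ :=
  ⨅ (Y : Ω → ℝ≥0∞) (_ : Measurable Y) (_ : ∀ ω, X ω ≤ Y ω), ∫⁻ ω, Y ω ∂P

end PoissonHeat

end

/-!
The stochastic integral of an `L¹` integrand is a pathwise Lebesgue integral. For predictable
`f ≥ 0`, the mean of `∫ f dN` equals the mean of `∫ f dν dλ` (`lintegral_strip_kernel_eq`): both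
sides are measures in `f` that agree on predictable rectangles, since the increments of `N` are
independent of the past. So, if `f` is predictable and integrable, the random variable
`∫ f dN - ∫ f dν dλ` (`compensatedIntegral`) is Lipschitz in `f` with respect to `L¹`, with constant
`2`, and it is the stochastic integral, because it is so for simple integrands, which are dense
(`exists_tendsto_simpleIntegrand`, `isStochasticIntegral_iff`).

The heat semigroup contracts `L^∞(ℝᵈ)` (`enorm_heatConv_le`), because the heat kernel is nonnegative
of mass at most `1`. Nonnegativity is obtained by subordination: for `α < 2`, `exp(-t|ξ|^α)` is a
limit of normalized exponentials of mixtures of Gaussians `exp(-s|ξ|²)` (`gaussPosDef_stable`).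
Hence, for every path and every `t ≤ T`, the pathwise integral of the convolution is at most `∫ ‖g‖
dN + ∫ ‖g‖ dν dλ` over `E × (0, T]` at almost every `x` (`eLpNorm_compensatedIntegral_le`), and the
mean of this bound is twice the norm of the source. This is the first claim, with `C = 2`. Any other
realization agrees almost surely with the pathwise one at each `(t, x)`, so by Fubini it agrees with
it on almost every path for almost every `(t, x)` (`ae_ae_eLpNorm_eq`), which is the second claim.

The source is only assumed measurable and adapted, so it has to be replaced by a predictable version
(`aestronglyMeasurable_predictable`). This needs no regularity of the filtration: for an event `A`,
the martingale `P(A | ℱ_r)` is left-continuous in mean at all but countably many `r`, since its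
second moment is monotone. Therefore a field that is adapted and orthogonal to all predictable ones
is orthogonal to all rectangles `A × B`, and vanishes.
-/

noncomputable section

namespace PoissonHeat

/-! ### Symbols with nonnegative Gaussian regularizations -/

section Gaussian

lemma abs_cos_mul_exp_mul_le {V : Type*} [NormedAddCommGroup V] [InnerProductSpace ℝ V]
    {R δ y : ℝ} (x ξ : V) (hy : |y| ≤ R) :
    ‖Real.cos (inner ℝ x ξ) * (Real.exp (-δ * ‖ξ‖ ^ 2) * y)‖ ≤
      R * Real.exp (-δ * ‖ξ‖ ^ 2) := by
  have h0 : 0 ≤ R := (abs_nonneg y).trans hy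
  rw [norm_mul, norm_mul, Real.norm_eq_abs, Real.norm_eq_abs, Real.norm_eq_abs, Real.abs_exp]
  have h1 := Real.abs_cos_le_one (inner ℝ x ξ)
  have h2 := Real.exp_pos (-δ * ‖ξ‖ ^ 2)
  calc _ ≤ 1 * (Real.exp (-δ * ‖ξ‖ ^ 2) * R) := by gcongr
    _ = _ := by ring

variable {V : Type*} [NormedAddCommGroup V] [InnerProductSpace ℝ V] [FiniteDimensional ℝ V]
  [MeasurableSpace V] [BorelSpace V]

lemma integral_cos_inner_mul_exp {δ : ℝ} (hδ : 0 < δ) (x : V) :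
    ∫ ξ : V, Real.cos (inner ℝ x ξ) * Real.exp (-δ * ‖ξ‖ ^ 2) =
      (Real.pi / δ) ^ (Module.finrank ℝ V / 2 : ℝ) * Real.exp (-‖x‖ ^ 2 / (4 * δ)) := by
  have h := GaussianFourier.integral_cexp_neg_mul_sq_norm_add (V := V) (b := (δ : ℂ))
    (by simpa using hδ) Complex.I x
  have hint := GaussianFourier.integrable_cexp_neg_mul_sq_norm_add (V := V) (b := (δ : ℂ))
    (by simpa using hδ) Complex.I x
  have h' := congrArg Complex.re h
  have e1 := integral_re hint
  simp only [RCLike.re_to_complex] at e1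
  rw [← e1] at h'
  convert! h' using 1
  · refine integral_congr_ae (ae_of_all _ fun ξ => ?_)
    have : (-(δ : ℂ) * (‖ξ‖ : ℂ) ^ 2 + Complex.I * ((inner ℝ x ξ : ℝ) : ℂ)) =
        ((-δ * ‖ξ‖ ^ 2 : ℝ) : ℂ) + ((inner ℝ x ξ : ℝ) : ℂ) * Complex.I := by
      push_cast; ring
    simp only [this, Complex.exp_add, Complex.exp_mul_I]
    rw [← Complex.ofReal_exp, ← Complex.ofReal_cos, ← Complex.ofReal_sin, Complex.re_ofReal_mul,
      Complex.add_re, Complex.ofReal_re, Complex.re_ofReal_mul, Complex.I_re, mul_zero, add_zero,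
      mul_comm]
  · have e2 : ((Real.pi : ℂ) / δ) ^ ((Module.finrank ℝ V : ℂ) / 2) =
        (((Real.pi / δ) ^ (Module.finrank ℝ V / 2 : ℝ) : ℝ) : ℂ) := by
      rw [Complex.ofReal_cpow (by positivity)]
      push_cast; rfl
    have e3 : Complex.I ^ 2 * (‖x‖ : ℂ) ^ 2 / (4 * (δ : ℂ)) =
        ((-‖x‖ ^ 2 / (4 * δ) : ℝ) : ℂ) := by
      push_cast; rw [Complex.I_sq]; ring
    rw [e2, e3, ← Complex.ofReal_exp, ← Complex.ofReal_mul, Complex.ofReal_re]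

lemma integrable_exp_neg_mul_sq_norm {δ : ℝ} (hδ : 0 < δ) :
    Integrable (fun ξ : V => Real.exp (-δ * ‖ξ‖ ^ 2)) := by
  have hint := GaussianFourier.integrable_cexp_neg_mul_sq_norm_add (V := V) (b := (δ : ℂ))
    (by simpa using hδ) 0 (0 : V)
  refine hint.re.congr (ae_of_all _ fun ξ => ?_)
  have : (-(δ : ℂ) * (‖ξ‖ : ℂ) ^ 2 + 0 * ((inner ℝ (0 : V) ξ : ℝ) : ℂ)) =
        ((-δ * ‖ξ‖ ^ 2 : ℝ) : ℂ) := by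
      push_cast; ring
  simp only [this, ← Complex.ofReal_exp, RCLike.re_to_complex, Complex.ofReal_re]

/-- A bounded Borel symbol `h` all of whose Gaussian regularizations `exp(-δ|ξ|²) h(ξ)` have a
nonnegative (cosine) Fourier transform: a substitute for positive definiteness that is visibly
stable under multiplication by mixtures of Gaussians and under bounded pointwise limits. -/
structure GaussPosDef (h : V → ℝ) : Prop where
  measurable : Measurable h
  bounded : ∃ R : ℝ, ∀ ξ, |h ξ| ≤ R
  nonneg : ∀ δ : ℝ, 0 < δ → ∀ x : V,
    0 ≤ ∫ ξ : V, Real.cos (inner ℝ x ξ) * (Real.exp (-δ * ‖ξ‖ ^ 2) * h ξ)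

namespace GaussPosDef

lemma integrable {h : V → ℝ} (hh : GaussPosDef h) {δ : ℝ} (hδ : 0 < δ) (x : V) :
    Integrable (fun ξ : V => Real.cos (inner ℝ x ξ) * (Real.exp (-δ * ‖ξ‖ ^ 2) * h ξ)) := by
  obtain ⟨R, hR⟩ := hh.bounded
  have := hh.measurable
  exact ((integrable_exp_neg_mul_sq_norm hδ).const_mul R).mono'
    (by fun_prop) (ae_of_all _ fun ξ => abs_cos_mul_exp_mul_le x ξ (hR ξ))

lemma one : GaussPosDef (fun _ : V => (1 : ℝ)) where
  measurable := measurable_const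
  bounded := ⟨1, fun _ => by simp⟩
  nonneg δ hδ x := by
    simp only [mul_one]
    rw [integral_cos_inner_mul_exp hδ]
    positivity

lemma mul_exp {h : V → ℝ} (hh : GaussPosDef h) {s : ℝ} (hs : 0 ≤ s) :
    GaussPosDef (fun ξ => h ξ * Real.exp (-s * ‖ξ‖ ^ 2)) where
  measurable := by have := hh.measurable; fun_prop
  bounded := by
    obtain ⟨R, hR⟩ := hh.bounded
    refine ⟨R, fun ξ => ?_⟩
    rw [abs_mul, Real.abs_exp]
    have : Real.exp (-s * ‖ξ‖ ^ 2) ≤ 1 := Real.exp_le_one_iff.2 (by nlinarith [sq_nonneg ‖ξ‖])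
    nlinarith [hR ξ, abs_nonneg (h ξ)]
  nonneg δ hδ x := by
    convert hh.nonneg (δ + s) (by positivity) x using 4 with ξ
    rw [show -(δ + s) * ‖ξ‖ ^ 2 = -δ * ‖ξ‖ ^ 2 + -s * ‖ξ‖ ^ 2 by ring, Real.exp_add]
    ring

lemma const_mul {h : V → ℝ} (hh : GaussPosDef h) {c : ℝ} (hc : 0 ≤ c) :
    GaussPosDef (fun ξ => c * h ξ) where
  measurable := hh.measurable.const_mul c
  bounded := by
    obtain ⟨R, hR⟩ := hh.bounded
    exact ⟨c * R, fun ξ => by rw [abs_mul, abs_of_nonneg hc]; gcongr; exact hR ξ⟩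
  nonneg δ hδ x := by
    have := mul_nonneg hc (hh.nonneg δ hδ x)
    rw [← integral_const_mul] at this
    refine this.trans_eq (integral_congr_ae (ae_of_all _ fun ξ => ?_))
    ring

lemma sum {ι : Type*} {h : ι → V → ℝ} (s : Finset ι) (hh : ∀ i ∈ s, GaussPosDef (h i)) :
    GaussPosDef (fun ξ => ∑ i ∈ s, h i ξ) where
  measurable := Finset.measurable_sum _ fun i hi => (hh i hi).measurable
  bounded := by
    choose! R hR using fun i hi => (hh i hi).bounded
    exact ⟨∑ i ∈ s, R i, fun ξ => (Finset.abs_sum_le_sum_abs _ _).trans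
      (Finset.sum_le_sum fun i hi => hR i hi ξ)⟩
  nonneg δ hδ x := by
    simp only [Finset.mul_sum]
    rw [integral_finsetSum _ fun i hi => (hh i hi).integrable hδ x]
    exact Finset.sum_nonneg fun i hi => (hh i hi).nonneg δ hδ x

lemma of_tendsto {h : ℕ → V → ℝ} {h' : V → ℝ} (hh : ∀ n, GaussPosDef (h n)) {R : ℝ}
    (hR : ∀ n ξ, |h n ξ| ≤ R) (hlim : ∀ ξ, Tendsto (fun n => h n ξ) atTop (𝓝 (h' ξ))) :
    GaussPosDef h' where
  measurable := measurable_of_tendsto_metrizable (fun n => (hh n).measurable)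
    (tendsto_pi_nhds.2 hlim)
  bounded := ⟨R, fun ξ => le_of_tendsto' (hlim ξ).abs fun n => hR n ξ⟩
  nonneg δ hδ x := by
    refine ge_of_tendsto' (x := atTop) (tendsto_integral_of_dominated_convergence _
      (fun n => ((hh n).integrable hδ x).aestronglyMeasurable)
      ((integrable_exp_neg_mul_sq_norm hδ).const_mul R)
      (fun n => ae_of_all _ fun ξ => abs_cos_mul_exp_mul_le x ξ (hR n ξ))
      (ae_of_all _ fun ξ => ((hlim ξ).const_mul _).const_mul _))
      fun n => (hh n).nonneg δ hδ x

/-- Multiplication by a mixture `∫ exp(-s|ξ|²) μ(ds)` of Gaussians (Fubini). -/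
lemma mul_laplace {h : V → ℝ} (hh : GaussPosDef h) (μ : Measure ℝ) [IsFiniteMeasure μ]
    (hμ : ∀ᵐ s ∂μ, 0 ≤ s) :
    GaussPosDef (fun ξ => h ξ * ∫ s, Real.exp (-s * ‖ξ‖ ^ 2) ∂μ) := by
  have hm := hh.measurable
  have hbd : ∀ ξ : V, ∀ᵐ s ∂μ, ‖Real.exp (-s * ‖ξ‖ ^ 2)‖ ≤ 1 := fun ξ => by
    filter_upwards [hμ] with s hs
    rw [Real.norm_eq_abs, Real.abs_exp]
    exact Real.exp_le_one_iff.2 (by nlinarith [sq_nonneg ‖ξ‖])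
  refine ⟨?_, ?_, ?_⟩
  · refine hm.mul ?_
    have : StronglyMeasurable (fun p : V × ℝ => Real.exp (-p.2 * ‖p.1‖ ^ 2)) :=
      Measurable.stronglyMeasurable (by fun_prop)
    exact this.integral_prod_right.measurable
  · obtain ⟨R, hR⟩ := hh.bounded
    refine ⟨R * (1 * μ.real univ), fun ξ => ?_⟩
    rw [abs_mul]
    have := norm_integral_le_of_norm_le_const (hbd ξ)
    rw [Real.norm_eq_abs] at this
    have h0 := (abs_nonneg _).trans (hR ξ)
    gcongr
    exact hR ξ
  · intro δ hδ x
    obtain ⟨R, hR⟩ := hh.bounded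
    have hint : Integrable (Function.uncurry fun (ξ : V) (s : ℝ) =>
        Real.cos (inner ℝ x ξ) * (Real.exp (-δ * ‖ξ‖ ^ 2) * (h ξ * Real.exp (-s * ‖ξ‖ ^ 2))))
        (volume.prod μ) := by
      have hd : Integrable (fun p : V × ℝ => R * Real.exp (-δ * ‖p.1‖ ^ 2))
          (volume.prod μ) := ((integrable_exp_neg_mul_sq_norm (V := V) hδ).const_mul R).comp_fst μ
      refine hd.mono' (by apply Measurable.aestronglyMeasurable; fun_prop) ?_
      have : ∀ᵐ p ∂((volume : Measure V).prod μ), 0 ≤ p.2 :=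
        Measure.quasiMeasurePreserving_snd.ae hμ
      filter_upwards [this] with p hp
      refine abs_cos_mul_exp_mul_le x p.1 ?_
      rw [abs_mul, Real.abs_exp]
      have : Real.exp (-p.2 * ‖p.1‖ ^ 2) ≤ 1 :=
        Real.exp_le_one_iff.2 (by nlinarith [sq_nonneg ‖p.1‖])
      nlinarith [hR p.1, abs_nonneg (h p.1)]
    have : ∀ ξ : V, Real.cos (inner ℝ x ξ) * (Real.exp (-δ * ‖ξ‖ ^ 2) *
        (h ξ * ∫ s, Real.exp (-s * ‖ξ‖ ^ 2) ∂μ)) = ∫ s, Real.cos (inner ℝ x ξ) *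
        (Real.exp (-δ * ‖ξ‖ ^ 2) * (h ξ * Real.exp (-s * ‖ξ‖ ^ 2))) ∂μ := fun ξ => by
      simp only [integral_const_mul]
    simp only [this]
    rw [integral_integral_swap hint]
    refine integral_nonneg_of_ae ?_
    filter_upwards [hμ] with s hs
    exact (hh.mul_exp hs).nonneg δ hδ x

/-- Exponentials of Laplace transforms, by the power series of `exp`: up to normalization these are
the symbols of Brownian motion subordinated to a compound Poisson process. -/
lemma exp_laplace (μ : Measure ℝ) [IsFiniteMeasure μ] (hμ : ∀ᵐ s ∂μ, 0 ≤ s) :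
    GaussPosDef (fun ξ : V => Real.exp (∫ s, Real.exp (-s * ‖ξ‖ ^ 2) ∂μ)) := by
  have hpow : ∀ k : ℕ, GaussPosDef (fun ξ : V => (∫ s, Real.exp (-s * ‖ξ‖ ^ 2) ∂μ) ^ k) := by
    intro k
    induction k with
    | zero => simpa using one
    | succ k ih => simpa only [pow_succ] using ih.mul_laplace μ hμ
  have hbd : ∀ ξ : V, |∫ s, Real.exp (-s * ‖ξ‖ ^ 2) ∂μ| ≤ μ.real univ := fun ξ => by
    have := norm_integral_le_of_norm_le_const (μ := μ) (C := 1)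
      (f := fun s => Real.exp (-s * ‖ξ‖ ^ 2)) (by
        filter_upwards [hμ] with s hs
        rw [Real.norm_eq_abs, Real.abs_exp]
        exact Real.exp_le_one_iff.2 (by nlinarith [sq_nonneg ‖ξ‖]))
    simpa using this
  refine of_tendsto (R := Real.exp (μ.real univ))
    (h := fun n ξ => ∑ k ∈ Finset.range n, ((k.factorial : ℝ)⁻¹ *
      (∫ s, Real.exp (-s * ‖ξ‖ ^ 2) ∂μ) ^ k))
    (fun n => sum _ fun k _ => (hpow k).const_mul (by positivity)) (fun n ξ => ?_) fun ξ => ?_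
  · calc |∑ k ∈ Finset.range n, ((k.factorial : ℝ)⁻¹ * (∫ s, Real.exp (-s * ‖ξ‖ ^ 2) ∂μ) ^ k)|
        ≤ ∑ k ∈ Finset.range n, (μ.real univ) ^ k / (k.factorial : ℝ) := by
          refine (Finset.abs_sum_le_sum_abs _ _).trans (Finset.sum_le_sum fun k _ => ?_)
          rw [abs_mul, abs_pow, abs_of_nonneg (by positivity : (0:ℝ) ≤ (k.factorial : ℝ)⁻¹),
            div_eq_inv_mul]
          gcongr
          exact hbd ξ
      _ ≤ _ := Real.sum_le_exp_of_nonneg measureReal_nonneg n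
  · have := (NormedSpace.expSeries_div_hasSum_exp (𝔸 := ℝ)
      (∫ s, Real.exp (-s * ‖ξ‖ ^ 2) ∂μ)).tendsto_sum_nat
    rw [← Real.exp_eq_exp_ℝ] at this
    simpa only [div_eq_inv_mul] using this

end GaussPosDef

end Gaussian

/-! ### The symbol of the isotropic stable semigroup -/

section Stable

lemma integrableOn_one_sub_exp_mul_rpow {β q : ℝ} (hβ : 0 < β) (hβ1 : β < 1) (hq : 0 ≤ q) :
    IntegrableOn (fun s : ℝ => (1 - Real.exp (-s * q)) * s ^ (-1 - β)) (Ioi 0) := by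
  have hm : AEStronglyMeasurable (fun s : ℝ => (1 - Real.exp (-s * q)) * s ^ (-1 - β)) :=
    Measurable.aestronglyMeasurable (by fun_prop)
  have key : ∀ s : ℝ, 0 < s → ‖(1 - Real.exp (-s * q)) * s ^ (-1 - β)‖ ≤ q * s ^ (-β) ∧
      ‖(1 - Real.exp (-s * q)) * s ^ (-1 - β)‖ ≤ s ^ (-1 - β) := by
    intro s hs
    have h1 : Real.exp (-s * q) ≤ 1 := Real.exp_le_one_iff.2 (by nlinarith)
    have h2 : 1 - Real.exp (-s * q) ≤ s * q := by
      have := Real.add_one_le_exp (-s * q); linarith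
    have h3 := Real.exp_pos (-s * q)
    have h4 : (0:ℝ) ≤ s ^ (-1 - β) := by positivity
    rw [Real.norm_eq_abs, abs_of_nonneg (mul_nonneg (by linarith) h4)]
    constructor
    · calc _ ≤ (s * q) * s ^ (-1 - β) := by gcongr
        _ = q * s ^ (-β) := by
          rw [show -β = 1 + (-1 - β) by ring, Real.rpow_add hs, Real.rpow_one]; ring
    · nlinarith
  rw [← Ioc_union_Ioi_eq_Ioi zero_le_one]
  refine IntegrableOn.union ?_ ?_
  · have h := intervalIntegral.intervalIntegrable_rpow' (a := 0) (b := 1) (r := -β) (by linarith)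
    rw [intervalIntegrable_iff_integrableOn_Ioc_of_le zero_le_one] at h
    refine Integrable.mono' (h.const_mul q) hm.restrict ?_
    exact (ae_restrict_iff' measurableSet_Ioc).2 (ae_of_all _ fun s hs => (key s hs.1).1)
  · refine Integrable.mono' (integrableOn_Ioi_rpow_of_lt (a := -1 - β) (by linarith) zero_lt_one)
      hm.restrict ?_
    exact (ae_restrict_iff' measurableSet_Ioi).2
      (ae_of_all _ fun s hs => (key s (zero_lt_one.trans hs)).2)

/-- The integral representing `q ^ β`, up to a constant, by scaling. -/
lemma integral_one_sub_exp_mul_rpow {β q : ℝ} (hβ : 0 < β) (hq : 0 ≤ q) :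
    ∫ s in Ioi (0 : ℝ), (1 - Real.exp (-s * q)) * s ^ (-1 - β) =
      q ^ β * ∫ s in Ioi (0 : ℝ), (1 - Real.exp (-s * 1)) * s ^ (-1 - β) := by
  rcases hq.eq_or_lt with rfl | hq
  · simp [Real.zero_rpow hβ.ne']
  have h := integral_comp_mul_left_Ioi
    (fun s : ℝ => (1 - Real.exp (-s * 1)) * s ^ (-1 - β)) 0 hq
  rw [mul_zero, smul_eq_mul] at h
  have h2 : ∫ s in Ioi (0 : ℝ), (1 - Real.exp (-(q * s) * 1)) * (q * s) ^ (-1 - β) =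
      q ^ (-1 - β) * ∫ s in Ioi (0 : ℝ), (1 - Real.exp (-s * q)) * s ^ (-1 - β) := by
    rw [← integral_const_mul]
    refine setIntegral_congr_fun measurableSet_Ioi fun s hs => ?_
    rw [Real.mul_rpow hq.le (le_of_lt hs), mul_one, show -(q * s) = -s * q by ring]
    ring
  rw [h2] at h
  have h3 : q ^ (-1 - β) * (q ^ β * q) = 1 := by
    rw [← Real.rpow_add_one hq.ne', ← Real.rpow_add hq, show -1 - β + (β + 1) = 0 by ring,
      Real.rpow_zero]
  set A := ∫ s in Ioi (0 : ℝ), (1 - Real.exp (-s * 1)) * s ^ (-1 - β)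
  set B := ∫ s in Ioi (0 : ℝ), (1 - Real.exp (-s * q)) * s ^ (-1 - β)
  calc B = (q ^ (-1 - β) * (q ^ β * q)) * B := by rw [h3, one_mul]
    _ = q ^ β * q * (q ^ (-1 - β) * B) := by ring
    _ = q ^ β * (q * q⁻¹) * A := by rw [h]; ring
    _ = q ^ β * A := by rw [mul_inv_cancel₀ hq.ne', mul_one]

lemma integral_one_sub_exp_mul_rpow_pos {β : ℝ} (hβ : 0 < β) (hβ1 : β < 1) :
    0 < ∫ s in Ioi (0 : ℝ), (1 - Real.exp (-s * 1)) * s ^ (-1 - β) := by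
  have hpos : ∀ s ∈ Ioi (0 : ℝ), 0 < (1 - Real.exp (-s * 1)) * s ^ (-1 - β) := fun s hs => by
    have h1 : Real.exp (-s * 1) < 1 := Real.exp_lt_one_iff.2 (by simpa using hs)
    exact mul_pos (by linarith) (Real.rpow_pos_of_pos hs _)
  rw [setIntegral_pos_iff_support_of_nonneg_ae]
  · have : Function.support (fun s : ℝ => (1 - Real.exp (-s * 1)) * s ^ (-1 - β)) ∩ Ioi 0 =
        Ioi 0 := inter_eq_right.2 fun s hs => (hpos s hs).ne'
    rw [this]; simp
  · exact (ae_restrict_iff' measurableSet_Ioi).2 (ae_of_all _ fun s hs => (hpos s hs).le)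
  · exact integrableOn_one_sub_exp_mul_rpow hβ hβ1 zero_le_one

variable {V : Type*} [NormedAddCommGroup V] [InnerProductSpace ℝ V] [FiniteDimensional ℝ V]
  [MeasurableSpace V] [BorelSpace V]

/-- The symbol of the isotropic `α`-stable semigroup. For `α < 2` one writes
`q^(α/2) = A⁻¹ ∫₀^∞ (1 - exp(-sq)) s^(-1-α/2) ds` and cuts off the small `s`, which makes the
subordinator compound Poisson. -/
lemma gaussPosDef_stable {α t : ℝ} (hα : 0 < α) (hα2 : α ≤ 2) (ht : 0 < t) :
    GaussPosDef (fun ξ : V => Real.exp (-t * ‖ξ‖ ^ α)) := by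
  rcases hα2.eq_or_lt with rfl | hα2
  · simpa using GaussPosDef.one.mul_exp (V := V) ht.le
  set β := α / 2 with hβdef
  have hβ : 0 < β := by positivity
  have hβ1 : β < 1 := by rw [hβdef]; linarith
  set A := ∫ s in Ioi (0 : ℝ), (1 - Real.exp (-s * 1)) * s ^ (-1 - β) with hA
  have hA0 : 0 < A := integral_one_sub_exp_mul_rpow_pos hβ hβ1
  set c : ℝ := t / A with hc
  have hc0 : 0 < c := div_pos ht hA0
  let ε : ℕ → ℝ := fun n => 1 / ((n : ℝ) + 1)
  have hε : ∀ n, 0 < ε n := fun n => by positivity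
  let μ : ℕ → Measure ℝ := fun n =>
    (volume.restrict (Ioi (ε n))).withDensity fun s => ENNReal.ofReal (c * s ^ (-1 - β))
  have hwint : ∀ n, IntegrableOn (fun s : ℝ => c * s ^ (-1 - β)) (Ioi (ε n)) := fun n =>
    (integrableOn_Ioi_rpow_of_lt (by linarith) (hε n)).const_mul c
  have hfin : ∀ n, IsFiniteMeasure (μ n) := fun n =>
    isFiniteMeasure_withDensity_ofReal (hwint n).2
  have hμ : ∀ n, ∀ᵐ s ∂(μ n), 0 ≤ s := fun n => by
    refine (withDensity_absolutelyContinuous _ _).ae_le ?_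
    exact (ae_restrict_iff' measurableSet_Ioi).2
      (ae_of_all _ fun s hs => ((hε n).trans hs).le)
  have hint : ∀ n (f : ℝ → ℝ), ∫ s, f s ∂(μ n) = ∫ s in Ioi (ε n), c * s ^ (-1 - β) * f s := by
    intro n f
    rw [integral_withDensity_eq_integral_toReal_smul (by fun_prop) (ae_of_all _ (by simp))]
    refine setIntegral_congr_fun measurableSet_Ioi fun s hs => ?_
    have : 0 < s := (hε n).trans hs
    simp only [smul_eq_mul]
    rw [ENNReal.toReal_ofReal (by positivity)]
  have hdiff : ∀ n (q : ℝ), 0 ≤ q → (∫ s, Real.exp (-s * q) ∂(μ n)) - (μ n).real univ =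
      -(c * ∫ s in Ioi (ε n), (1 - Real.exp (-s * q)) * s ^ (-1 - β)) := by
    intro n q hq
    have h1 : (μ n).real univ = ∫ s, (1 : ℝ) ∂(μ n) := by simp
    have hi : Integrable (fun s => Real.exp (-s * q)) (μ n) :=
      (integrable_const (1 : ℝ)).mono' (by fun_prop) (by
        filter_upwards [hμ n] with s hs
        rw [Real.norm_eq_abs, Real.abs_exp]
        exact Real.exp_le_one_iff.2 (by nlinarith))
    rw [h1, ← integral_sub hi (integrable_const _), hint, ← integral_const_mul, ← integral_neg]
    refine integral_congr_ae (ae_of_all _ fun s => ?_)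
    ring
  have hlim : ∀ q : ℝ, 0 ≤ q → Tendsto (fun n => ∫ s in Ioi (ε n),
      (1 - Real.exp (-s * q)) * s ^ (-1 - β)) atTop (𝓝 (q ^ β * A)) := by
    intro q hq
    rw [← integral_one_sub_exp_mul_rpow hβ hq]
    have hU : ⋃ n, Ioi (ε n) = Ioi 0 := by
      ext s
      simp only [mem_iUnion, mem_Ioi]
      exact ⟨fun ⟨n, hn⟩ => (hε n).trans hn, fun hs => exists_nat_one_div_lt hs⟩
    rw [← hU]
    refine tendsto_setIntegral_of_monotone (fun n => measurableSet_Ioi) ?_ ?_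
    · intro a b hab
      exact Ioi_subset_Ioi (Nat.one_div_le_one_div hab)
    · rw [hU]; exact integrableOn_one_sub_exp_mul_rpow hβ hβ1 hq
  have hpos : ∀ n (q : ℝ), 0 ≤ q →
      0 ≤ ∫ s in Ioi (ε n), (1 - Real.exp (-s * q)) * s ^ (-1 - β) := by
    intro n q hq
    refine setIntegral_nonneg measurableSet_Ioi fun s hs => ?_
    have : 0 < s := (hε n).trans hs
    have h1 : Real.exp (-s * q) ≤ 1 := Real.exp_le_one_iff.2 (by nlinarith)
    exact mul_nonneg (by linarith) (by positivity)
  refine GaussPosDef.of_tendsto (R := 1) (h := fun n ξ => Real.exp (-(μ n).real univ) *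
      Real.exp (∫ s, Real.exp (-s * ‖ξ‖ ^ 2) ∂(μ n)))
    (fun n => (GaussPosDef.exp_laplace (μ n) (hμ n)).const_mul (Real.exp_pos _).le) ?_ ?_
  · intro n ξ
    rw [← Real.exp_add, Real.abs_exp, Real.exp_le_one_iff, neg_add_eq_sub,
      hdiff n _ (sq_nonneg _), neg_nonpos]
    exact mul_nonneg hc0.le (hpos n _ (sq_nonneg _))
  · intro ξ
    have h1 : -t * ‖ξ‖ ^ α = -(c * ((‖ξ‖ ^ 2) ^ β * A)) := by
      rw [← Real.rpow_natCast, ← Real.rpow_mul (norm_nonneg _), hc]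
      have : ((2 : ℕ) : ℝ) * β = α := by rw [hβdef]; push_cast; ring
      rw [this]; field_simp
    rw [h1]
    refine ((Real.continuous_exp.tendsto _).comp
      (((hlim (‖ξ‖ ^ 2) (sq_nonneg _)).const_mul c).neg)).congr fun n => ?_
    rw [Function.comp_apply, ← hdiff n _ (sq_nonneg _), ← Real.exp_add, neg_add_eq_sub]

lemma integrable_exp_neg_mul_rpow_norm [Nontrivial V] {α t : ℝ} (hα : 0 < α) (ht : 0 < t) :
    Integrable (fun ξ : V => Real.exp (-t * ‖ξ‖ ^ α)) := by
  refine (integrable_fun_norm_addHaar (E := V) volume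
    (f := fun y : ℝ => Real.exp (-t * y ^ α))).2 ?_
  have h := integrableOn_rpow_mul_exp_neg_mul_rpow (p := α) (b := t)
    (s := ((Module.finrank ℝ V - 1 : ℕ) : ℝ)) (neg_one_lt_zero.trans_le (Nat.cast_nonneg _)) hα ht
  simpa only [Real.rpow_natCast, smul_eq_mul] using h

end Stable

/-! ### The heat kernel -/

section HeatKernel

variable {d : ℕ} {α t : ℝ}

lemma nontrivial_space (hd : 1 ≤ d) : Nontrivial (Space d) := by
  have : Nonempty (Fin d) := ⟨⟨0, hd⟩⟩
  infer_instance

lemma measurable_heatKernel (d : ℕ) (α : ℝ) :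
    Measurable (fun p : ℝ × Space d => heatKernel d α p.1 p.2) := by
  have : StronglyMeasurable (fun q : (ℝ × Space d) × Space d =>
      Real.cos (inner ℝ q.1.2 q.2) * Real.exp (-q.1.1 * ‖q.2‖ ^ α)) :=
    Measurable.stronglyMeasurable (by fun_prop)
  exact this.integral_prod_right.measurable.const_mul _

lemma measurable_heatKernel_comp {Θ : Type*} [MeasurableSpace Θ] (α : ℝ) {s : Θ → ℝ}
    (hs : Measurable s) {x : Θ → Space d} (hx : Measurable x) :
    Measurable (fun θ => heatKernel d α (s θ) (x θ)) :=
  Measurable.comp (g := fun p : ℝ × Space d => heatKernel d α p.1 p.2)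
    (f := fun θ => (s θ, x θ)) (measurable_heatKernel d α) (hs.prodMk hx)

/-- The heat kernel is nonnegative: remove the Gaussian regularization in `gaussPosDef_stable`. -/
lemma heatKernel_nonneg (hd : 1 ≤ d) (hα : 0 < α) (hα2 : α ≤ 2) (ht : 0 < t) (x : Space d) :
    0 ≤ heatKernel d α t x := by
  have := nontrivial_space hd
  have hG := gaussPosDef_stable (V := Space d) hα hα2 ht
  have hI := integrable_exp_neg_mul_rpow_norm (V := Space d) hα ht
  refine mul_nonneg (by positivity) ?_
  have hlim : ∀ ξ : Space d, Tendsto (fun n : ℕ => Real.cos (inner ℝ x ξ) *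
      (Real.exp (-(1 / ((n : ℝ) + 1)) * ‖ξ‖ ^ 2) * Real.exp (-t * ‖ξ‖ ^ α))) atTop
      (𝓝 (Real.cos (inner ℝ x ξ) * Real.exp (-t * ‖ξ‖ ^ α))) := fun ξ => by
    have h1 : Tendsto (fun n : ℕ => Real.exp (-(1 / ((n : ℝ) + 1)) * ‖ξ‖ ^ 2)) atTop (𝓝 1) := by
      have := (Real.continuous_exp.tendsto _).comp
        ((tendsto_one_div_add_atTop_nhds_zero_nat (𝕜 := ℝ)).neg.mul_const (‖ξ‖ ^ 2))
      simpa [Function.comp_def] using this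
    simpa using (h1.mul_const (Real.exp (-t * ‖ξ‖ ^ α))).const_mul (Real.cos (inner ℝ x ξ))
  refine ge_of_tendsto' (x := atTop) (tendsto_integral_of_dominated_convergence _
    (fun n => (hG.integrable (by positivity : 0 < 1 / ((n : ℝ) + 1)) x).aestronglyMeasurable)
    hI (fun n => ae_of_all _ fun ξ => ?_) (ae_of_all _ hlim))
    fun n => hG.nonneg _ (by positivity) x
  rw [norm_mul, norm_mul, Real.norm_eq_abs, Real.norm_eq_abs, Real.norm_eq_abs, Real.abs_exp,
    Real.abs_exp]
  have h1 := Real.abs_cos_le_one (inner ℝ x ξ)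
  have h2 : Real.exp (-(1 / ((n : ℝ) + 1)) * ‖ξ‖ ^ 2) ≤ 1 := Real.exp_le_one_iff.2 (by
    have : 0 ≤ 1 / ((n : ℝ) + 1) := by positivity
    nlinarith [sq_nonneg ‖ξ‖])
  have h3 := Real.exp_pos (-(1 / ((n : ℝ) + 1)) * ‖ξ‖ ^ 2)
  have h4 := Real.exp_pos (-t * ‖ξ‖ ^ α)
  calc _ ≤ 1 * (1 * Real.exp (-t * ‖ξ‖ ^ α)) := by gcongr
    _ = _ := by ring

lemma abs_heatKernel_le (t : ℝ) (x : Space d)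
    (hI : Integrable (fun ξ : Space d => Real.exp (-t * ‖ξ‖ ^ α))) :
    |heatKernel d α t x| ≤
      ((2 * Real.pi) ^ d)⁻¹ * ∫ ξ : Space d, Real.exp (-t * ‖ξ‖ ^ α) := by
  rw [heatKernel, abs_mul, abs_of_pos (by positivity)]
  gcongr
  refine norm_integral_le_of_norm_le (f := fun ξ : Space d =>
    Real.cos (inner ℝ x ξ) * Real.exp (-t * ‖ξ‖ ^ α)) hI (ae_of_all _ fun ξ => ?_)
  rw [norm_mul, Real.norm_eq_abs, Real.norm_eq_abs, Real.abs_exp]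
  exact mul_le_of_le_one_left (Real.exp_pos _).le (Real.abs_cos_le_one _)

/-- Regularized mass of the heat kernel: by Fubini it is the average of the symbol `≤ 1` against a
Gaussian probability density. -/
lemma integral_heatKernel_mul_exp_le (hd : 1 ≤ d) (hα : 0 < α) (ht : 0 < t) {δ : ℝ}
    (hδ : 0 < δ) :
    ∫ x : Space d, heatKernel d α t x * Real.exp (-δ * ‖x‖ ^ 2) ≤ 1 := by
  have := nontrivial_space hd
  have hI := integrable_exp_neg_mul_rpow_norm (V := Space d) hα ht
  have hE := integrable_exp_neg_mul_sq_norm (V := Space d) hδ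
  have hE4 := integrable_exp_neg_mul_sq_norm (V := Space d) (δ := (4 * δ)⁻¹) (by positivity)
  have hint : Integrable (Function.uncurry fun (x ξ : Space d) =>
      (Real.cos (inner ℝ ξ x) * Real.exp (-δ * ‖x‖ ^ 2)) * Real.exp (-t * ‖ξ‖ ^ α))
      (volume.prod volume) := by
    refine (hE.mul_prod hI).mono' (by apply Measurable.aestronglyMeasurable; fun_prop)
      (ae_of_all _ fun p => ?_)
    simp only [Function.uncurry]
    rw [norm_mul, norm_mul, Real.norm_eq_abs, Real.norm_eq_abs, Real.norm_eq_abs, Real.abs_exp,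
      Real.abs_exp]
    gcongr
    exact mul_le_of_le_one_left (Real.exp_pos _).le (Real.abs_cos_le_one _)
  have hdim : Module.finrank ℝ (Space d) = d := by simp
  have h1 : ∀ x : Space d, heatKernel d α t x * Real.exp (-δ * ‖x‖ ^ 2) =
      ((2 * Real.pi) ^ d)⁻¹ * ∫ ξ : Space d,
        (Real.cos (inner ℝ ξ x) * Real.exp (-δ * ‖x‖ ^ 2)) * Real.exp (-t * ‖ξ‖ ^ α) := by
    intro x
    rw [heatKernel, mul_assoc, ← integral_mul_const]
    congr 1
    refine integral_congr_ae (ae_of_all _ fun ξ => ?_)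
    simp only [real_inner_comm x ξ]
    ring
  simp only [h1]
  rw [integral_const_mul, integral_integral_swap hint]
  simp only [integral_mul_const, integral_cos_inner_mul_exp hδ, hdim]
  have h2 : ∫ ξ : Space d, (Real.pi / δ) ^ ((d : ℝ) / 2) * Real.exp (-‖ξ‖ ^ 2 / (4 * δ)) *
      Real.exp (-t * ‖ξ‖ ^ α) ≤
      ∫ ξ : Space d, (Real.pi / δ) ^ ((d : ℝ) / 2) * Real.exp (-(4 * δ)⁻¹ * ‖ξ‖ ^ 2) := by
    refine integral_mono_of_nonneg (ae_of_all _ fun ξ => by positivity) (hE4.const_mul _)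
      (ae_of_all _ fun ξ => ?_)
    have : Real.exp (-t * ‖ξ‖ ^ α) ≤ 1 := Real.exp_le_one_iff.2 (by
      have : 0 ≤ ‖ξ‖ ^ α := by positivity
      nlinarith)
    simp only
    rw [show -‖ξ‖ ^ 2 / (4 * δ) = -(4 * δ)⁻¹ * ‖ξ‖ ^ 2 by field_simp]
    exact mul_le_of_le_one_right (by positivity) this
  refine (mul_le_mul_of_nonneg_left h2 (by positivity)).trans_eq ?_
  rw [integral_const_mul, GaussianFourier.integral_rexp_neg_mul_sq_norm (by positivity), hdim,
    ← Real.mul_rpow (by positivity) (by positivity),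
    show Real.pi / δ * (Real.pi / (4 * δ)⁻¹) = (2 * Real.pi) ^ (2 : ℝ) by
      rw [Real.rpow_two]; field_simp; ring, ← Real.rpow_mul (by positivity),
    show (2 : ℝ) * ((d : ℝ) / 2) = d by ring, Real.rpow_natCast]
  exact inv_mul_cancel₀ (by positivity)

/-- The heat kernel has mass at most `1`: remove the Gaussian regularization of the mass by Fatou's
lemma. -/
lemma lintegral_heatKernel_le (hd : 1 ≤ d) (hα : 0 < α) (hα2 : α ≤ 2) (ht : 0 < t) :
    ∫⁻ x : Space d, ‖heatKernel d α t x‖ₑ ≤ 1 := by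
  have := nontrivial_space hd
  have hI := integrable_exp_neg_mul_rpow_norm (V := Space d) hα ht
  have hm : Measurable (fun x => heatKernel d α t x) :=
    measurable_heatKernel_comp α measurable_const measurable_id
  let F : ℕ → Space d → ℝ≥0∞ := fun n x =>
    ENNReal.ofReal (heatKernel d α t x * Real.exp (-(1 / ((n : ℝ) + 1)) * ‖x‖ ^ 2))
  have hF : ∀ n, ∫⁻ x, F n x ≤ 1 := fun n => by
    have hδ : 0 < 1 / ((n : ℝ) + 1) := by positivity
    have hint : Integrable (fun x : Space d =>
        heatKernel d α t x * Real.exp (-(1 / ((n : ℝ) + 1)) * ‖x‖ ^ 2)) := by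
      refine ((integrable_exp_neg_mul_sq_norm (V := Space d) hδ).const_mul
        (((2 * Real.pi) ^ d)⁻¹ * ∫ ξ : Space d, Real.exp (-t * ‖ξ‖ ^ α))).mono' ?_
        (ae_of_all _ fun x => ?_)
      · exact (hm.mul (by fun_prop)).aestronglyMeasurable
      · rw [norm_mul, Real.norm_eq_abs, Real.norm_eq_abs, Real.abs_exp]
        gcongr
        exact abs_heatKernel_le t x hI
    rw [← ofReal_integral_eq_lintegral_ofReal hint
      (ae_of_all _ fun x => mul_nonneg (heatKernel_nonneg hd hα hα2 ht x) (Real.exp_pos _).le)]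
    exact ENNReal.ofReal_le_one.2 (integral_heatKernel_mul_exp_le hd hα ht hδ)
  have hlim : ∀ x, Tendsto (fun n => F n x) atTop (𝓝 ‖heatKernel d α t x‖ₑ) := fun x => by
    have h1 : Tendsto (fun n : ℕ => Real.exp (-(1 / ((n : ℝ) + 1)) * ‖x‖ ^ 2)) atTop (𝓝 1) := by
      have := (Real.continuous_exp.tendsto _).comp
        ((tendsto_one_div_add_atTop_nhds_zero_nat (𝕜 := ℝ)).neg.mul_const (‖x‖ ^ 2))
      simpa [Function.comp_def] using this
    have h2 := ENNReal.tendsto_ofReal (h1.const_mul (heatKernel d α t x))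
    rwa [mul_one, ← Real.enorm_of_nonneg (heatKernel_nonneg hd hα hα2 ht x)] at h2
  calc ∫⁻ x : Space d, ‖heatKernel d α t x‖ₑ = ∫⁻ x, liminf (fun n => F n x) atTop :=
        lintegral_congr fun x => (hlim x).liminf_eq.symm
    _ ≤ liminf (fun n => ∫⁻ x, F n x) atTop := lintegral_liminf_le fun n =>
        (hm.mul (by fun_prop)).ennreal_ofReal
    _ ≤ 1 := by
        refine (liminf_le_liminf (Eventually.of_forall hF)).trans ?_
        simp

/-- The heat semigroup is a contraction of `L^∞`, pointwise in `x` for positive times. -/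
lemma enorm_heatConv_le (hd : 1 ≤ d) (hα : 0 < α) (hα2 : α ≤ 2) {s : ℝ≥0} (hs : s ≠ 0)
    (h : Space d → ℝ) (x : Space d) :
    ‖heatConv α s h x‖ₑ ≤ eLpNorm h ∞ volume := by
  rw [heatConv, if_neg hs]
  have hs' : 0 < (s : ℝ) := by positivity
  have hm : ∀ x : Space d, Measurable (fun y => heatKernel d α s (x - y)) := fun x =>
    measurable_heatKernel_comp α measurable_const (measurable_const.sub measurable_id)
  calc ‖∫ y, heatKernel d α s (x - y) * h y‖ₑ ≤ ∫⁻ y, ‖heatKernel d α s (x - y) * h y‖ₑ :=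
        enorm_integral_le_lintegral_enorm _
    _ ≤ ∫⁻ y, ‖heatKernel d α s (x - y)‖ₑ * eLpNorm h ∞ volume := by
        refine lintegral_mono_ae ?_
        rw [eLpNorm_exponent_top]
        filter_upwards [enorm_ae_le_eLpNormEssSup h volume] with y hy
        rw [enorm_mul]
        gcongr
    _ = (∫⁻ y, ‖heatKernel d α s (x - y)‖ₑ) * eLpNorm h ∞ volume :=
        lintegral_mul_const _ (hm x).enorm
    _ = (∫⁻ y, ‖heatKernel d α s y‖ₑ) * eLpNorm h ∞ volume := by
        rw [lintegral_sub_left_eq_self (μ := volume) (fun y => ‖heatKernel d α s y‖ₑ) x]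
    _ ≤ 1 * eLpNorm h ∞ volume := by gcongr; exact lintegral_heatKernel_le hd hα hα2 hs'
    _ = _ := one_mul _

/-- Convolution with the heat kernel of a measurable family of functions, at varying times, is
measurable in all variables. -/
lemma measurable_heatConv {Θ : Type*} [MeasurableSpace Θ] (α : ℝ) {s : Θ → ℝ≥0}
    (hs : Measurable s) {G : Θ × Space d → ℝ} (hG : Measurable G) {x : Θ → Space d}
    (hx : Measurable x) :
    Measurable (fun θ => heatConv α (s θ) (fun y => G (θ, y)) (x θ)) := by
  unfold heatConv
  refine Measurable.ite (hs (measurableSet_singleton 0)) (hG.comp (measurable_id.prodMk hx)) ?_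
  have : StronglyMeasurable (fun q : Θ × Space d =>
      heatKernel d α (s q.1) (x q.1 - q.2) * G q) := by
    refine Measurable.stronglyMeasurable (Measurable.mul ?_ hG)
    exact measurable_heatKernel_comp α (by fun_prop) (by fun_prop)
  exact this.integral_prod_right.measurable

end HeatKernel

/-! ### Bounded martingales and the predictable σ-algebra -/

section Martingale

lemma integral_mul_condExp {Ω : Type*} {m' m : MeasurableSpace Ω} {P : Measure Ω}
    [IsFiniteMeasure P] (hm : m' ≤ m) {f g : Ω → ℝ} (hf : AEStronglyMeasurable[m'] f P)
    (hfg : Integrable (f * g) P) (hg : Integrable g P) :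
    ∫ ω, f ω * (P[g|m']) ω ∂P = ∫ ω, f ω * g ω ∂P := by
  have h := integral_condExp (μ := P) (f := f * g) hm
  rw [integral_congr_ae (condExp_mul_of_aestronglyMeasurable_left hf hfg hg)] at h
  exact h

variable {Ω : Type*} {m : MeasurableSpace Ω} {P : Measure Ω} [IsProbabilityMeasure P]
  {ℱ : Filtration ℝ≥0 m} {M : ℝ≥0 → Ω → ℝ}

lemma integral_sq_sub_of_martingale (hM : Martingale M ℱ P) {R : ℝ} (hR : ∀ r ω, |M r ω| ≤ R)
    {s r : ℝ≥0} (hsr : s ≤ r) :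
    ∫ ω, (M r ω - M s ω) ^ 2 ∂P = ∫ ω, M r ω ^ 2 ∂P - ∫ ω, M s ω ^ 2 ∂P := by
  have hmeas : ∀ r, AEStronglyMeasurable (M r) P := fun r => (hM.integrable r).1
  have hint : ∀ a b, Integrable (fun ω => M a ω * M b ω) P := fun a b =>
    (hM.integrable b).bdd_mul (hmeas a) (ae_of_all _ (hR a))
  have hcross : ∫ ω, M s ω * M r ω ∂P = ∫ ω, M s ω * M s ω ∂P := by
    rw [← integral_mul_condExp (ℱ.le s) (hM.stronglyMeasurable s).aestronglyMeasurable
      (hint s r) (hM.integrable r)]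
    refine integral_congr_ae ?_
    filter_upwards [hM.condExp_ae_eq hsr] with ω hω
    rw [hω]
  have : ∀ ω, (M r ω - M s ω) ^ 2 = M r ω * M r ω - 2 * (M s ω * M r ω) + M s ω * M s ω :=
    fun ω => by ring
  simp only [this, pow_two]
  have hi : Integrable (fun ω => M r ω * M r ω - 2 * (M s ω * M r ω)) P :=
    (hint r r).sub ((hint s r).const_mul 2)
  rw [integral_add hi (hint s s),
    integral_sub (hint r r) ((hint s r).const_mul 2), integral_const_mul, hcross]
  ring

lemma integral_abs_sub_sq_le_of_martingale (hM : Martingale M ℱ P) {R : ℝ}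
    (hR : ∀ r ω, |M r ω| ≤ R) {s r : ℝ≥0} (hsr : s ≤ r) :
    (∫ ω, |M r ω - M s ω| ∂P) ^ 2 ≤ ∫ ω, M r ω ^ 2 ∂P - ∫ ω, M s ω ^ 2 ∂P := by
  rw [← integral_sq_sub_of_martingale hM hR hsr]
  have hZ : Integrable (fun ω => M r ω - M s ω) P := (hM.integrable r).sub (hM.integrable s)
  have hZ2 : Integrable (fun ω => (M r ω - M s ω) ^ 2) P := by
    simp only [pow_two]
    refine hZ.bdd_mul hZ.1 (c := R + R) (ae_of_all _ fun ω => ?_)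
    exact (abs_sub _ _).trans (add_le_add (hR r ω) (hR s ω))
  set c := ∫ ω, |M r ω - M s ω| ∂P with hc
  have h0 : 0 ≤ ∫ ω, (|M r ω - M s ω| - c) ^ 2 ∂P := integral_nonneg fun ω => sq_nonneg _
  have : ∀ ω, (|M r ω - M s ω| - c) ^ 2 =
      (M r ω - M s ω) ^ 2 - 2 * c * |M r ω - M s ω| + c ^ 2 := fun ω => by
    rw [sub_sq, sq_abs]; ring
  simp only [this] at h0
  have hi : Integrable (fun ω => (M r ω - M s ω) ^ 2 - 2 * c * |M r ω - M s ω|) P :=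
    hZ2.sub (hZ.abs.const_mul _)
  rw [integral_add hi (integrable_const _),
    integral_sub hZ2 (hZ.abs.const_mul _), integral_const_mul, ← hc] at h0
  simp only [integral_const, probReal_univ, one_smul] at h0
  nlinarith

/-- A bounded martingale, indexed by continuous time, is left-continuous in mean at all but
countably many times: its second moment is nondecreasing. No regularity of the filtration is
needed. -/
lemma countable_not_leftContinuous_of_martingale (hM : Martingale M ℱ P) {R : ℝ}
    (hR : ∀ r ω, |M r ω| ≤ R) :
    ∃ D : Set ℝ≥0, D.Countable ∧ ∀ r ∉ D, ∀ s : ℕ → ℝ≥0, (∀ n, s n ≤ r) →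
      Tendsto s atTop (𝓝 r) → Tendsto (fun n => ∫ ω, |M r ω - M (s n) ω| ∂P) atTop (𝓝 0) := by
  set φ : ℝ≥0 → ℝ := fun r => ∫ ω, M r ω ^ 2 ∂P with hφ
  have hmono : Monotone φ := fun s r hsr => by
    have := integral_abs_sub_sq_le_of_martingale hM hR hsr
    have h2 := sq_nonneg (∫ ω, |M r ω - M s ω| ∂P)
    simp only [hφ]; linarith
  refine ⟨_, hmono.countable_not_continuousAt, fun r hr s hs hlim => ?_⟩
  have hcont : ContinuousAt φ r := by simpa using hr
  have h1 : Tendsto (fun n => φ r - φ (s n)) atTop (𝓝 0) := by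
    simpa using (hcont.tendsto.comp hlim).const_sub (φ r)
  have h2 : Tendsto (fun n => (∫ ω, |M r ω - M (s n) ω| ∂P) ^ 2) atTop (𝓝 0) :=
    squeeze_zero (fun n => sq_nonneg _)
      (fun n => integral_abs_sub_sq_le_of_martingale hM hR (hs n)) h1
  have h3 := (Real.continuous_sqrt.tendsto 0).comp h2
  rw [Real.sqrt_zero] at h3
  refine h3.congr fun n => ?_
  exact Real.sqrt_sq (integral_nonneg fun ω => abs_nonneg _)

end Martingale

section Predictable

variable {Ω X : Type*} {m : MeasurableSpace Ω} [MeasurableSpace X]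

/-- The predictable σ-algebra on `Ω × X`, where the parameter `x ∈ X` occurs at time `τ x`: it is
generated by the rectangles `F × B` such that `F` is known strictly before the time of each point
of `B` (or at time `0`). For `X = E × ℝ₊` and `τ (v, r) = r` this is the product of the Borel
σ-algebra of `E` and the usual predictable σ-algebra. -/
@[reducible]
def predictable (ℱ : Filtration ℝ≥0 m) (τ : X → ℝ≥0) : MeasurableSpace (Ω × X) :=
  MeasurableSpace.generateFrom {S | ∃ (a : ℝ≥0) (F : Set Ω) (B : Set X),
    MeasurableSet[ℱ a] F ∧ MeasurableSet B ∧ (∀ x ∈ B, a < τ x ∨ a = 0) ∧ S = F ×ˢ B}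

variable {ℱ : Filtration ℝ≥0 m} {τ : X → ℝ≥0}

lemma measurableSet_predictable {a : ℝ≥0} {F : Set Ω} {B : Set X} (hF : MeasurableSet[ℱ a] F)
    (hB : MeasurableSet B) (ha : ∀ x ∈ B, a < τ x ∨ a = 0) :
    MeasurableSet[predictable ℱ τ] (F ×ˢ B) :=
  MeasurableSpace.measurableSet_generateFrom ⟨a, F, B, hF, hB, ha, rfl⟩

lemma predictable_le (ℱ : Filtration ℝ≥0 m) (τ : X → ℝ≥0) :
    predictable ℱ τ ≤ (inferInstance : MeasurableSpace (Ω × X)) := by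
  refine MeasurableSpace.generateFrom_le ?_
  rintro _ ⟨a, F, B, hF, hB, -, rfl⟩
  exact (ℱ.le a F hF).prod hB

lemma measurable_snd_predictable : Measurable[predictable ℱ τ] (Prod.snd : Ω × X → X) := by
  intro B hB
  have : (Prod.snd ⁻¹' B : Set (Ω × X)) = univ ×ˢ B := by ext; simp
  rw [this]
  exact measurableSet_predictable (a := 0) MeasurableSet.univ hB fun _ _ => Or.inr rfl

lemma measurable_section_predictable (x : X) :
    Measurable[ℱ (τ x), predictable ℱ τ] (fun ω : Ω => (ω, x)) := by
  refine @measurable_generateFrom _ _ (ℱ (τ x)) _ _ ?_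
  rintro _ ⟨a, F, B, hF, hB, ha, rfl⟩
  by_cases hx : x ∈ B
  · have hle : a ≤ τ x := by
      rcases ha x hx with h | h
      · exact h.le
      · rw [h]; exact zero_le
    have : (fun ω : Ω => (ω, x)) ⁻¹' F ×ˢ B = F := by ext; simp [hx]
    rw [this]
    exact ℱ.mono hle F hF
  · have : (fun ω : Ω => (ω, x)) ⁻¹' F ×ˢ B = ∅ := by ext; simp [hx]
    rw [this]
    exact @MeasurableSet.empty _ (ℱ (τ x))

/-- The last point of the grid `ℕ / (n + 1)` strictly before `r > 0`; it is `0` for `r = 0`, where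
the subtraction truncates. -/
def gridBefore (n : ℕ) (r : ℝ≥0) : ℝ≥0 := ((⌈r * (n + 1)⌉₊ - 1 : ℕ) : ℝ≥0) / (n + 1)

lemma gridBefore_lt (n : ℕ) (r : ℝ≥0) : gridBefore n r < r ∨ gridBefore n r = 0 := by
  unfold gridBefore
  rcases Nat.eq_zero_or_pos (⌈r * (n + 1)⌉₊ - 1) with h | h
  · right; simp [h]
  · left
    rw [div_lt_iff₀ (by positivity)]
    exact Nat.lt_ceil.1 (by omega)

lemma gridBefore_le (n : ℕ) (r : ℝ≥0) : gridBefore n r ≤ r := by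
  rcases gridBefore_lt n r with h | h
  · exact h.le
  · rw [h]; exact zero_le

lemma tendsto_gridBefore (r : ℝ≥0) : Tendsto (fun n => gridBefore n r) atTop (𝓝 r) := by
  have h1 : ∀ n : ℕ, r - 1 / ((n : ℝ≥0) + 1) ≤ gridBefore n r := fun n => by
    rw [tsub_le_iff_right, gridBefore, ← add_div, le_div_iff₀ (by positivity)]
    refine (Nat.le_ceil _).trans ?_
    have : ⌈r * (n + 1)⌉₊ ≤ (⌈r * (n + 1)⌉₊ - 1) + 1 := by omega
    exact_mod_cast this
  have h2 : Tendsto (fun n : ℕ => r - 1 / ((n : ℝ≥0) + 1)) atTop (𝓝 r) := by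
    have h0 : Tendsto (fun n : ℕ => 1 / ((n : ℝ≥0) + 1)) atTop (𝓝 0) :=
      tendsto_one_div_add_atTop_nhds_zero_nat (𝕜 := ℝ≥0)
    simpa using (tendsto_const_nhds (x := r)).sub h0
  exact tendsto_of_tendsto_of_tendsto_of_le_of_le h2 tendsto_const_nhds h1
    fun n => gridBefore_le n r

lemma measurable_comp_gridBefore (hτ : Measurable τ) {M : ℝ≥0 → Ω → ℝ}
    (hM : ∀ r, Measurable[ℱ r] (M r)) (n : ℕ) :
    Measurable[predictable ℱ τ] (fun p : Ω × X => M (gridBefore n (τ p.2)) p.1) := by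
  intro U hU
  have : (fun p : Ω × X => M (gridBefore n (τ p.2)) p.1) ⁻¹' U =
      ⋃ j : ℕ, (M ((j : ℝ≥0) / (n + 1)) ⁻¹' U) ×ˢ {x | ⌈τ x * (n + 1)⌉₊ - 1 = j} := by
    ext p
    simp [gridBefore]
  rw [this]
  refine MeasurableSet.iUnion fun j => ?_
  refine measurableSet_predictable (hM _ hU) ?_ fun x hx => ?_
  · have : Measurable fun x => ⌈τ x * (n + 1)⌉₊ - 1 :=
      (measurable_from_top (f := fun k : ℕ => k - 1)).comp
        (Nat.measurable_ceil.comp (by fun_prop))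
    exact this (measurableSet_singleton j)
  · have := gridBefore_lt n (τ x)
    rw [gridBefore, hx] at this
    exact this

end Predictable

/-! ### Predictable versions of adapted fields -/

section PredictableVersion

variable {Ω X : Type*} {m : MeasurableSpace Ω} [MeasurableSpace X] {P : Measure Ω}
  {ℱ : Filtration ℝ≥0 m} {τ : X → ℝ≥0}

/-- The martingale `P(A | ℱ_r)`, in a version with values in `[-1, 1]`. -/
lemma exists_bounded_martingale_indicator [IsProbabilityMeasure P] (ℱ : Filtration ℝ≥0 m)
    (A : Set Ω) :
    ∃ M : ℝ≥0 → Ω → ℝ, Martingale M ℱ P ∧ (∀ r ω, |M r ω| ≤ 1) ∧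
      ∀ r, M r =ᵐ[P] P[A.indicator (fun _ => (1 : ℝ)) | ℱ r] := by
  set f : Ω → ℝ := A.indicator (fun _ => (1 : ℝ)) with hf
  have hbd : ∀ r, ∀ᵐ ω ∂P, |(P[f | ℱ r]) ω| ≤ 1 := fun r =>
    ae_bdd_abs_condExp_of_ae_bdd_abs (ae_of_all _ fun ω => by
      by_cases h : ω ∈ A <;> simp [hf, h])
  have hM0 := martingale_condExp f ℱ P
  let M : ℝ≥0 → Ω → ℝ := fun r ω => max (-1) (min 1 ((P[f | ℱ r]) ω))
  have hae : ∀ r, M r =ᵐ[P] P[f | ℱ r] := fun r => by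
    filter_upwards [hbd r] with ω hω
    rw [abs_le] at hω
    simp only [M]
    rw [min_eq_right hω.2, max_eq_right hω.1]
  refine ⟨M, ⟨fun r => ?_, fun s r hsr => ?_⟩, fun r ω => ?_, hae⟩
  · exact (continuous_const.max (continuous_const.min continuous_id)).comp_stronglyMeasurable
      (hM0.stronglyMeasurable r)
  · exact (condExp_congr_ae (hae r)).trans ((hM0.condExp_ae_eq hsr).trans (hae s).symm)
  · rw [abs_le]
    exact ⟨le_max_left _ _, max_le (by norm_num) (min_le_left _ _)⟩

/-- An adapted bounded measurable field has a predictable version: the difference between the field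
and its conditional expectation given the predictable σ-algebra is orthogonal to every rectangle
`A × B`, because `1_A` may be replaced by `P(A | ℱ_{τ x})` and, off a null set of `x`, by its values
at earlier grid times, which are predictable. -/
lemma aestronglyMeasurable_predictable_of_bounded [IsProbabilityMeasure P] {η : Measure X}
    [IsFiniteMeasure η] (hτ : Measurable τ) (hη : ∀ r, η (τ ⁻¹' {r}) = 0) {G : Ω × X → ℝ}
    (hG : Measurable G) {R : ℝ≥0} (hR : ∀ p, |G p| ≤ R)
    (had : ∀ x, AEStronglyMeasurable[ℱ (τ x)] (fun ω => G (ω, x)) P) :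
    AEStronglyMeasurable[predictable ℱ τ] G (P.prod η) := by
  set ρ : Measure (Ω × X) := P.prod η with hρ
  have hle := predictable_le ℱ τ
  have hGint : Integrable G ρ :=
    (integrable_const (R : ℝ)).mono' hG.aestronglyMeasurable (ae_of_all _ hR)
  set G' : Ω × X → ℝ := ρ[G | predictable ℱ τ] with hG'
  have hG'm : StronglyMeasurable[predictable ℱ τ] G' := stronglyMeasurable_condExp
  have hG'int : Integrable G' ρ := integrable_condExp
  have hG'bd : ∀ᵐ p ∂ρ, |G' p| ≤ R := ae_bdd_abs_condExp_of_ae_bdd_abs (ae_of_all _ hR)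
  have hG'm0 : Measurable G' := (hG'm.mono hle).measurable
  set k : Ω × X → ℝ := fun p => G p - G' p with hk
  have hkm : Measurable k := hG.sub hG'm0
  have hkint : Integrable k ρ := hGint.sub hG'int
  have hkbd : ∀ᵐ p ∂ρ, |k p| ≤ R + R := by
    filter_upwards [hG'bd] with p hp
    exact (abs_sub _ _).trans (add_le_add (hR p) hp)
  have hkbd' : ∀ᵐ x ∂η, ∀ᵐ ω ∂P, |k (ω, x)| ≤ R + R := by
    have h := Measure.ae_ae_of_ae_prod hkbd
    refine (Measure.ae_ae_comm ?_).1 h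
    exact measurableSet_le (by fun_prop) measurable_const
  have hkad : ∀ x, AEStronglyMeasurable[ℱ (τ x)] (fun ω => k (ω, x)) P := fun x => by
    refine (had x).sub (StronglyMeasurable.aestronglyMeasurable ?_)
    exact hG'm.comp_measurable (measurable_section_predictable x)
  have hksec : ∀ x, AEStronglyMeasurable (fun ω => k (ω, x)) P := fun x =>
    (hkm.comp measurable_prodMk_right).aestronglyMeasurable
  -- orthogonality to bounded predictable functions
  have horth : ∀ (W : Ω × X → ℝ) (C : ℝ), Measurable[predictable ℱ τ] W → (∀ p, |W p| ≤ C) →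
      ∫ p, W p * k p ∂ρ = 0 := by
    intro W C hW hWC
    have hWi : ∀ f : Ω × X → ℝ, Integrable f ρ → Integrable (fun p => W p * f p) ρ := fun f hf =>
      hf.bdd_mul (hW.mono hle le_rfl).aestronglyMeasurable (ae_of_all _ hWC)
    have h1 := integral_mul_condExp (P := ρ) hle (f := W) (g := G)
      hW.stronglyMeasurable.aestronglyMeasurable (hWi G hGint) hGint
    simp only [hk, mul_sub]
    rw [integral_sub (hWi G hGint) (hWi G' hG'int), ← h1, sub_self]
  have hrect : ∀ (A : Set Ω) (B : Set X), MeasurableSet A → MeasurableSet B →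
      ∫ p in A ×ˢ B, k p ∂ρ = 0 := by
    intro A B hA hB
    obtain ⟨M, hM, hM1, hMA⟩ := exists_bounded_martingale_indicator (P := P) ℱ A
    obtain ⟨D, hD, hcont⟩ := countable_not_leftContinuous_of_martingale hM hM1
    have hDnull : ∀ᵐ x ∂η, τ x ∉ D := by
      have : η (τ ⁻¹' D) = 0 := by
        rw [← biUnion_preimage_singleton, measure_biUnion_null_iff hD]
        exact fun r _ => hη r
      exact measure_eq_zero_iff_ae_notMem.1 this
    let W : ℕ → Ω × X → ℝ := fun n p =>
      B.indicator (fun _ => (1 : ℝ)) p.2 * M (gridBefore n (τ p.2)) p.1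
    have hWm : ∀ n, Measurable[predictable ℱ τ] (W n) := fun n => by
      refine Measurable.mul ?_ (measurable_comp_gridBefore hτ
        (fun r => (hM.stronglyMeasurable r).measurable) n)
      exact (measurable_const.indicator hB).comp measurable_snd_predictable
    have hW1 : ∀ n p, |W n p| ≤ 1 := fun n p => by
      by_cases hp : p.2 ∈ B <;> simp [W, hp, hM1]
    have hWkint : ∀ n, Integrable (fun p => W n p * k p) ρ := fun n =>
      hkint.bdd_mul ((hWm n).mono hle le_rfl).aestronglyMeasurable (ae_of_all _ (hW1 n))
    have hzero : ∀ n, ∫ x, ∫ ω, W n (ω, x) * k (ω, x) ∂P ∂η = 0 := fun n => by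
      rw [← integral_prod_symm _ (hWkint n)]
      exact horth _ 1 (hWm n) (hW1 n)
    have hlim : Tendsto (fun n => ∫ x, ∫ ω, W n (ω, x) * k (ω, x) ∂P ∂η) atTop
        (𝓝 (∫ x, ∫ ω, (A ×ˢ B).indicator k (ω, x) ∂P ∂η)) := by
      refine tendsto_integral_of_dominated_convergence (fun _ => ((R : ℝ) + R)) (fun n => ?_)
        (integrable_const _) (fun n => ?_) ?_
      · exact (hWkint n).integral_prod_right.aestronglyMeasurable
      · filter_upwards [hkbd'] with x hx
        refine (norm_integral_le_of_norm_le_const (C := (R : ℝ) + R) ?_).trans (by simp)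
        filter_upwards [hx] with ω hω
        rw [norm_mul, Real.norm_eq_abs, Real.norm_eq_abs]
        exact (mul_le_of_le_one_left (abs_nonneg _) (hW1 n _)).trans hω
      · filter_upwards [hkbd', hDnull] with x hx hxD
        by_cases hxB : x ∈ B
        swap
        · simp [W, hxB]
        have hkx : Integrable (fun ω => k (ω, x)) P :=
          (integrable_const ((R : ℝ) + R)).mono' (hksec x) hx
        have hMk : ∀ r, Integrable (fun ω => M r ω * k (ω, x)) P := fun r =>
          hkx.bdd_mul (hM.integrable r).1 (ae_of_all _ (hM1 r))
        have hAint : Integrable (A.indicator (fun _ => (1 : ℝ))) P :=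
          (integrable_const 1).indicator hA
        have h1 : ∫ ω, (A ×ˢ B).indicator k (ω, x) ∂P = ∫ ω, M (τ x) ω * k (ω, x) ∂P := by
          have h2 := integral_mul_condExp (P := P) (ℱ.le (τ x)) (hkad x)
            (g := A.indicator (fun _ => (1 : ℝ)))
            (hAint.bdd_mul (hksec x) hx) hAint
          calc ∫ ω, (A ×ˢ B).indicator k (ω, x) ∂P
              = ∫ ω, k (ω, x) * A.indicator (fun _ => (1 : ℝ)) ω ∂P := by
                refine integral_congr_ae (ae_of_all _ fun ω => ?_)
                by_cases hω : ω ∈ A <;> simp [hω, hxB]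
            _ = ∫ ω, k (ω, x) * (P[A.indicator (fun _ => (1 : ℝ)) | ℱ (τ x)]) ω ∂P := h2.symm
            _ = ∫ ω, M (τ x) ω * k (ω, x) ∂P := by
                refine integral_congr_ae ?_
                filter_upwards [hMA (τ x)] with ω hω
                rw [hω, mul_comm]
        rw [h1]
        simp only [W, hxB, indicator_of_mem, one_mul]
        rw [tendsto_iff_norm_sub_tendsto_zero]
        have h3 := (hcont (τ x) hxD (fun n => gridBefore n (τ x)) (fun n => gridBefore_le n _)
          (tendsto_gridBefore _)).const_mul ((R : ℝ) + R)
        rw [mul_zero] at h3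
        refine squeeze_zero (fun _ => norm_nonneg _) (fun n => ?_) h3
        rw [← integral_sub (hMk _) (hMk _), ← integral_const_mul]
        refine norm_integral_le_of_norm_le
          (((hM.integrable _).sub (hM.integrable _)).abs.const_mul _) ?_
        filter_upwards [hx] with ω hω
        rw [← sub_mul, norm_mul, mul_comm, Real.norm_eq_abs, Real.norm_eq_abs,
          abs_sub_comm (M (gridBefore n (τ x)) ω)]
        exact mul_le_mul_of_nonneg_right hω (abs_nonneg _)
    simp only [hzero] at hlim
    have h0 := tendsto_nhds_unique hlim tendsto_const_nhds
    rw [← integral_indicator (hA.prod hB), hρ,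
      integral_prod_symm _ (hkint.indicator (hA.prod hB)), h0]
  have hktot : ∫ p, k p ∂ρ = 0 := by
    rw [← setIntegral_univ, ← univ_prod_univ]
    exact hrect _ _ MeasurableSet.univ MeasurableSet.univ
  have hall : ∀ S : Set (Ω × X), MeasurableSet S → ∫ p in S, k p ∂ρ = 0 := by
    intro S hS
    refine MeasurableSpace.induction_on_inter (C := fun S _ => ∫ p in S, k p ∂ρ = 0)
      generateFrom_prod.symm isPiSystem_prod ?_ ?_ ?_ ?_ S hS
    · simp
    · rintro _ ⟨A, hA, B, hB, rfl⟩
      exact hrect A B hA hB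
    · intro t ht h
      have := integral_add_compl ht hkint
      rw [h, zero_add, hktot] at this
      exact this
    · intro f hd hm h
      rw [integral_iUnion hm hd hkint.integrableOn]
      simp [h]
  have hk0 : k =ᵐ[ρ] 0 :=
    hkint.ae_eq_zero_of_forall_setIntegral_eq_zero fun S hS _ => hall S hS
  refine ⟨G', hG'm, ?_⟩
  filter_upwards [hk0] with p hp
  have : G p - G' p = 0 := hp
  linarith

/-- An adapted measurable field has a predictable version. -/
lemma aestronglyMeasurable_predictable [IsProbabilityMeasure P] {η : Measure X}
    [IsFiniteMeasure η] (hτ : Measurable τ) (hη : ∀ r, η (τ ⁻¹' {r}) = 0) {G : Ω × X → ℝ}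
    (hG : Measurable G) (had : ∀ x, AEStronglyMeasurable[ℱ (τ x)] (fun ω => G (ω, x)) P) :
    AEStronglyMeasurable[predictable ℱ τ] G (P.prod η) := by
  -- reduction to the bounded field `arctan ∘ G`
  have h := aestronglyMeasurable_predictable_of_bounded (P := P) (ℱ := ℱ) (R := 2) hτ hη
    (G := fun p => Real.arctan (G p)) (by fun_prop) (fun p => ?_)
    (fun x => Real.continuous_arctan.comp_aestronglyMeasurable (had x))
  · obtain ⟨H, hH, hGH⟩ := h
    refine ⟨fun p => Real.sin (H p) / Real.cos (H p), ?_, ?_⟩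
    · exact (Measurable.div (Real.measurable_sin.comp hH.measurable)
        (Real.measurable_cos.comp hH.measurable)).stronglyMeasurable
    · filter_upwards [hGH] with p hp
      rw [← Real.tan_eq_sin_div_cos, ← hp, Real.tan_arctan]
  · have h1 := Real.arctan_lt_pi_div_two (G p)
    have h2 := Real.neg_pi_div_two_lt_arctan (G p)
    have h3 := Real.pi_lt_four
    rw [abs_le]
    push_cast
    constructor <;> linarith

end PredictableVersion

/-! ### Poisson random measures as kernels -/

section Lebesgue

lemma lebesgue_apply {S : Set ℝ≥0} (hS : MeasurableSet S) :
    lebesgue S = volume (Real.toNNReal ⁻¹' S ∩ Ici 0) := by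
  rw [lebesgue, Measure.map_apply measurable_real_toNNReal hS,
    Measure.restrict_apply (measurable_real_toNNReal hS)]

lemma lebesgue_singleton (r : ℝ≥0) : lebesgue {r} = 0 := by
  rw [lebesgue_apply (measurableSet_singleton r)]
  refine measure_mono_null (t := {(r : ℝ)}) ?_ Real.volume_singleton
  rintro x ⟨hx, h0⟩
  rw [mem_preimage, mem_singleton_iff] at hx
  rw [mem_singleton_iff, ← hx, Real.coe_toNNReal x h0]

lemma lebesgue_Iic_lt_top (T : ℝ≥0) : lebesgue (Iic T) < ∞ := by
  rw [lebesgue_apply measurableSet_Iic]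
  refine (measure_mono (t := Icc 0 (T : ℝ)) ?_).trans_lt measure_Icc_lt_top
  rintro x ⟨hx, h0⟩
  exact ⟨h0, Real.toNNReal_le_iff_le_coe.1 hx⟩

lemma lebesgue_Ioc_lt_top (a b : ℝ≥0) : lebesgue (Ioc a b) < ∞ :=
  (measure_mono Ioc_subset_Iic_self).trans_lt (lebesgue_Iic_lt_top b)

instance sigmaFinite_lebesgue : SigmaFinite lebesgue :=
  ⟨⟨{ set := fun n => Iic (n : ℝ≥0)
      set_mem := fun _ => trivial
      finite := fun n => lebesgue_Iic_lt_top n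
      spanning := by
        ext r
        simpa using exists_nat_ge r }⟩⟩

instance nullSingletonClass_lebesgue : NullSingletonClass lebesgue := ⟨lebesgue_singleton⟩

end Lebesgue

section Levy

variable {d : ℕ} {c : ℝ}

/-- The marks of size at least `1 / (n + 1)`: a set of finite Lévy measure. -/
def bigMarks (d : ℕ) (c : ℝ) (n : ℕ) : Set (Mark d c) := {v | 1 / ((n : ℝ) + 1) ≤ ‖(v : Space d)‖}

lemma measurableSet_bigMarks (n : ℕ) : MeasurableSet (bigMarks d c n) :=
  measurableSet_le measurable_const (by fun_prop)

lemma bigMarks_mono : Monotone (bigMarks d c) := fun _ _ h v (hv : _ ≤ ‖(v : Space d)‖) =>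
  (Nat.one_div_le_one_div h).trans hv

lemma iUnion_bigMarks : ⋃ n, bigMarks d c n = univ := by
  ext v
  simp only [mem_iUnion, mem_univ, iff_true]
  have hv : 0 < ‖(v : Space d)‖ := norm_pos_iff.2 v.2.2
  obtain ⟨n, hn⟩ := exists_nat_one_div_lt hv
  exact ⟨n, hn.le⟩

lemma IsLevyMeasure.bigMarks_lt_top {ν : Measure (Mark d c)} (hν : IsLevyMeasure ν) (n : ℕ) :
    ν (bigMarks d c n) < ∞ := by
  set f : Mark d c → ℝ≥0∞ := fun v => ENNReal.ofReal (min 1 (‖(v : Space d)‖ ^ 2)) with hf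
  set ε : ℝ := min 1 ((1 / ((n : ℝ) + 1)) ^ 2) with hε
  have hε0 : 0 < ε := by positivity
  have hsub : bigMarks d c n ⊆ {v | ENNReal.ofReal ε ≤ f v} := fun v hv => by
    refine ENNReal.ofReal_le_ofReal (min_le_min le_rfl ?_)
    exact pow_le_pow_left₀ (by positivity) hv 2
  have h := mul_meas_ge_le_lintegral (μ := ν) (f := f) (by fun_prop) (ENNReal.ofReal ε)
  refine (measure_mono hsub).trans_lt (lt_top_iff_ne_top.2 fun htop => ?_)
  rw [htop, ENNReal.mul_top (by simpa using hε0)] at h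
  exact absurd hν (not_lt.2 h)

lemma IsLevyMeasure.sigmaFinite {ν : Measure (Mark d c)} (hν : IsLevyMeasure ν) :
    SigmaFinite ν :=
  ⟨⟨{ set := bigMarks d c
      set_mem := fun _ => trivial
      finite := hν.bigMarks_lt_top
      spanning := iUnion_bigMarks }⟩⟩

end Levy

section Poisson

lemma lintegral_poissonMeasure_natCast (r : ℝ≥0) :
    ∫⁻ k : ℕ, (k : ℝ≥0∞) ∂(poissonMeasure r) = r := by
  rw [lintegral_countable']
  simp only [poissonMeasure_singleton]
  have h1 : ∀ n : ℕ, ((n + 1 : ℕ) : ℝ≥0∞) *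
      ENNReal.ofReal (Real.exp (-r) * r ^ (n + 1) / ((n + 1).factorial : ℝ)) =
      r * ENNReal.ofReal (Real.exp (-r) * r ^ n / (n.factorial : ℝ)) := fun n => by
    rw [← ENNReal.ofReal_natCast, ← ENNReal.ofReal_coe_nnreal (p := r),
      ← ENNReal.ofReal_mul (by positivity), ← ENNReal.ofReal_mul (by positivity)]
    congr 1
    rw [Nat.factorial_succ]
    push_cast
    field_simp
    ring
  rw [tsum_eq_zero_add' ENNReal.summable]
  simp only [h1]
  rw [ENNReal.tsum_mul_left]
  have h2 : ∑' n : ℕ, ENNReal.ofReal (Real.exp (-r) * r ^ n / (n.factorial : ℝ)) = 1 := by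
    have h := lintegral_countable' (μ := poissonMeasure r) (fun _ => (1 : ℝ≥0∞))
    simp only [poissonMeasure_singleton, one_mul, lintegral_const, measure_univ] at h
    exact h.symm
  simp [h2]

variable {d : ℕ} {c : ℝ} {Ω : Type*} {m : MeasurableSpace Ω} {P : Measure Ω}
  {ℱ : Filtration ℝ≥0 m} {ν : Measure (Mark d c)} {N : Ω → Measure (Mark d c × ℝ≥0)}

namespace IsPoissonRandomMeasure

lemma measurable_apply (hN : IsPoissonRandomMeasure P ℱ ν N) {S : Set (Mark d c × ℝ≥0)}
    (hS : MeasurableSet S) : Measurable (fun ω => N ω S) :=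
  (Measure.measurable_coe hS).comp hN.measurable

lemma lintegral_apply (hN : IsPoissonRandomMeasure P ℱ ν N) {B : Set (Mark d c)} {I : Set ℝ≥0}
    (hB : MeasurableSet B) (hI : MeasurableSet I) (hνB : ν B < ∞) (hlI : lebesgue I < ∞) :
    ∫⁻ ω, N ω (B ×ˢ I) ∂P = ν B * lebesgue I := by
  have h1 : ∫⁻ x, x ∂(P.map fun ω => N ω (B ×ˢ I)) = ∫⁻ ω, N ω (B ×ˢ I) ∂P :=
    lintegral_map measurable_id (hN.measurable_apply (hB.prod hI))
  rw [← h1, hN.poisson B I hB hI hνB hlI,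
    lintegral_map (f := fun x => x) measurable_id .of_discrete, lintegral_poissonMeasure_natCast,
    ENNReal.coe_toNNReal (ENNReal.mul_lt_top hνB hlI).ne]

lemma ae_lt_top (hN : IsPoissonRandomMeasure P ℱ ν N) {B : Set (Mark d c)} {I : Set ℝ≥0}
    (hB : MeasurableSet B) (hI : MeasurableSet I) (hνB : ν B < ∞) (hlI : lebesgue I < ∞) :
    ∀ᵐ ω ∂P, N ω (B ×ˢ I) < ∞ := by
  refine ae_lt_top' (hN.measurable_apply (hB.prod hI)).aemeasurable ?_
  rw [hN.lintegral_apply hB hI hνB hlI]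
  exact (ENNReal.mul_lt_top hνB hlI).ne

/-- The mean of `N` over a predictable rectangle. -/
lemma setLIntegral_apply (hN : IsPoissonRandomMeasure P ℱ ν N) {F : Set Ω} {B : Set (Mark d c)}
    {a b : ℝ≥0} (hF : MeasurableSet[ℱ a] F) (hab : a ≤ b) (hB : MeasurableSet B) (hνB : ν B < ∞) :
    ∫⁻ ω in F, N ω (B ×ˢ Ioc a b) ∂P = P F * (ν B * lebesgue (Ioc a b)) := by
  have hm : Measurable (fun ω => N ω (B ×ˢ Ioc a b)) :=
    hN.measurable_apply (hB.prod measurableSet_Ioc)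
  have h := lintegral_mul_eq_lintegral_mul_lintegral_of_independent_measurableSpace (μ := P)
    (f := F.indicator fun _ => (1 : ℝ≥0∞)) (g := fun ω => N ω (B ×ˢ Ioc a b)) (ℱ.le a)
    hm.comap_le (hN.indep_past B hB a b hab).symm
    ((@measurable_const _ _ _ (ℱ a) _).indicator hF) (comap_measurable _)
  rw [hN.lintegral_apply hB measurableSet_Ioc hνB (lebesgue_Ioc_lt_top a b),
    lintegral_indicator_const (ℱ.le a F hF), one_mul] at h
  rw [← h, ← lintegral_indicator (ℱ.le a F hF)]
  refine lintegral_congr fun ω => ?_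
  by_cases hω : ω ∈ F <;> simp [hω]

end IsPoissonRandomMeasure

end Poisson

section Kernel

variable {α β : Type*} {mα : MeasurableSpace α} {mβ : MeasurableSpace β}

/-- A kernel of finite, not necessarily bounded, total mass is s-finite: split it according to the
integer part of the mass. -/
lemma isSFiniteKernel_of_apply_univ_lt_top {κ : Kernel α β} (h : ∀ a, κ a univ < ∞) :
    IsSFiniteKernel κ := by
  classical
  have hm : Measurable fun a => ⌊(κ a univ).toReal⌋₊ :=
    Nat.measurable_floor.comp (κ.measurable_coe MeasurableSet.univ).ennreal_toReal
  have hs : ∀ j : ℕ, MeasurableSet {a | ⌊(κ a univ).toReal⌋₊ = j} := fun j =>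
    hm (measurableSet_singleton j)
  refine ⟨fun j => Kernel.piecewise (hs j) κ 0, fun j => ⟨(j : ℝ≥0∞) + 1, by finiteness, ?_⟩, ?_⟩
  · intro a
    rw [Kernel.piecewise_apply]
    split_ifs with ha
    · rw [← ENNReal.ofReal_toReal (h a).ne]
      have h1 := Nat.lt_floor_add_one (κ a univ).toReal
      rw [show ⌊(κ a univ).toReal⌋₊ = j from ha] at h1
      refine (ENNReal.ofReal_le_ofReal h1.le).trans_eq ?_
      rw [ENNReal.ofReal_add (by positivity) zero_le_one]
      simp
    · simp
  · ext a s hs'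
    rw [Kernel.sum_apply' _ _ hs', tsum_eq_single ⌊(κ a univ).toReal⌋₊]
    · rw [Kernel.piecewise_apply']
      exact (if_pos (by exact rfl)).symm
    · intro j hj
      rw [Kernel.piecewise_apply', if_neg (fun h' => hj h'.symm)]
      simp

lemma isSFiniteKernel_of_iUnion {κ : Kernel α β} {S : ℕ → Set β} (hS : ∀ n, MeasurableSet (S n))
    (hU : ⋃ n, S n = univ) (h : ∀ a n, κ a (S n) < ∞) : IsSFiniteKernel κ := by
  have hD : ∀ n, MeasurableSet (disjointed S n) := fun n => MeasurableSet.disjointed hS n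
  have hκ : κ = Kernel.sum fun n => κ.restrict (hD n) := by
    ext a s hs
    rw [Kernel.sum_apply' _ _ hs]
    simp only [Kernel.restrict_apply' _ _ _ hs]
    rw [← measure_iUnion]
    · rw [← inter_iUnion, iUnion_disjointed, hU, inter_univ]
    · intro i j hij
      exact ((disjoint_disjointed S hij).mono inter_subset_right inter_subset_right)
    · exact fun n => hs.inter (hD n)
  rw [hκ]
  have : ∀ n, IsSFiniteKernel (κ.restrict (hD n)) := fun n =>
    isSFiniteKernel_of_apply_univ_lt_top fun a => by
      rw [Kernel.restrict_apply' _ _ _ MeasurableSet.univ, univ_inter]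
      exact (measure_mono (disjointed_subset S n)).trans_lt (h a n)
  exact Kernel.isSFiniteKernel_sum

variable {d : ℕ} {c : ℝ} {Ω : Type*} {m : MeasurableSpace Ω} {P : Measure Ω}
  {ℱ : Filtration ℝ≥0 m} {ν : Measure (Mark d c)} {N : Ω → Measure (Mark d c × ℝ≥0)}

/-- Off a null set, `N` is finite on the sets `bigMarks n × [0, n]`; redefined as `0` on that null
set, it is an s-finite kernel, which makes Tonelli's theorem available. -/
lemma IsPoissonRandomMeasure.exists_kernel (hN : IsPoissonRandomMeasure P ℱ ν N)
    (hν : IsLevyMeasure ν) :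
    ∃ κ : Kernel Ω (Mark d c × ℝ≥0), IsSFiniteKernel κ ∧ ∀ᵐ ω ∂P, κ ω = N ω := by
  classical
  let S : ℕ → Set (Mark d c × ℝ≥0) := fun n => bigMarks d c n ×ˢ Iic (n : ℝ≥0)
  have hS : ∀ n, MeasurableSet (S n) := fun n => (measurableSet_bigMarks n).prod measurableSet_Iic
  let Ω₀ : Set Ω := {ω | ∀ n, N ω (S n) < ∞}
  have hΩ₀ : MeasurableSet Ω₀ := by
    simp only [Ω₀, ofPred_forall]
    exact MeasurableSet.iInter fun n =>
      measurableSet_lt (hN.measurable_apply (hS n)) measurable_const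
  let κ : Kernel Ω (Mark d c × ℝ≥0) :=
    Kernel.piecewise hΩ₀ ⟨N, hN.measurable⟩ 0
  have hκ : ∀ ω, κ ω = if ω ∈ Ω₀ then N ω else 0 := fun ω => by
    rw [Kernel.piecewise_apply]; rfl
  refine ⟨κ, isSFiniteKernel_of_iUnion hS ?_ fun ω n => ?_, ?_⟩
  · ext ⟨v, r⟩
    simp only [mem_iUnion, mem_univ, iff_true]
    have hv : v ∈ ⋃ n, bigMarks d c n := by rw [iUnion_bigMarks]; trivial
    obtain ⟨k, hk⟩ := mem_iUnion.1 hv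
    obtain ⟨l, hl⟩ := exists_nat_ge r
    refine ⟨max k l, bigMarks_mono (le_max_left k l) hk, hl.trans ?_⟩
    exact_mod_cast le_max_right k l
  · rw [hκ]
    split_ifs with h
    · exact h n
    · simp
  · have : ∀ᵐ ω ∂P, ∀ n, N ω (S n) < ∞ := ae_all_iff.2 fun n =>
      hN.ae_lt_top (measurableSet_bigMarks n) measurableSet_Iic (hν.bigMarks_lt_top n)
        (lebesgue_Iic_lt_top n)
    filter_upwards [this] with ω hω
    rw [hκ]
    exact if_pos (by exact hω)

end Kernel

/-! ### The compensation formula -/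

section MarkPredictable

variable {d : ℕ} {c : ℝ} {Ω : Type*} {m : MeasurableSpace Ω} {P : Measure Ω}
  {ℱ : Filtration ℝ≥0 m} {ν : Measure (Mark d c)} {N : Ω → Measure (Mark d c × ℝ≥0)}

/-- The predictable σ-algebra on `Ω × (E × ℝ₊)`. -/
@[reducible]
def markPredictable (d : ℕ) (c : ℝ) (ℱ : Filtration ℝ≥0 m) :
    MeasurableSpace (Ω × (Mark d c × ℝ≥0)) :=
  predictable ℱ (Prod.snd : Mark d c × ℝ≥0 → ℝ≥0)

/-- The predictable rectangles `F × A × (a, b]` with `F ∈ ℱ_a`, together with the rectangles at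
time `0`. -/
def predictableRectangles (d : ℕ) (c : ℝ) (ℱ : Filtration ℝ≥0 m) :
    Set (Set (Ω × (Mark d c × ℝ≥0))) :=
  {S | (∃ (a b : ℝ≥0) (F : Set Ω) (A : Set (Mark d c)), MeasurableSet[ℱ a] F ∧ MeasurableSet A ∧
      S = F ×ˢ (A ×ˢ Ioc a b)) ∨
    ∃ (F : Set Ω) (A : Set (Mark d c)), MeasurableSet[ℱ 0] F ∧ MeasurableSet A ∧
      S = F ×ˢ (A ×ˢ {0})}

lemma isPiSystem_predictableRectangles : IsPiSystem (predictableRectangles d c ℱ) := by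
  rintro _ (⟨a, b, F, A, hF, hA, rfl⟩ | ⟨F, A, hF, hA, rfl⟩) _
    (⟨a', b', F', A', hF', hA', rfl⟩ | ⟨F', A', hF', hA', rfl⟩) hne
  · left
    refine ⟨a ⊔ a', b ⊓ b', F ∩ F', A ∩ A', ?_, hA.inter hA', ?_⟩
    · exact (ℱ.mono le_sup_left F hF).inter (ℱ.mono le_sup_right F' hF')
    · rw [prod_inter_prod, prod_inter_prod, Ioc_inter_Ioc]
  · obtain ⟨⟨ω, v, r⟩, h1, h2⟩ := hne
    have h3 : r = 0 := h2.2.2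
    have h4 : a < r := h1.2.2.1
    rw [h3] at h4
    exact absurd h4 not_lt_zero
  · obtain ⟨⟨ω, v, r⟩, h1, h2⟩ := hne
    have h3 : r = 0 := h1.2.2
    have h4 : a' < r := h2.2.2.1
    rw [h3] at h4
    exact absurd h4 not_lt_zero
  · right
    refine ⟨F ∩ F', A ∩ A', hF.inter hF', hA.inter hA', ?_⟩
    rw [prod_inter_prod, prod_inter_prod, inter_self]

lemma iUnion_Ioc_add_natCast (a : ℝ≥0) : ⋃ n : ℕ, Ioc a (a + n) = Ioi a := by
  ext r
  simp only [mem_iUnion, mem_Ioc, mem_Ioi]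
  refine ⟨fun ⟨_, h, _⟩ => h, fun h => ?_⟩
  obtain ⟨n, hn⟩ := exists_nat_ge r
  exact ⟨n, h, hn.trans le_add_self⟩

lemma markPredictable_eq_generateFrom :
    markPredictable d c ℱ = MeasurableSpace.generateFrom (predictableRectangles d c ℱ) := by
  apply le_antisymm
  · set 𝒢 := MeasurableSpace.generateFrom (predictableRectangles d c ℱ) with h𝒢
    have hIoi : ∀ (a : ℝ≥0) (F : Set Ω) (A : Set (Mark d c)), MeasurableSet[ℱ a] F →
        MeasurableSet A → MeasurableSet[𝒢] (F ×ˢ (A ×ˢ Ioi a)) := by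
      intro a F A hF hA
      rw [← iUnion_Ioc_add_natCast a, prod_iUnion, prod_iUnion]
      exact MeasurableSet.iUnion fun n =>
        MeasurableSpace.measurableSet_generateFrom (Or.inl ⟨a, a + n, F, A, hF, hA, rfl⟩)
    have hall : ∀ (F : Set Ω) (A : Set (Mark d c)), MeasurableSet[ℱ 0] F →
        MeasurableSet A → MeasurableSet[𝒢] (F ×ˢ (A ×ˢ univ)) := by
      intro F A hF hA
      have : (univ : Set ℝ≥0) = Ioi 0 ∪ {0} := by
        ext r; simp
      rw [this, prod_union, prod_union]
      exact (hIoi 0 F A hF hA).union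
        (MeasurableSpace.measurableSet_generateFrom (Or.inr ⟨F, A, hF, hA, rfl⟩))
    have hv : Measurable[𝒢] (fun p : Ω × (Mark d c × ℝ≥0) => p.2.1) := by
      intro A hA
      convert hall univ A MeasurableSet.univ hA using 1
      ext; simp
    have hr : Measurable[𝒢] (fun p : Ω × (Mark d c × ℝ≥0) => p.2.2) := by
      refine @measurable_of_Ioi ℝ≥0 (Ω × (Mark d c × ℝ≥0)) _ _ _ 𝒢 _ _ _ _ (fun a => ?_)
      convert hIoi a univ univ MeasurableSet.univ MeasurableSet.univ using 1
      ext; simp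
    have hsnd : Measurable[𝒢] (Prod.snd : Ω × (Mark d c × ℝ≥0) → Mark d c × ℝ≥0) :=
      hv.prodMk hr
    refine MeasurableSpace.generateFrom_le ?_
    rintro _ ⟨a, F, B, hF, hB, ha, rfl⟩
    have hFB : (F ×ˢ B : Set (Ω × (Mark d c × ℝ≥0))) =
        (F ×ˢ (univ ×ˢ {r | a < r ∨ a = 0})) ∩ Prod.snd ⁻¹' B := by
      ext ⟨ω, v, r⟩
      simp only [mem_prod, mem_inter_iff, mem_univ, true_and, mem_preimage]
      exact ⟨fun h => ⟨⟨h.1, ha _ h.2⟩, h.2⟩, fun h => ⟨h.1.1, h.2⟩⟩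
    rw [hFB]
    refine MeasurableSet.inter ?_ (hsnd hB)
    by_cases h0 : a = 0
    · subst h0
      have : {r : ℝ≥0 | 0 < r ∨ (0 : ℝ≥0) = 0} = univ := by ext; simp
      rw [this]
      exact hall F univ hF MeasurableSet.univ
    · have : {r : ℝ≥0 | a < r ∨ a = 0} = Ioi a := by ext; simp [h0]
      rw [this]
      exact hIoi a F univ hF MeasurableSet.univ
  · refine MeasurableSpace.generateFrom_le ?_
    rintro _ (⟨a, b, F, A, hF, hA, rfl⟩ | ⟨F, A, hF, hA, rfl⟩)
    · exact measurableSet_predictable hF (hA.prod measurableSet_Ioc) fun x hx => Or.inl hx.2.1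
    · exact measurableSet_predictable hF (hA.prod (measurableSet_singleton 0))
        fun _ _ => Or.inr rfl

/-- Bounded regions of `Ω × E × (0, ∞)`, of finite mean measure. -/
def window (Ω : Type*) (d : ℕ) (c : ℝ) (n : ℕ) : Set (Ω × (Mark d c × ℝ≥0)) :=
  univ ×ˢ (bigMarks d c n ×ˢ Ioc 0 (n : ℝ≥0))

lemma measurableSet_window (n : ℕ) : MeasurableSet[markPredictable d c ℱ] (window Ω d c n) :=
  measurableSet_predictable (a := 0) MeasurableSet.univ
    ((measurableSet_bigMarks n).prod measurableSet_Ioc) fun _ _ => Or.inr rfl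

lemma monotone_window : Monotone (window Ω d c) := fun k l h =>
  prod_mono le_rfl (prod_mono (bigMarks_mono h) (Ioc_subset_Ioc_right (by exact_mod_cast h)))

lemma iUnion_window : ⋃ n, window Ω d c n = {p | 0 < p.2.2} := by
  ext ⟨ω, v, r⟩
  simp only [mem_iUnion, window, mem_prod, mem_univ, true_and, mem_Ioc, mem_ofPred_eq]
  refine ⟨fun ⟨n, h⟩ => h.2.1, fun h => ?_⟩
  have hv : v ∈ ⋃ n, bigMarks d c n := by rw [iUnion_bigMarks]; trivial
  obtain ⟨k, hk⟩ := mem_iUnion.1 hv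
  obtain ⟨l, hl⟩ := exists_nat_ge r
  refine ⟨max k l, bigMarks_mono (le_max_left k l) hk, h, hl.trans ?_⟩
  exact_mod_cast le_max_right k l

lemma prod_inter_window {F : Set Ω} {A : Set (Mark d c)} {a b : ℝ≥0} (n : ℕ) :
    F ×ˢ (A ×ˢ Ioc a b) ∩ window Ω d c n =
      F ×ˢ ((A ∩ bigMarks d c n) ×ˢ Ioc a (a ⊔ (b ⊓ n))) := by
  have h : Ioc a b ∩ Ioc 0 (n : ℝ≥0) = Ioc a (a ⊔ (b ⊓ n)) := by
    ext r
    simp only [mem_inter_iff, mem_Ioc, le_sup_iff, le_inf_iff]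
    constructor
    · rintro ⟨⟨h1, h2⟩, h3, h4⟩
      exact ⟨h1, Or.inr ⟨h2, h4⟩⟩
    · rintro ⟨h1, h2 | h2⟩
      · exact absurd h1 (not_lt.2 h2)
      · exact ⟨⟨h1, h2.1⟩, pos_of_gt h1, h2.2⟩
  rw [window, prod_inter_prod, prod_inter_prod, inter_univ, h]

lemma prod_singleton_inter_window {F : Set Ω} {A : Set (Mark d c)} (n : ℕ) :
    F ×ˢ (A ×ˢ {0}) ∩ window Ω d c n = ∅ := by
  ext ⟨ω, v, r⟩
  simp only [window, mem_inter_iff, mem_prod, mem_singleton_iff, mem_Ioc, mem_empty_iff_false,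
    iff_false]
  rintro ⟨⟨-, -, h⟩, -, -, h', -⟩
  exact h'.ne' h

lemma prod_window_lt_top [IsProbabilityMeasure P] (hν : IsLevyMeasure ν) (n : ℕ) :
    (P.prod (ν.prod lebesgue)) (window Ω d c n) < ∞ := by
  have := hν.sigmaFinite
  rw [window, Measure.prod_prod, Measure.prod_prod, measure_univ, one_mul]
  exact ENNReal.mul_lt_top (hν.bigMarks_lt_top n) (lebesgue_Ioc_lt_top _ _)

/-- The compensation formula on predictable rectangles: the increment of `N` after time `a` is
independent of `F`. -/
lemma compProd_predictable_rectangle [IsProbabilityMeasure P]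
    (hN : IsPoissonRandomMeasure P ℱ ν N) (hν : IsLevyMeasure ν)
    {κ : Kernel Ω (Mark d c × ℝ≥0)} [IsSFiniteKernel κ] (hκ : ∀ᵐ ω ∂P, κ ω = N ω)
    {F : Set Ω} {A : Set (Mark d c)} {a b : ℝ≥0} (hF : MeasurableSet[ℱ a] F) (hab : a ≤ b)
    (hA : MeasurableSet A) (hνA : ν A < ∞) :
    (P ⊗ₘ κ) (F ×ˢ (A ×ˢ Ioc a b)) = (P.prod (ν.prod lebesgue)) (F ×ˢ (A ×ˢ Ioc a b)) := by
  have := hν.sigmaFinite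
  rw [Measure.compProd_apply_prod (ℱ.le a F hF) (hA.prod measurableSet_Ioc), Measure.prod_prod,
    Measure.prod_prod, ← hN.setLIntegral_apply hF hab hA hνA]
  refine lintegral_congr_ae (ae_restrict_of_ae ?_)
  filter_upwards [hκ] with ω hω
  rw [hω]

/-- Compensation formula: for a nonnegative predictable integrand, the expected integral against `N`
is the expected integral against the intensity. -/
lemma setLIntegral_compProd_eq [IsProbabilityMeasure P]
    (hN : IsPoissonRandomMeasure P ℱ ν N) (hν : IsLevyMeasure ν)
    {κ : Kernel Ω (Mark d c × ℝ≥0)} [IsSFiniteKernel κ] (hκ : ∀ᵐ ω ∂P, κ ω = N ω)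
    {f : Ω × (Mark d c × ℝ≥0) → ℝ≥0∞} (hf : Measurable[markPredictable d c ℱ] f) :
    ∫⁻ p in {p | 0 < p.2.2}, f p ∂(P ⊗ₘ κ) =
      ∫⁻ p in {p | 0 < p.2.2}, f p ∂(P.prod (ν.prod lebesgue)) := by
  have hle := predictable_le ℱ (Prod.snd : Mark d c × ℝ≥0 → ℝ≥0)
  have hW : ∀ n, MeasurableSet (window Ω d c n) := fun n => hle _ (measurableSet_window n)
  have hrect : ∀ n, ∀ S ∈ predictableRectangles d c ℱ, (P ⊗ₘ κ) (S ∩ window Ω d c n) =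
      (P.prod (ν.prod lebesgue)) (S ∩ window Ω d c n) := by
    rintro n _ (⟨a, b, F, A, hF, hA, rfl⟩ | ⟨F, A, hF, hA, rfl⟩)
    · rw [prod_inter_window]
      exact compProd_predictable_rectangle hN hν hκ hF le_sup_left
        (hA.inter (measurableSet_bigMarks n))
        ((measure_mono inter_subset_right).trans_lt (hν.bigMarks_lt_top n))
    · rw [prod_singleton_inter_window]; simp
  have huniv : ∀ n, (P ⊗ₘ κ) (window Ω d c n) = (P.prod (ν.prod lebesgue)) (window Ω d c n) := by
    intro n
    have h := hrect n (window Ω d c n) (Or.inl ⟨0, n, univ, bigMarks d c n, MeasurableSet.univ,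
      measurableSet_bigMarks n, rfl⟩)
    rwa [inter_self] at h
  have hWn : ∀ n, ∫⁻ p in window Ω d c n, f p ∂(P ⊗ₘ κ) =
      ∫⁻ p in window Ω d c n, f p ∂(P.prod (ν.prod lebesgue)) := by
    intro n
    have key : ((P ⊗ₘ κ).restrict (window Ω d c n)).trim hle =
        ((P.prod (ν.prod lebesgue)).restrict (window Ω d c n)).trim hle := by
      have hS : ∀ (ρ : Measure (Ω × (Mark d c × ℝ≥0))) S,
          MeasurableSet[markPredictable d c ℱ] S →
          (ρ.restrict (window Ω d c n)).trim hle S = ρ (S ∩ window Ω d c n) := fun ρ S hS => by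
        rw [trim_measurableSet_eq hle hS, Measure.restrict_apply (hle _ hS)]
      refine @ext_of_generate_finite _ (markPredictable d c ℱ) _ _ _ markPredictable_eq_generateFrom
        isPiSystem_predictableRectangles ⟨?_⟩ (fun S hSm => ?_) ?_
      · rw [hS _ _ MeasurableSet.univ, univ_inter, huniv]
        exact prod_window_lt_top hν n
      · have hSm' : MeasurableSet[markPredictable d c ℱ] S := by
          rw [markPredictable_eq_generateFrom]
          exact MeasurableSpace.measurableSet_generateFrom hSm
        rw [hS _ _ hSm', hS _ _ hSm', hrect n S hSm]
      · rw [hS _ _ MeasurableSet.univ, hS _ _ MeasurableSet.univ, univ_inter, huniv]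
    rw [← lintegral_trim hle hf, key, lintegral_trim hle hf]
  rw [← iUnion_window, setLIntegral_iUnion_of_directed _ (monotone_window.directed_le),
    setLIntegral_iUnion_of_directed _ (monotone_window.directed_le)]
  simp only [hWn]

end MarkPredictable

/-! ### Density of the simple integrands -/

namespace SimpleIntegrand

variable {d : ℕ} {c : ℝ} {Ω : Type*} {m : MeasurableSpace Ω}
  {ℱ : Filtration ℝ≥0 m} {ν : Measure (Mark d c)}

/-- A simple integrand as a function on `Ω × (E × ℝ₊)`. -/
def toFun (φ : SimpleIntegrand ℱ ν) (p : Ω × (Mark d c × ℝ≥0)) : ℝ := φ.eval p.2.2 p.2.1 p.1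

lemma measurable_toFun (φ : SimpleIntegrand ℱ ν) : Measurable[markPredictable d c ℱ] φ.toFun := by
  unfold toFun eval
  refine Finset.measurable_sum _ fun i _ => ?_
  have h : (fun p : Ω × (Mark d c × ℝ≥0) => φ.ξ i p.1 *
      (φ.A i ×ˢ Ioc (φ.a i) (φ.b i)).indicator (fun _ => (1 : ℝ)) (p.2.1, p.2.2)) =
      ((univ : Set Ω) ×ˢ (φ.A i ×ˢ Ioc (φ.a i) (φ.b i))).indicator (fun p => φ.ξ i p.1) := by
    ext p
    by_cases hp : p.2 ∈ φ.A i ×ˢ Ioc (φ.a i) (φ.b i) <;> simp [hp, indicator]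
  rw [h]
  intro U hU
  have hB : MeasurableSet (φ.A i ×ˢ Ioc (φ.a i) (φ.b i)) :=
    (φ.measurableSet i).prod measurableSet_Ioc
  have hS : ∀ F : Set Ω, MeasurableSet[ℱ (φ.a i)] F →
      MeasurableSet[markPredictable d c ℱ] (F ×ˢ (φ.A i ×ˢ Ioc (φ.a i) (φ.b i))) := fun F hF =>
    measurableSet_predictable hF hB fun x hx => Or.inl hx.2.1
  clear h
  generalize φ.A i ×ˢ Ioc (φ.a i) (φ.b i) = D at hB hS ⊢
  have hpre : ((univ : Set Ω) ×ˢ D).indicator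
      (fun p => φ.ξ i p.1) ⁻¹' U =
      ((φ.ξ i ⁻¹' U) ×ˢ D) ∪ (((univ : Set Ω) ×ˢ D)ᶜ ∩ (fun _ => (0 : ℝ)) ⁻¹' U) := by
    ext p
    by_cases hp : p.2 ∈ D <;> simp [indicator, hp]
  rw [hpre]
  refine (hS _ (φ.measurable i hU)).union ((hS _ MeasurableSet.univ).compl.inter ?_)
  by_cases h0 : (0 : ℝ) ∈ U
  · convert @MeasurableSet.univ _ (markPredictable d c ℱ); simp [h0]
  · convert @MeasurableSet.empty _ (markPredictable d c ℱ); simp [h0]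

/-- The integrand `1_F(ω) 1_{(a,b]}(r) 1_A(v)`. -/
def single {a b : ℝ≥0} {F : Set Ω} {A : Set (Mark d c)} (hab : a ≤ b) (hF : MeasurableSet[ℱ a] F)
    (hA : MeasurableSet A) (hνA : ν A < ∞) : SimpleIntegrand ℱ ν where
  n := 1
  a := fun _ => a
  b := fun _ => b
  A := fun _ => A
  ξ := fun _ => F.indicator fun _ => 1
  le := fun _ => hab
  measurableSet := fun _ => hA
  finite := fun _ => hνA
  measurable := fun _ => (@measurable_const _ _ _ (ℱ a) _).indicator hF
  bounded := ⟨1, fun _ ω => by by_cases h : ω ∈ F <;> simp [h]⟩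

lemma toFun_single {a b : ℝ≥0} {F : Set Ω} {A : Set (Mark d c)} (hab : a ≤ b)
    (hF : MeasurableSet[ℱ a] F) (hA : MeasurableSet A) (hνA : ν A < ∞) :
    (single hab hF hA hνA).toFun = (F ×ˢ (A ×ˢ Ioc a b)).indicator (fun _ => (1 : ℝ)) := by
  ext ⟨ω, x⟩
  change ∑ _i : Fin 1, F.indicator (fun _ => (1 : ℝ)) ω *
    (A ×ˢ Ioc a b).indicator (fun _ => (1 : ℝ)) x = _
  rw [Fin.sum_univ_one]
  by_cases hω : ω ∈ F <;> by_cases hx : x ∈ A ×ˢ Ioc a b <;>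
    simp only [indicator, mem_prod (t := A ×ˢ Ioc a b), hω, hx] <;> simp

/-- Multiplication of a simple integrand by a constant. -/
def smul (k : ℝ) (φ : SimpleIntegrand ℱ ν) : SimpleIntegrand ℱ ν where
  n := φ.n
  a := φ.a
  b := φ.b
  A := φ.A
  ξ := fun i ω => k * φ.ξ i ω
  le := φ.le
  measurableSet := φ.measurableSet
  finite := φ.finite
  measurable := fun i => (φ.measurable i).const_mul k
  bounded := by
    obtain ⟨M, hM⟩ := φ.bounded
    exact ⟨|k| * M, fun i ω => by rw [abs_mul]; gcongr; exact hM i ω⟩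

lemma toFun_smul (k : ℝ) (φ : SimpleIntegrand ℱ ν) (p : Ω × (Mark d c × ℝ≥0)) :
    (smul k φ).toFun p = k * φ.toFun p := by
  change ∑ i, (k * φ.ξ i p.1) * _ = k * ∑ i, φ.ξ i p.1 * _
  rw [Finset.mul_sum]
  exact Finset.sum_congr rfl fun i _ => mul_assoc _ _ _

/-- The sum of two simple integrands. -/
def add (φ ψ : SimpleIntegrand ℱ ν) : SimpleIntegrand ℱ ν where
  n := φ.n + ψ.n
  a := Fin.append φ.a ψ.a
  b := Fin.append φ.b ψ.b
  A := Fin.append φ.A ψ.A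
  ξ := Fin.append φ.ξ ψ.ξ
  le := Fin.addCases (fun i => by simpa using φ.le i) (fun i => by simpa using ψ.le i)
  measurableSet := Fin.addCases (fun i => by simpa using φ.measurableSet i)
    (fun i => by simpa using ψ.measurableSet i)
  finite := Fin.addCases (fun i => by simpa using φ.finite i) (fun i => by simpa using ψ.finite i)
  measurable := Fin.addCases
    (fun i => by rw [Fin.append_left, Fin.append_left]; exact φ.measurable i)
    (fun i => by rw [Fin.append_right, Fin.append_right]; exact ψ.measurable i)
  bounded := by
    obtain ⟨M, hM⟩ := φ.bounded
    obtain ⟨M', hM'⟩ := ψ.bounded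
    exact ⟨max M M', Fin.addCases
      (fun i ω => by rw [Fin.append_left]; exact (hM i ω).trans (le_max_left _ _))
      (fun i ω => by rw [Fin.append_right]; exact (hM' i ω).trans (le_max_right _ _))⟩

lemma toFun_add (φ ψ : SimpleIntegrand ℱ ν) (p : Ω × (Mark d c × ℝ≥0)) :
    (add φ ψ).toFun p = φ.toFun p + ψ.toFun p := by
  change ∑ i : Fin (φ.n + ψ.n), Fin.append φ.ξ ψ.ξ i p.1 *
    (Fin.append φ.A ψ.A i ×ˢ Ioc (Fin.append φ.a ψ.a i) (Fin.append φ.b ψ.b i)).indicator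
      (fun _ => (1 : ℝ)) (p.2.1, p.2.2) = _
  rw [Fin.sum_univ_add]
  simp only [Fin.append_left, Fin.append_right]
  rfl

/-- The zero integrand. -/
def zero : SimpleIntegrand ℱ ν where
  n := 0
  a := fun _ => 0
  b := fun _ => 0
  A := fun _ => ∅
  ξ := fun _ _ => 0
  le := fun _ => le_rfl
  measurableSet := fun _ => MeasurableSet.empty
  finite := fun _ => by simp
  measurable := fun _ => measurable_const
  bounded := ⟨0, fun _ _ => by simp⟩

lemma toFun_zero (p : Ω × (Mark d c × ℝ≥0)) :
    (zero : SimpleIntegrand ℱ ν).toFun p = 0 := by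
  rw [toFun, eval]
  exact Finset.sum_eq_zero fun i _ => Fin.elim0 i

end SimpleIntegrand

section Density

lemma measurable_enorm_sub {Θ : Type*} [MeasurableSpace Θ] {f g : Θ → ℝ} (hf : Measurable f)
    (hg : Measurable g) : Measurable (fun p => ‖f p - g p‖ₑ) := (hf.sub hg).enorm

variable {d : ℕ} {c : ℝ} {Ω : Type*} {m : MeasurableSpace Ω}
  {ℱ : Filtration ℝ≥0 m} {ν : Measure (Mark d c)} {μ : Measure (Ω × (Mark d c × ℝ≥0))}

/-- `f` is predictable and lies in the `L¹(μ)`-closure of the simple integrands. -/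
structure SimplyApproximable (ℱ : Filtration ℝ≥0 m) (ν : Measure (Mark d c))
    (μ : Measure (Ω × (Mark d c × ℝ≥0))) (f : Ω × (Mark d c × ℝ≥0) → ℝ) : Prop where
  measurable : Measurable[markPredictable d c ℱ] f
  approx : ∀ ε : ℝ≥0∞, ε ≠ 0 → ∃ φ : SimpleIntegrand ℱ ν, ∫⁻ p, ‖φ.toFun p - f p‖ₑ ∂μ ≤ ε

lemma measurable_of_markPredictable {β : Type*} [MeasurableSpace β]
    {f : Ω × (Mark d c × ℝ≥0) → β} (hf : Measurable[markPredictable d c ℱ] f) : Measurable f :=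
  hf.mono (predictable_le ℱ _) le_rfl

namespace SimplyApproximable

lemma toFun (φ : SimpleIntegrand ℱ ν) : SimplyApproximable ℱ ν μ φ.toFun :=
  ⟨φ.measurable_toFun, fun ε _ => ⟨φ, by simp⟩⟩

lemma zero : SimplyApproximable ℱ ν μ (fun _ => 0) := by
  have h : (SimpleIntegrand.zero : SimpleIntegrand ℱ ν).toFun = fun _ => 0 :=
    funext SimpleIntegrand.toFun_zero
  rw [← h]
  exact toFun _

lemma add {f g : Ω × (Mark d c × ℝ≥0) → ℝ} (hf : SimplyApproximable ℱ ν μ f)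
    (hg : SimplyApproximable ℱ ν μ g) : SimplyApproximable ℱ ν μ (fun p => f p + g p) := by
  refine ⟨hf.measurable.add hg.measurable, fun ε hε => ?_⟩
  obtain ⟨φ, hφ⟩ := hf.approx (ε / 2) (by simpa using hε)
  obtain ⟨ψ, hψ⟩ := hg.approx (ε / 2) (by simpa using hε)
  refine ⟨φ.add ψ, ?_⟩
  calc ∫⁻ p, ‖(φ.add ψ).toFun p - (f p + g p)‖ₑ ∂μ
      ≤ ∫⁻ p, (‖φ.toFun p - f p‖ₑ + ‖ψ.toFun p - g p‖ₑ) ∂μ := by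
        refine lintegral_mono fun p => ?_
        rw [SimpleIntegrand.toFun_add, add_sub_add_comm]
        exact enorm_add_le _ _
    _ = ∫⁻ p, ‖φ.toFun p - f p‖ₑ ∂μ + ∫⁻ p, ‖ψ.toFun p - g p‖ₑ ∂μ :=
        lintegral_add_left
          (measurable_of_markPredictable (φ.measurable_toFun.sub hf.measurable)).enorm _
    _ ≤ ε / 2 + ε / 2 := add_le_add hφ hψ
    _ = ε := ENNReal.add_halves ε

lemma const_mul {f : Ω × (Mark d c × ℝ≥0) → ℝ} (hf : SimplyApproximable ℱ ν μ f) (k : ℝ) :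
    SimplyApproximable ℱ ν μ (fun p => k * f p) := by
  refine ⟨hf.measurable.const_mul k, fun ε hε => ?_⟩
  obtain ⟨φ, hφ⟩ := hf.approx (ε / (‖k‖ₑ + 1)) (by
    simp only [ne_eq, ENNReal.div_eq_zero_iff, hε, false_or]
    finiteness)
  refine ⟨φ.smul k, ?_⟩
  calc ∫⁻ p, ‖(φ.smul k).toFun p - k * f p‖ₑ ∂μ
      = ∫⁻ p, ‖k‖ₑ * ‖φ.toFun p - f p‖ₑ ∂μ := by
        refine lintegral_congr fun p => ?_
        rw [SimpleIntegrand.toFun_smul, ← mul_sub, enorm_mul]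
    _ = ‖k‖ₑ * ∫⁻ p, ‖φ.toFun p - f p‖ₑ ∂μ := lintegral_const_mul' _ _ (by finiteness)
    _ ≤ (‖k‖ₑ + 1) * (ε / (‖k‖ₑ + 1)) := by gcongr; exact le_self_add
    _ ≤ ε := ENNReal.mul_div_le

lemma sum {ι : Type*} {f : ι → Ω × (Mark d c × ℝ≥0) → ℝ} (s : Finset ι)
    (hf : ∀ i ∈ s, SimplyApproximable ℱ ν μ (f i)) :
    SimplyApproximable ℱ ν μ (fun p => ∑ i ∈ s, f i p) := by
  classical
  induction s using Finset.induction_on with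
  | empty => simpa using zero
  | insert i s hi ih =>
    simp only [Finset.sum_insert hi]
    exact (hf i (Finset.mem_insert_self i s)).add
      (ih fun j hj => hf j (Finset.mem_insert_of_mem hj))

lemma of_tendsto {f : ℕ → Ω × (Mark d c × ℝ≥0) → ℝ} {g : Ω × (Mark d c × ℝ≥0) → ℝ}
    (hf : ∀ n, SimplyApproximable ℱ ν μ (f n)) (hg : Measurable[markPredictable d c ℱ] g)
    (hlim : Tendsto (fun n => ∫⁻ p, ‖f n p - g p‖ₑ ∂μ) atTop (𝓝 0)) :
    SimplyApproximable ℱ ν μ g := by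
  refine ⟨hg, fun ε hε => ?_⟩
  have hε2 : 0 < ε / 2 := by simpa [pos_iff_ne_zero] using hε
  obtain ⟨n, hn⟩ := ((tendsto_order.1 hlim).2 _ hε2).exists
  obtain ⟨φ, hφ⟩ := (hf n).approx (ε / 2) hε2.ne'
  refine ⟨φ, ?_⟩
  calc ∫⁻ p, ‖φ.toFun p - g p‖ₑ ∂μ
      ≤ ∫⁻ p, (‖φ.toFun p - f n p‖ₑ + ‖f n p - g p‖ₑ) ∂μ := by
        refine lintegral_mono fun p => ?_
        rw [← sub_add_sub_cancel (φ.toFun p) (f n p) (g p)]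
        exact enorm_add_le _ _
    _ = ∫⁻ p, ‖φ.toFun p - f n p‖ₑ ∂μ + ∫⁻ p, ‖f n p - g p‖ₑ ∂μ :=
        lintegral_add_left
          (measurable_of_markPredictable (φ.measurable_toFun.sub (hf n).measurable)).enorm _
    _ ≤ ε / 2 + ε / 2 := add_le_add hφ hn.le
    _ = ε := ENNReal.add_halves ε

lemma of_dominated {f : ℕ → Ω × (Mark d c × ℝ≥0) → ℝ} {g bound : Ω × (Mark d c × ℝ≥0) → ℝ}
    (hf : ∀ n, SimplyApproximable ℱ ν μ (f n)) (hg : Measurable[markPredictable d c ℱ] g)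
    (hbound : Integrable bound μ) (hle : ∀ n p, |f n p - g p| ≤ bound p)
    (hlim : ∀ᵐ p ∂μ, Tendsto (fun n => f n p) atTop (𝓝 (g p))) :
    SimplyApproximable ℱ ν μ g := by
  refine of_tendsto hf hg ?_
  have h := tendsto_lintegral_of_dominated_convergence (μ := μ)
    (F := fun n p => ‖f n p - g p‖ₑ) (f := fun _ => 0) (fun p => ‖bound p‖ₑ)
    (fun n => (measurable_of_markPredictable ((hf n).measurable.sub hg)).enorm)
    (fun n => ae_of_all _ fun p => ?_) hbound.2.ne ?_
  · simpa using h
  · exact enorm_le_iff_norm_le.2 (by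
      rw [Real.norm_eq_abs, Real.norm_eq_abs]; exact (hle n p).trans (le_abs_self _))
  · filter_upwards [hlim] with p hp
    have := (hp.sub_const (g p)).enorm
    simpa using this

/-- Predictable sets in a window are approximated by simple integrands: a `π`-`λ` argument from the
predictable rectangles. -/
lemma indicator_inter_window (hν : IsLevyMeasure ν) (hμ : ∀ n, μ (window Ω d c n) < ∞) (n : ℕ)
    {S : Set (Ω × (Mark d c × ℝ≥0))} (hS : MeasurableSet[markPredictable d c ℱ] S) :
    SimplyApproximable ℱ ν μ ((S ∩ window Ω d c n).indicator fun _ => 1) := by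
  have hWm := measurableSet_window (ℱ := ℱ) (d := d) (c := c) n
  have hWm0 : MeasurableSet (window Ω d c n) := predictable_le ℱ _ _ hWm
  have hWint : Integrable ((window Ω d c n).indicator fun _ => (1 : ℝ)) μ :=
    (integrable_indicator_iff hWm0).2 (integrableOn_const (hμ n).ne)
  have hrect : ∀ {a b : ℝ≥0} {F : Set Ω} {A : Set (Mark d c)}, MeasurableSet[ℱ a] F →
      MeasurableSet A → SimplyApproximable ℱ ν μ
        ((F ×ˢ (A ×ˢ Ioc a b) ∩ window Ω d c n).indicator fun _ => 1) := by
    intro a b F A hF hA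
    rw [prod_inter_window, ← SimpleIntegrand.toFun_single (ν := ν) le_sup_left hF
      (hA.inter (measurableSet_bigMarks n))
      ((measure_mono inter_subset_right).trans_lt (hν.bigMarks_lt_top n))]
    exact toFun _
  have hW : SimplyApproximable ℱ ν μ ((window Ω d c n).indicator fun _ => 1) := by
    have := hrect (a := 0) (b := n) (F := univ) (A := bigMarks d c n) MeasurableSet.univ
      (measurableSet_bigMarks n)
    rwa [show (univ : Set Ω) ×ˢ (bigMarks d c n ×ˢ Ioc 0 (n : ℝ≥0)) = window Ω d c n from rfl,
      inter_self] at this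
  refine MeasurableSpace.induction_on_inter (m := markPredictable d c ℱ)
    (C := fun S _ => SimplyApproximable ℱ ν μ ((S ∩ window Ω d c n).indicator fun _ => 1))
    markPredictable_eq_generateFrom isPiSystem_predictableRectangles ?_ ?_ ?_ ?_ S hS
  · simpa using zero
  · rintro _ (⟨a, b, F, A, hF, hA, rfl⟩ | ⟨F, A, hF, hA, rfl⟩)
    · exact hrect hF hA
    · rw [prod_singleton_inter_window]; simpa using zero
  · intro t ht h
    have := hW.add (h.const_mul (-1))
    convert this using 1
    ext p
    by_cases h1 : p ∈ t <;> by_cases h2 : p ∈ window Ω d c n <;> simp [h1, h2]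
  · intro f hd hm h
    refine of_dominated (fun k => sum (Finset.range k) fun i _ => h i)
      (measurable_const.indicator ((MeasurableSet.iUnion hm).inter hWm)) hWint (fun k p => ?_)
      (ae_of_all _ fun p => ?_)
    · by_cases hpW : p ∈ window Ω d c n
      swap
      · simp [hpW]
      by_cases hp : ∃ j, p ∈ f j
      · obtain ⟨j, hj⟩ := hp
        have hne : ∀ i, i ≠ j → p ∉ f i := fun i hi hpi =>
          Set.disjoint_left.1 (hd hi) hpi hj
        have hU : p ∈ ⋃ i, f i := mem_iUnion.2 ⟨j, hj⟩
        by_cases hjk : j < k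
        · rw [Finset.sum_eq_single j (fun i _ hi => by simp [hne i hi])
            (fun h => absurd (Finset.mem_range.2 hjk) h)]
          simp [hpW, hj, hU]
        · rw [Finset.sum_eq_zero fun i hi => by
            have : i ≠ j := by rintro rfl; exact hjk (Finset.mem_range.1 hi)
            simp [hne i this]]
          simp [hpW, hU]
      · push Not at hp
        simp [hp, hpW]
    · by_cases hpW : p ∈ window Ω d c n
      swap
      · simp [hpW]
      by_cases hp : ∃ j, p ∈ f j
      · obtain ⟨j, hj⟩ := hp
        have hne : ∀ i, i ≠ j → p ∉ f i := fun i hi hpi =>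
          Set.disjoint_left.1 (hd hi) hpi hj
        refine tendsto_const_nhds.congr' ?_
        filter_upwards [eventually_gt_atTop j] with k hjk
        have hU : p ∈ ⋃ i, f i := mem_iUnion.2 ⟨j, hj⟩
        rw [Finset.sum_eq_single j (fun i _ hi => by simp [hne i hi])
          (fun h => absurd (Finset.mem_range.2 hjk) h)]
        simp [hpW, hj, hU]
      · push Not at hp
        simp [hp]

/-- Every integrable predictable function is an `L¹` limit of simple integrands. -/
lemma of_integrable (hν : IsLevyMeasure ν) (hμ : ∀ n, μ (window Ω d c n) < ∞)
    (hμ0 : ∀ᵐ p ∂μ, 0 < p.2.2) {f : Ω × (Mark d c × ℝ≥0) → ℝ}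
    (hf : Measurable[markPredictable d c ℱ] f) (hfi : Integrable f μ) :
    SimplyApproximable ℱ ν μ f := by
  have hsimple : ∀ (n : ℕ) (g : @SimpleFunc (Ω × (Mark d c × ℝ≥0)) (markPredictable d c ℱ) ℝ),
      SimplyApproximable ℱ ν μ ((window Ω d c n).indicator g) := by
    intro n g
    refine @SimpleFunc.induction _ _ (markPredictable d c ℱ) _
      (fun g => SimplyApproximable ℱ ν μ ((window Ω d c n).indicator g)) ?_ ?_ g
    · intro k S hS
      convert (indicator_inter_window (ν := ν) hν hμ n hS).const_mul k using 1
      ext p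
      by_cases h1 : p ∈ S <;> by_cases h2 : p ∈ window Ω d c n <;> simp [h1, h2]
    · intro g₁ g₂ _ h₁ h₂
      convert h₁.add h₂ using 1
      ext p
      by_cases h2 : p ∈ window Ω d c n <;> simp [h2]
  have hwin : ∀ n, SimplyApproximable ℱ ν μ ((window Ω d c n).indicator f) := by
    intro n
    have hWm := measurableSet_window (ℱ := ℱ) (d := d) (c := c) n
    refine of_tendsto (fun k => hsimple n (@SimpleFunc.approxOn _ _ _ _ _
      (markPredictable d c ℱ) f hf (range f ∪ {0}) 0 (by simp) _ k)) (hf.indicator hWm) ?_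
    have hle := predictable_le ℱ (Prod.snd : Mark d c × ℝ≥0 → ℝ≥0)
    have hft : Integrable f (μ.trim hle) := hfi.trim hle hf.stronglyMeasurable
    have h := @SimpleFunc.tendsto_approxOn_range_L1_enorm _ _ (markPredictable d c ℱ) _ _ _ f
      (μ.trim hle) _ hf hft
    refine tendsto_of_tendsto_of_tendsto_of_le_of_le tendsto_const_nhds h (fun _ => zero_le)
      fun k => ?_
    rw [lintegral_trim hle]
    · refine lintegral_mono fun p => ?_
      by_cases h2 : p ∈ window Ω d c n <;> simp [h2]
    · exact @measurable_enorm_sub _ (markPredictable d c ℱ) _ _ 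
        (@SimpleFunc.measurable _ _ (_) _ _) hf
  refine of_dominated (bound := fun p => |f p|) hwin hf hfi.abs (fun n p => ?_) ?_
  · by_cases h2 : p ∈ window Ω d c n <;> simp [h2]
  · filter_upwards [hμ0] with p hp
    have : p ∈ ⋃ n, window Ω d c n := by rw [iUnion_window]; exact hp
    obtain ⟨k, hk⟩ := mem_iUnion.1 this
    refine tendsto_const_nhds.congr' ?_
    filter_upwards [eventually_ge_atTop k] with n hn
    rw [indicator_of_mem (monotone_window hn hk)]

end SimplyApproximable

end Density

/-! ### The pathwise compensated integral -/

section CompensatedIntegral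

variable {d : ℕ} {c : ℝ} {Ω : Type*} {m : MeasurableSpace Ω} {P : Measure Ω}
  {ℱ : Filtration ℝ≥0 m} {ν : Measure (Mark d c)} {N : Ω → Measure (Mark d c × ℝ≥0)}
  {κ : Kernel Ω (Mark d c × ℝ≥0)}

/-- The strip `E × (0, t]`. -/
def strip (d : ℕ) (c : ℝ) (t : ℝ≥0) : Set (Mark d c × ℝ≥0) := univ ×ˢ Ioc 0 t

lemma measurableSet_strip (t : ℝ≥0) : MeasurableSet (strip d c t) :=
  MeasurableSet.univ.prod measurableSet_Ioc

lemma strip_mono {s t : ℝ≥0} (h : s ≤ t) : strip d c s ⊆ strip d c t :=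
  prod_mono le_rfl (Ioc_subset_Ioc_right h)

/-- The pathwise integral `∫_{E × (0,t]} f(ω, ·) d(κ(ω) - ν × λ)`. -/
def compensatedIntegral (κ : Kernel Ω (Mark d c × ℝ≥0)) (ν : Measure (Mark d c))
    (f : Ω × (Mark d c × ℝ≥0) → ℝ) (t : ℝ≥0) (ω : Ω) : ℝ :=
  ∫ z in strip d c t, f (ω, z) ∂(κ ω) - ∫ z in strip d c t, f (ω, z) ∂(ν.prod lebesgue)

lemma enorm_compensatedIntegral_le (f : Ω × (Mark d c × ℝ≥0) → ℝ) (t : ℝ≥0) (ω : Ω) :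
    ‖compensatedIntegral κ ν f t ω‖ₑ ≤ ∫⁻ z in strip d c t, ‖f (ω, z)‖ₑ ∂(κ ω) +
      ∫⁻ z in strip d c t, ‖f (ω, z)‖ₑ ∂(ν.prod lebesgue) :=
  enorm_sub_le.trans
    (add_le_add (enorm_integral_le_lintegral_enorm _) (enorm_integral_le_lintegral_enorm _))

lemma lintegral_strip_eq_iterated [SFinite ν] {h : Mark d c × ℝ≥0 → ℝ≥0∞} (hh : Measurable h)
    (t : ℝ≥0) :
    ∫⁻ z in strip d c t, h z ∂(ν.prod lebesgue) =
      ∫⁻ r in Ioc 0 t, ∫⁻ v, h (v, r) ∂ν ∂lebesgue := by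
  rw [strip, ← Measure.prod_restrict, Measure.restrict_univ, lintegral_prod_symm _ hh.aemeasurable]

/-- Compensation formula on the strip `E × (0, t]`. -/
lemma lintegral_strip_kernel_eq [IsProbabilityMeasure P]
    (hN : IsPoissonRandomMeasure P ℱ ν N) (hν : IsLevyMeasure ν) [IsSFiniteKernel κ]
    (hκ : ∀ᵐ ω ∂P, κ ω = N ω) {f : Ω × (Mark d c × ℝ≥0) → ℝ≥0∞}
    (hf : Measurable[markPredictable d c ℱ] f) (t : ℝ≥0) :
    ∫⁻ ω, ∫⁻ z in strip d c t, f (ω, z) ∂(κ ω) ∂P =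
      ∫⁻ ω, ∫⁻ z in strip d c t, f (ω, z) ∂(ν.prod lebesgue) ∂P := by
  have := hν.sigmaFinite
  have hS : MeasurableSet (strip d c t) := measurableSet_strip t
  have hSt : MeasurableSet[markPredictable d c ℱ] ((univ : Set Ω) ×ˢ strip d c t) :=
    measurableSet_predictable (a := 0) MeasurableSet.univ hS fun _ _ => Or.inr rfl
  have h := setLIntegral_compProd_eq hN hν hκ (hf.indicator hSt)
  have hsub : ((univ : Set Ω) ×ˢ strip d c t) ∩ {p | 0 < p.2.2} = univ ×ˢ strip d c t :=
    inter_eq_left.2 fun p hp => hp.2.2.1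
  rw [setLIntegral_indicator (predictable_le ℱ _ _ hSt),
    setLIntegral_indicator (predictable_le ℱ _ _ hSt), hsub] at h
  have hfm : Measurable f := measurable_of_markPredictable hf
  rw [Measure.setLIntegral_compProd hfm MeasurableSet.univ hS, ← Measure.compProd_const,
    Measure.setLIntegral_compProd hfm MeasurableSet.univ hS] at h
  simpa using h

lemma integral_strip_indicator (M : Measure (Mark d c × ℝ≥0)) {A : Set (Mark d c)} {a b t : ℝ≥0}
    (hA : MeasurableSet A) (hM : M (A ×ˢ Ioc a (min b t)) < ∞) (k : ℝ) :
    IntegrableOn (fun z => k * (A ×ˢ Ioc a b).indicator (fun _ => (1 : ℝ)) z) (strip d c t) M ∧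
    ∫ z in strip d c t, k * (A ×ˢ Ioc a b).indicator (fun _ => (1 : ℝ)) z ∂M =
      k * (M (A ×ˢ Ioc a (min b t))).toReal := by
  have hAm : MeasurableSet (A ×ˢ Ioc a b) := hA.prod measurableSet_Ioc
  have hinter : A ×ˢ Ioc a b ∩ strip d c t = A ×ˢ Ioc a (min b t) := by
    rw [strip, prod_inter_prod, inter_univ, Ioc_inter_Ioc]
    simp
  have hMr : (M.restrict (strip d c t)) (A ×ˢ Ioc a b) = M (A ×ˢ Ioc a (min b t)) := by
    rw [Measure.restrict_apply hAm, hinter]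
  constructor
  · refine Integrable.const_mul ?_ k
    rw [integrable_indicator_iff hAm]
    exact integrableOn_const (by rw [hMr]; exact hM.ne)
  · rw [integral_const_mul, integral_indicator_const _ hAm, measureReal_def, hMr, smul_eq_mul,
      mul_one]

lemma integrableOn_toFun (φ : SimpleIntegrand ℱ ν) (M : Measure (Mark d c × ℝ≥0)) {t : ℝ≥0}
    (hM : ∀ i, M (φ.A i ×ˢ Ioc (φ.a i) (min (φ.b i) t)) < ∞) (ω : Ω) :
    IntegrableOn (fun z => φ.toFun (ω, z)) (strip d c t) M ∧
    ∫ z in strip d c t, φ.toFun (ω, z) ∂M =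
      ∑ i, φ.ξ i ω * (M (φ.A i ×ˢ Ioc (φ.a i) (min (φ.b i) t))).toReal := by
  have h := fun i => integral_strip_indicator M (φ.measurableSet i) (hM i) (φ.ξ i ω)
  unfold SimpleIntegrand.toFun SimpleIntegrand.eval
  refine ⟨integrable_finsetSum _ fun i _ => (h i).1, ?_⟩
  simp only [Prod.mk.eta]
  rw [integral_finsetSum _ fun i _ => (h i).1]
  exact Finset.sum_congr rfl fun i _ => (h i).2

/-- The elementary integral of a simple integrand is its pathwise compensated integral. -/
lemma ae_integral_eq_compensatedIntegral (hN : IsPoissonRandomMeasure P ℱ ν N)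
    (hν : IsLevyMeasure ν) (hκ : ∀ᵐ ω ∂P, κ ω = N ω) (φ : SimpleIntegrand ℱ ν) (t : ℝ≥0) :
    ∀ᵐ ω ∂P, IntegrableOn (fun z => φ.toFun (ω, z)) (strip d c t) (κ ω) ∧
      IntegrableOn (fun z => φ.toFun (ω, z)) (strip d c t) (ν.prod lebesgue) ∧
      φ.integral N t ω = compensatedIntegral κ ν φ.toFun t ω := by
  have := hν.sigmaFinite
  have hfin : ∀ᵐ ω ∂P, ∀ i, N ω (φ.A i ×ˢ Ioc (φ.a i) (min (φ.b i) t)) < ∞ :=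
    ae_all_iff.2 fun i => hN.ae_lt_top (φ.measurableSet i) measurableSet_Ioc (φ.finite i)
      (lebesgue_Ioc_lt_top _ _)
  filter_upwards [hfin, hκ] with ω hω hκω
  have h1 := integrableOn_toFun φ (κ ω) (t := t) (by rw [hκω]; exact hω) ω
  have h2 := integrableOn_toFun φ (ν.prod lebesgue) (t := t) (fun i => by
    rw [Measure.prod_prod]
    exact ENNReal.mul_lt_top (φ.finite i) (lebesgue_Ioc_lt_top _ _)) ω
  refine ⟨h1.1, h2.1, ?_⟩
  rw [compensatedIntegral, h1.2, h2.2, ← Finset.sum_sub_distrib, SimpleIntegrand.integral]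
  refine Finset.sum_congr rfl fun i _ => ?_
  rw [compensated, ← mul_sub, hκω, Measure.prod_prod]

/-- The compensated integral is Lipschitz in `L¹`, with constant `2`, with respect to predictable
integrands; stated for the distance to an elementary integral. -/
lemma lintegral_enorm_integral_sub_le [IsProbabilityMeasure P]
    (hN : IsPoissonRandomMeasure P ℱ ν N) (hν : IsLevyMeasure ν) [IsSFiniteKernel κ]
    (hκ : ∀ᵐ ω ∂P, κ ω = N ω) {f : Ω × (Mark d c × ℝ≥0) → ℝ}
    (hf : Measurable[markPredictable d c ℱ] f) {t : ℝ≥0}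
    (hfin : ∫⁻ ω, ∫⁻ z in strip d c t, ‖f (ω, z)‖ₑ ∂(ν.prod lebesgue) ∂P < ∞)
    (φ : SimpleIntegrand ℱ ν) :
    ∫⁻ ω, ‖φ.integral N t ω - compensatedIntegral κ ν f t ω‖ₑ ∂P ≤
      2 * ∫⁻ ω, ∫⁻ z in strip d c t, ‖φ.toFun (ω, z) - f (ω, z)‖ₑ ∂(ν.prod lebesgue) ∂P := by
  have := hν.sigmaFinite
  have hfm : Measurable f := measurable_of_markPredictable hf
  have hφm : Measurable φ.toFun := measurable_of_markPredictable φ.measurable_toFun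
  have hfe : Measurable[markPredictable d c ℱ] (fun p => ‖f p‖ₑ) := measurable_enorm.comp hf
  have hde : Measurable[markPredictable d c ℱ] (fun p => ‖φ.toFun p - f p‖ₑ) :=
    @measurable_enorm_sub _ (markPredictable d c ℱ) _ _ φ.measurable_toFun hf
  have hsec : ∀ ω, Measurable fun z => f (ω, z) := fun ω => hfm.comp measurable_prodMk_left
  have hm1 : Measurable fun ω => ∫⁻ z in strip d c t, ‖f (ω, z)‖ₑ ∂(κ ω) :=
    Measurable.setLIntegral_kernel_prod_right (f := fun ω z => ‖f (ω, z)‖ₑ)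
      (by exact hfm.enorm) (measurableSet_strip t)
  have hm2 : Measurable fun ω => ∫⁻ z in strip d c t, ‖f (ω, z)‖ₑ ∂(ν.prod lebesgue) :=
    Measurable.lintegral_prod_right' (f := fun p : Ω × (Mark d c × ℝ≥0) => ‖f p‖ₑ)
      (by exact hfm.enorm)
  have hm3 : Measurable fun ω => ∫⁻ z in strip d c t, ‖φ.toFun (ω, z) - f (ω, z)‖ₑ ∂(κ ω) :=
    Measurable.setLIntegral_kernel_prod_right (f := fun ω z => ‖φ.toFun (ω, z) - f (ω, z)‖ₑ)
      (by exact (hφm.sub hfm).enorm) (measurableSet_strip t)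
  have hfin1 : ∀ᵐ ω ∂P, ∫⁻ z in strip d c t, ‖f (ω, z)‖ₑ ∂(κ ω) < ∞ :=
    ae_lt_top hm1 (by rw [lintegral_strip_kernel_eq hN hν hκ hfe]; exact hfin.ne)
  have hfin2 : ∀ᵐ ω ∂P, ∫⁻ z in strip d c t, ‖f (ω, z)‖ₑ ∂(ν.prod lebesgue) < ∞ :=
    ae_lt_top hm2 hfin.ne
  calc ∫⁻ ω, ‖φ.integral N t ω - compensatedIntegral κ ν f t ω‖ₑ ∂P
      ≤ ∫⁻ ω, (∫⁻ z in strip d c t, ‖φ.toFun (ω, z) - f (ω, z)‖ₑ ∂(κ ω) +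
          ∫⁻ z in strip d c t, ‖φ.toFun (ω, z) - f (ω, z)‖ₑ ∂(ν.prod lebesgue)) ∂P := by
        refine lintegral_mono_ae ?_
        filter_upwards [hfin1, hfin2, ae_integral_eq_compensatedIntegral hN hν hκ φ t]
          with ω h1 h2 h3
        have hf1 : IntegrableOn (fun z => f (ω, z)) (strip d c t) (κ ω) :=
          ⟨(hsec ω).aestronglyMeasurable, h1⟩
        have hf2 : IntegrableOn (fun z => f (ω, z)) (strip d c t) (ν.prod lebesgue) :=
          ⟨(hsec ω).aestronglyMeasurable, h2⟩
        have heq : φ.integral N t ω - compensatedIntegral κ ν f t ω =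
            compensatedIntegral κ ν (fun p => φ.toFun p - f p) t ω := by
          rw [h3.2.2]
          simp only [compensatedIntegral]
          rw [integral_sub h3.1 hf1, integral_sub h3.2.1 hf2]
          ring
        rw [heq]
        exact enorm_compensatedIntegral_le _ t ω
    _ = ∫⁻ ω, ∫⁻ z in strip d c t, ‖φ.toFun (ω, z) - f (ω, z)‖ₑ ∂(κ ω) ∂P +
          ∫⁻ ω, ∫⁻ z in strip d c t, ‖φ.toFun (ω, z) - f (ω, z)‖ₑ ∂(ν.prod lebesgue) ∂P :=
        lintegral_add_left hm3 _
    _ = _ := by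
        rw [lintegral_strip_kernel_eq hN hν hκ hde, two_mul]

/-- An integrable predictable integrand is approximated by simple ones in `L¹(Ω × E × (0, t])`. -/
lemma exists_tendsto_simpleIntegrand [IsProbabilityMeasure P] (hν : IsLevyMeasure ν)
    {f : Ω × (Mark d c × ℝ≥0) → ℝ} (hf : Measurable[markPredictable d c ℱ] f) {t : ℝ≥0}
    (hfin : ∫⁻ ω, ∫⁻ z in strip d c t, ‖f (ω, z)‖ₑ ∂(ν.prod lebesgue) ∂P < ∞) :
    ∃ φ : ℕ → SimpleIntegrand ℱ ν, Tendsto (fun n => ∫⁻ ω, ∫⁻ z in strip d c t,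
      ‖(φ n).toFun (ω, z) - f (ω, z)‖ₑ ∂(ν.prod lebesgue) ∂P) atTop (𝓝 0) := by
  have := hν.sigmaFinite
  have hfm : Measurable f := measurable_of_markPredictable hf
  set μ : Measure (Ω × (Mark d c × ℝ≥0)) :=
    P.prod ((ν.prod lebesgue).restrict (strip d c t)) with hμ
  have hμeq : μ = (P.prod (ν.prod lebesgue)).restrict (univ ×ˢ strip d c t) := by
    rw [← Measure.prod_restrict, Measure.restrict_univ]
  have hlint : ∀ h : Ω × (Mark d c × ℝ≥0) → ℝ≥0∞, Measurable h → ∫⁻ p, h p ∂μ =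
      ∫⁻ ω, ∫⁻ z in strip d c t, h (ω, z) ∂(ν.prod lebesgue) ∂P := fun h hh =>
    lintegral_prod _ hh.aemeasurable
  have happ : SimplyApproximable ℱ ν μ f := by
    refine SimplyApproximable.of_integrable hν (fun n => ?_) ?_ hf
      ⟨hfm.aestronglyMeasurable, ?_⟩
    · rw [hμeq]
      exact (Measure.restrict_le_self _).trans_lt (prod_window_lt_top hν n)
    · rw [hμeq]
      exact (ae_restrict_iff' (MeasurableSet.univ.prod (measurableSet_strip t))).2
        (ae_of_all _ fun p hp => hp.2.2.1)
    · rw [HasFiniteIntegral, hlint _ hfm.enorm]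
      exact hfin
  choose φ hφ using fun n : ℕ => happ.approx ((n : ℝ≥0∞) + 1)⁻¹ (by simp)
  refine ⟨φ, ?_⟩
  have h0 : Tendsto (fun n : ℕ => ((n : ℝ≥0∞) + 1)⁻¹) atTop (𝓝 0) := by
    have := (ENNReal.tendsto_inv_nat_nhds_zero).comp (tendsto_add_atTop_nat 1)
    simpa [Function.comp_def] using this
  refine tendsto_of_tendsto_of_tendsto_of_le_of_le tendsto_const_nhds h0 (fun _ => zero_le)
    fun n => ?_
  rw [← hlint (fun p => ‖(φ n).toFun p - f p‖ₑ)]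
  · exact hφ n
  · exact measurable_enorm_sub (measurable_of_markPredictable (φ n).measurable_toFun) hfm

end CompensatedIntegral

/-! ### Predictable version of the source, essential suprema and upper expectations -/

section EssSup

variable {Θ V : Type*} [MeasurableSpace Θ] [MeasurableSpace V]

lemma measurable_essSup_section (μ : Measure V) [SFinite μ] {h : Θ × V → ℝ≥0∞}
    (hh : Measurable h) : Measurable (fun θ => essSup (fun y => h (θ, y)) μ) := by
  refine measurable_of_Iic fun a => ?_
  have : (fun θ => essSup (fun y => h (θ, y)) μ) ⁻¹' Iic a =
      {θ | μ (Prod.mk θ ⁻¹' {q | a < h q}) = 0} := by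
    ext θ
    simp only [mem_preimage, mem_Iic, mem_ofPred_eq]
    constructor
    · intro hle
      have h1 : ∀ᵐ y ∂μ, h (θ, y) ≤ a :=
        (ae_le_essSup (f := fun y => h (θ, y))).mono fun y hy => hy.trans hle
      rw [ae_iff] at h1
      simpa using h1
    · intro h0
      refine essSup_le_of_ae_le a ?_
      rw [EventuallyLE, ae_iff]
      simpa using h0
  rw [this]
  exact measurable_measure_prodMk_left (measurableSet_lt measurable_const hh)
    (measurableSet_singleton 0)

lemma measurable_eLpNorm_top_section (μ : Measure V) [SFinite μ] {h : Θ × V → ℝ}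
    (hh : Measurable h) : Measurable (fun θ => eLpNorm (fun y => h (θ, y)) ∞ μ) := by
  simp only [eLpNorm_exponent_top, eLpNormEssSup]
  exact measurable_essSup_section μ (h := fun q => ‖h q‖ₑ) hh.enorm

end EssSup

section UpperExpectation

variable {Ω : Type*} {m : MeasurableSpace Ω} {P : Measure Ω}

lemma upperExpectation_le {X Y : Ω → ℝ≥0∞} (hY : Measurable Y) (h : ∀ᵐ ω ∂P, X ω ≤ Y ω) :
    upperExpectation P X ≤ ∫⁻ ω, Y ω ∂P := by
  classical
  set S := toMeasurable P {ω | ¬ X ω ≤ Y ω} with hS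
  have hS0 : P S = 0 := by rw [hS, measure_toMeasurable]; exact h
  have hSm : MeasurableSet S := measurableSet_toMeasurable _ _
  have hY' : Measurable (S.piecewise (fun _ => ∞) Y) := measurable_const.piecewise hSm hY
  have hle : ∀ ω, X ω ≤ S.piecewise (fun _ => ∞) Y ω := fun ω => by
    by_cases hω : ω ∈ S
    · simp [hω]
    · rw [piecewise_eq_of_notMem _ _ _ hω]
      by_contra hc
      exact hω (subset_toMeasurable P _ hc)
  have h1 : upperExpectation P X ≤ ∫⁻ ω, S.piecewise (fun _ => ∞) Y ω ∂P :=
    iInf_le_of_le _ (iInf_le_of_le hY' (iInf_le_of_le hle le_rfl))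
  refine h1.trans_eq ?_
  refine lintegral_congr_ae ?_
  filter_upwards [measure_eq_zero_iff_ae_notMem.1 hS0] with ω hω
  rw [piecewise_eq_of_notMem _ _ _ hω]

end UpperExpectation

section Version

variable {d : ℕ} {c : ℝ} {Ω : Type*} {m : MeasurableSpace Ω} {P : Measure Ω}
  {ℱ : Filtration ℝ≥0 m} {ν : Measure (Mark d c)}

/-- The source `g` has a version that is predictable, jointly with the space variable. The space
variable is first treated as part of the parameter `((v, r), x)`, whose time is `r`. -/
lemma exists_predictable_version [IsProbabilityMeasure P] (hν : IsLevyMeasure ν)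
    {g : ℝ≥0 → Mark d c → Space d → Ω → ℝ}
    (hg : Measurable (fun p : ℝ≥0 × Mark d c × Space d × Ω => g p.1 p.2.1 p.2.2.1 p.2.2.2))
    (had : ∀ t v x, AEStronglyMeasurable[ℱ t] (g t v x) P) :
    ∃ g' : (Ω × (Mark d c × ℝ≥0)) × Space d → ℝ,
      Measurable[(markPredictable d c ℱ).prod inferInstance] g' ∧
      ∀ᵐ θ ∂(P.prod (ν.prod lebesgue)), ∀ᵐ x, g' (θ, x) = g θ.2.2 θ.2.1 x θ.1 := by
  have := hν.sigmaFinite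
  set μX : Measure ((Mark d c × ℝ≥0) × Space d) := (ν.prod lebesgue).prod volume with hμX
  obtain ⟨η, hη, hη1, hη2⟩ := exists_isFiniteMeasure_absolutelyContinuous μX
  let τ : (Mark d c × ℝ≥0) × Space d → ℝ≥0 := fun x => x.1.2
  have hτ : Measurable τ := by fun_prop
  have hη0 : ∀ r, η (τ ⁻¹' {r}) = 0 := fun r => by
    refine hη2 ?_
    have : τ ⁻¹' {r} = (univ ×ˢ {r}) ×ˢ univ := by ext; simp [τ]
    rw [this, hμX, Measure.prod_prod, Measure.prod_prod, lebesgue_singleton]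
    simp
  let G : Ω × ((Mark d c × ℝ≥0) × Space d) → ℝ := fun p => g p.2.1.2 p.2.1.1 p.2.2 p.1
  have hG : Measurable G := by
    have h1 : Measurable (fun p : Ω × ((Mark d c × ℝ≥0) × Space d) =>
        (p.2.1.2, p.2.1.1, p.2.2, p.1)) := by fun_prop
    exact hg.comp h1
  obtain ⟨H, hH, hGH⟩ := aestronglyMeasurable_predictable (P := P) (ℱ := ℱ) hτ hη0 hG
    fun x => had x.1.2 x.1.1 x.2
  have hGH' : ∀ᵐ p ∂(P.prod μX), G p = H p :=
    (Measure.AbsolutelyContinuous.prod Measure.AbsolutelyContinuous.rfl hη1).ae_le hGH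
  let e : (Ω × (Mark d c × ℝ≥0)) × Space d → Ω × ((Mark d c × ℝ≥0) × Space d) :=
    fun q => (q.1.1, (q.1.2, q.2))
  have he : MeasurePreserving e ((P.prod (ν.prod lebesgue)).prod volume) (P.prod μX) :=
    measurePreserving_prodAssoc P (ν.prod lebesgue) volume
  have hem : Measurable[(markPredictable d c ℱ).prod inferInstance, predictable ℱ τ] e := by
    refine @measurable_generateFrom _ _ ((markPredictable d c ℱ).prod inferInstance) _ _ ?_
    rintro _ ⟨a, F, B, hF, hB, ha, rfl⟩
    have hfst : Measurable[(markPredictable d c ℱ).prod inferInstance, markPredictable d c ℱ]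
        (Prod.fst : (Ω × (Mark d c × ℝ≥0)) × Space d → Ω × (Mark d c × ℝ≥0)) :=
      @measurable_fst _ _ (markPredictable d c ℱ) _
    have hsnd : Measurable[(markPredictable d c ℱ).prod inferInstance]
        (Prod.snd : (Ω × (Mark d c × ℝ≥0)) × Space d → Space d) :=
      @measurable_snd _ _ (markPredictable d c ℱ) _
    have hz : Measurable[(markPredictable d c ℱ).prod inferInstance]
        (fun q : (Ω × (Mark d c × ℝ≥0)) × Space d => (q.1.2, q.2)) := by
      have hv : Measurable[(markPredictable d c ℱ).prod inferInstance]
          (fun q : (Ω × (Mark d c × ℝ≥0)) × Space d => q.1.2) :=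
        measurable_snd_predictable.comp hfst
      exact hv.prodMk hsnd
    have hset : e ⁻¹' (F ×ˢ B) = (Prod.fst ⁻¹' (F ×ˢ {z : Mark d c × ℝ≥0 | a < z.2 ∨ a = 0})) ∩
        (fun q : (Ω × (Mark d c × ℝ≥0)) × Space d => (q.1.2, q.2)) ⁻¹' B := by
      ext q
      simp only [e, mem_preimage, mem_prod, mem_inter_iff]
      exact ⟨fun h => ⟨⟨h.1, ha _ h.2⟩, h.2⟩, fun h => ⟨h.1.1, h.2⟩⟩
    rw [hset]
    refine MeasurableSet.inter (hfst (measurableSet_predictable hF ?_ fun _ h => h)) (hz hB)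
    exact (measurableSet_lt measurable_const measurable_snd).union (MeasurableSet.const _)
  refine ⟨H ∘ e, hH.measurable.comp hem, ?_⟩
  have h2 : ∀ᵐ q ∂((P.prod (ν.prod lebesgue)).prod volume), G (e q) = H (e q) :=
    he.quasiMeasurePreserving.ae hGH'
  filter_upwards [Measure.ae_ae_of_ae_prod h2] with θ hθ
  filter_upwards [hθ] with x hx
  exact hx.symm

end Version

/-! ### The stochastic convolution -/

section StochasticIntegral

variable {d : ℕ} {c : ℝ} {Ω : Type*} {m : MeasurableSpace Ω} {P : Measure Ω}
  {ℱ : Filtration ℝ≥0 m} {ν : Measure (Mark d c)} {N : Ω → Measure (Mark d c × ℝ≥0)}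
  {κ : Kernel Ω (Mark d c × ℝ≥0)}

lemma SimpleIntegrand.measurable_integral (hN : IsPoissonRandomMeasure P ℱ ν N)
    (φ : SimpleIntegrand ℱ ν) (t : ℝ≥0) : Measurable (φ.integral N t) := by
  unfold SimpleIntegrand.integral compensated
  refine Finset.measurable_fun_sum _ fun i _ => ?_
  refine ((φ.measurable i).mono (ℱ.le _) le_rfl).mul (Measurable.sub_const ?_ _)
  exact (hN.measurable_apply ((φ.measurableSet i).prod measurableSet_Ioc)).ennreal_toReal

/-- Joint measurability of pathwise compensated integrals that depend on a parameter. -/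
lemma measurable_compensatedIntegral_param [SFinite ν] [IsSFiniteKernel κ] {A : Type*}
    [MeasurableSpace A] {t : A → ℝ≥0} (ht : Measurable t) {w : A → Ω} (hw : Measurable w)
    {F : A × (Mark d c × ℝ≥0) → ℝ} (hF : Measurable F) :
    Measurable fun a => ∫ z in strip d c (t a), F (a, z) ∂(κ (w a)) -
      ∫ z in strip d c (t a), F (a, z) ∂(ν.prod lebesgue) := by
  set S : Set (A × (Mark d c × ℝ≥0)) := {q | 0 < q.2.2 ∧ q.2.2 ≤ t q.1} with hS
  have hSm : MeasurableSet S :=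
    (measurableSet_lt measurable_const (by fun_prop)).inter
      (measurableSet_le (by fun_prop) (by fun_prop))
  have hI : ∀ (M : Measure (Mark d c × ℝ≥0)) (a : A),
      ∫ z in strip d c (t a), F (a, z) ∂M = ∫ z, S.indicator F (a, z) ∂M := fun M a => by
    rw [← integral_indicator (measurableSet_strip _)]
    refine integral_congr_ae (ae_of_all _ fun z => ?_)
    simp only [indicator, strip, mem_prod, mem_univ, true_and, mem_Ioc, hS, mem_ofPred_eq]
  simp only [hI]
  have hFS : StronglyMeasurable (S.indicator F) := (hF.indicator hSm).stronglyMeasurable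
  refine Measurable.sub ?_ hFS.integral_prod_right'.measurable
  exact (StronglyMeasurable.integral_kernel_prod_right' (κ := κ.comap w hw) hFS).measurable

lemma measurable_compensatedIntegral [SFinite ν] [IsSFiniteKernel κ]
    {f : Ω × (Mark d c × ℝ≥0) → ℝ} (hf : Measurable f) (t : ℝ≥0) :
    Measurable (compensatedIntegral κ ν f t) :=
  measurable_compensatedIntegral_param measurable_const measurable_id hf

/-- The pathwise compensated integral of an integrable predictable integrand is a version of its
stochastic integral, and every version agrees with it almost surely. The predictable `f` is only
almost everywhere equal to the integrand `h` of the stochastic integral. -/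
lemma isStochasticIntegral_iff [IsProbabilityMeasure P] (hN : IsPoissonRandomMeasure P ℱ ν N)
    (hν : IsLevyMeasure ν) [IsSFiniteKernel κ] (hκ : ∀ᵐ ω ∂P, κ ω = N ω)
    {f : Ω × (Mark d c × ℝ≥0) → ℝ} (hf : Measurable[markPredictable d c ℱ] f) {t : ℝ≥0}
    (hfin : ∫⁻ ω, ∫⁻ z in strip d c t, ‖f (ω, z)‖ₑ ∂(ν.prod lebesgue) ∂P < ∞)
    {h : ℝ≥0 → Mark d c → Ω → ℝ}
    (hh : Measurable fun p : Ω × (Mark d c × ℝ≥0) => h p.2.2 p.2.1 p.1)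
    (hfh : ∀ᵐ p ∂(P.prod (ν.prod lebesgue)), p.2 ∈ strip d c t → h p.2.2 p.2.1 p.1 = f p)
    {I : Ω → ℝ} (hI : AEMeasurable I P) :
    IsStochasticIntegral P ℱ ν N t h I ↔ I =ᵐ[P] compensatedIntegral κ ν f t := by
  have := hν.sigmaFinite
  have hfm : Measurable f := measurable_of_markPredictable hf
  have hJ : Measurable (compensatedIntegral κ ν f t) := measurable_compensatedIntegral hfm t
  have hφh : ∀ φ : SimpleIntegrand ℱ ν,
      ∫⁻ ω, ∫⁻ r in Ioc 0 t, ∫⁻ v, ‖φ.eval r v ω - h r v ω‖ₑ ∂ν ∂lebesgue ∂P =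
        ∫⁻ ω, ∫⁻ z in strip d c t, ‖φ.toFun (ω, z) - f (ω, z)‖ₑ ∂(ν.prod lebesgue) ∂P := by
    intro φ
    have hφm : Measurable φ.toFun := measurable_of_markPredictable φ.measurable_toFun
    have hae : ∀ᵐ ω ∂P, ∀ᵐ z ∂(ν.prod lebesgue), z ∈ strip d c t →
        h z.2 z.1 ω = f (ω, z) := Measure.ae_ae_of_ae_prod hfh
    refine lintegral_congr_ae ?_
    filter_upwards [hae] with ω hω
    have hm : Measurable fun z : Mark d c × ℝ≥0 => ‖φ.toFun (ω, z) - h z.2 z.1 ω‖ₑ :=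
      (measurable_enorm_sub hφm hh).comp (measurable_prodMk_left (x := ω))
    refine (lintegral_strip_eq_iterated (ν := ν) hm t).symm.trans ?_
    refine setLIntegral_congr_fun_ae (measurableSet_strip t) ?_
    filter_upwards [hω] with z hz hzt
    rw [hz hzt]
  unfold IsStochasticIntegral
  simp only [hφh]
  constructor
  · rintro ⟨-, φ, hφ1, hφ2⟩
    have hle : ∀ n, ∫⁻ ω, ‖I ω - compensatedIntegral κ ν f t ω‖ₑ ∂P ≤
        ∫⁻ ω, ‖(φ n).integral N t ω - I ω‖ₑ ∂P +
          2 * ∫⁻ ω, ∫⁻ z in strip d c t, ‖(φ n).toFun (ω, z) - f (ω, z)‖ₑ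
            ∂(ν.prod lebesgue) ∂P := fun n => by
      have hmn := (φ n).measurable_integral hN t
      refine le_trans ?_ (add_le_add_right
        (lintegral_enorm_integral_sub_le hN hν hκ hf hfin (φ n)) _)
      have hmI : AEMeasurable (fun ω => ‖(φ n).integral N t ω - I ω‖ₑ) P :=
        (hmn.aemeasurable.sub hI).enorm
      rw [← lintegral_add_left' hmI]
      refine lintegral_mono fun ω => ?_
      have : I ω - compensatedIntegral κ ν f t ω =
          ((φ n).integral N t ω - compensatedIntegral κ ν f t ω) -
            ((φ n).integral N t ω - I ω) := by ring
      rw [this]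
      exact enorm_sub_le.trans_eq (add_comm _ _)
    have hlim := hφ2.add (ENNReal.Tendsto.const_mul (a := 2) hφ1 (Or.inr (by simp)))
    rw [mul_zero, add_zero] at hlim
    have h0 := le_antisymm (ge_of_tendsto' hlim hle) zero_le
    filter_upwards [(lintegral_eq_zero_iff' (hI.sub hJ.aemeasurable).enorm).1 h0] with ω hω
    exact sub_eq_zero.1 (enorm_eq_zero.1 hω)
  · intro hIJ
    obtain ⟨φ, hφ⟩ := exists_tendsto_simpleIntegrand hν hf hfin
    refine ⟨hI, φ, hφ, ?_⟩
    have hlim := ENNReal.Tendsto.const_mul (a := 2) hφ (Or.inr (by simp))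
    rw [mul_zero] at hlim
    refine tendsto_of_tendsto_of_tendsto_of_le_of_le tendsto_const_nhds hlim
      (fun _ => zero_le) fun n => ?_
    refine le_trans (lintegral_mono_ae ?_)
      (lintegral_enorm_integral_sub_le hN hν hκ hf hfin (φ n))
    filter_upwards [hIJ] with ω hω
    rw [hω]

end StochasticIntegral

section Convolution

variable {d : ℕ} {c α : ℝ} {Ω : Type*} {m : MeasurableSpace Ω} {P : Measure Ω}
  {ℱ : Filtration ℝ≥0 m} {ν : Measure (Mark d c)} {N : Ω → Measure (Mark d c × ℝ≥0)}
  {κ : Kernel Ω (Mark d c × ℝ≥0)} {g' : (Ω × (Mark d c × ℝ≥0)) × Space d → ℝ}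

/-- The field `(K(t - r, ·) ∗ g'(r, v, ·))(x)` at `θ = (ω, (v, r))`. -/
def convField (α : ℝ) (g' : (Ω × (Mark d c × ℝ≥0)) × Space d → ℝ) (t : ℝ≥0) (x : Space d)
    (θ : Ω × (Mark d c × ℝ≥0)) : ℝ :=
  heatConv α (t - θ.2.2) (fun y => g' (θ, y)) x

/-- The norm `‖g'(r, v, ·)‖_{L^∞(ℝᵈ)}` at `θ = (ω, (v, r))`. -/
def supNorm (g' : (Ω × (Mark d c × ℝ≥0)) × Space d → ℝ) (θ : Ω × (Mark d c × ℝ≥0)) : ℝ≥0∞ :=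
  eLpNorm (fun y => g' (θ, y)) ∞ volume

lemma measurable_of_markPredictable_prod
    (hg' : Measurable[(markPredictable d c ℱ).prod inferInstance] g') : Measurable g' :=
  hg'.mono (sup_le_sup (MeasurableSpace.comap_mono (predictable_le ℱ _)) le_rfl) le_rfl

lemma measurable_supNorm (hg' : Measurable[(markPredictable d c ℱ).prod inferInstance] g') :
    Measurable[markPredictable d c ℱ] (supNorm g') :=
  @measurable_eLpNorm_top_section _ _ (markPredictable d c ℱ) _ volume _ g' hg'

lemma measurable_convField (hg' : Measurable[(markPredictable d c ℱ).prod inferInstance] g')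
    (t : ℝ≥0) (x : Space d) : Measurable[markPredictable d c ℱ] (convField α g' t x) := by
  have hr : Measurable[markPredictable d c ℱ]
      (fun θ : Ω × (Mark d c × ℝ≥0) => t - θ.2.2) :=
    (measurable_const.sub measurable_snd).comp measurable_snd_predictable
  exact @measurable_heatConv _ _ (markPredictable d c ℱ) α _ hr g' hg' _
    (@measurable_const _ _ _ (markPredictable d c ℱ) x)

lemma measurable_convField_joint (hg' : Measurable g') :
    Measurable fun q : (ℝ≥0 × Space d × Ω) × (Mark d c × ℝ≥0) =>
      convField α g' q.1.1 q.1.2.1 (q.1.2.2, q.2) := by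
  have hs : Measurable fun q : (ℝ≥0 × Space d × Ω) × (Mark d c × ℝ≥0) => q.1.1 - q.2.2 := by
    fun_prop
  have hG : Measurable fun p : ((ℝ≥0 × Space d × Ω) × (Mark d c × ℝ≥0)) × Space d =>
      g' ((p.1.1.2.2, p.1.2), p.2) := hg'.comp (by fun_prop)
  exact measurable_heatConv α hs hG (by fun_prop)

lemma enorm_convField_le (hd : 1 ≤ d) (hα : 0 < α) (hα2 : α ≤ 2) (t : ℝ≥0)
    (θ : Ω × (Mark d c × ℝ≥0)) :
    ∀ᵐ x, ‖convField α g' t x θ‖ₑ ≤ supNorm g' θ := by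
  by_cases h : t - θ.2.2 = 0
  · -- at time `0` the convolution is `g'` itself, bounded by its norm only almost everywhere
    rw [supNorm, eLpNorm_exponent_top]
    filter_upwards [enorm_ae_le_eLpNormEssSup (fun y => g' (θ, y)) volume] with x hx
    rwa [convField, heatConv, if_pos h]
  · exact ae_of_all _ fun x => enorm_heatConv_le hd hα hα2 h _ x

/-- The bound `∫ ‖g'‖ dN + ∫ ‖g'‖ dν dλ` over `E × (0, T]`, uniform in time and space. -/
def pathBound (κ : Kernel Ω (Mark d c × ℝ≥0)) (ν : Measure (Mark d c))
    (g' : (Ω × (Mark d c × ℝ≥0)) × Space d → ℝ) (T : ℝ≥0) (ω : Ω) : ℝ≥0∞ :=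
  ∫⁻ z in strip d c T, supNorm g' (ω, z) ∂(κ ω) +
    ∫⁻ z in strip d c T, supNorm g' (ω, z) ∂(ν.prod lebesgue)

lemma measurable_pathBound [SFinite ν] [IsSFiniteKernel κ]
    (hg' : Measurable[(markPredictable d c ℱ).prod inferInstance] g') (T : ℝ≥0) :
    Measurable (pathBound κ ν g' T) := by
  have hm : Measurable (supNorm g') := measurable_of_markPredictable (measurable_supNorm hg')
  exact (Measurable.setLIntegral_kernel_prod_right (f := fun ω z => supNorm g' (ω, z)) hm
    (measurableSet_strip T)).add (Measurable.lintegral_prod_right' hm)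

lemma lintegral_pathBound [IsProbabilityMeasure P] (hN : IsPoissonRandomMeasure P ℱ ν N)
    (hν : IsLevyMeasure ν) [IsSFiniteKernel κ] (hκ : ∀ᵐ ω ∂P, κ ω = N ω)
    (hg' : Measurable[(markPredictable d c ℱ).prod inferInstance] g') (T : ℝ≥0) :
    ∫⁻ ω, pathBound κ ν g' T ω ∂P =
      2 * ∫⁻ ω, ∫⁻ z in strip d c T, supNorm g' (ω, z) ∂(ν.prod lebesgue) ∂P := by
  have := hν.sigmaFinite
  have hm : Measurable (supNorm g') := measurable_of_markPredictable (measurable_supNorm hg')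
  unfold pathBound
  rw [lintegral_add_right _ (Measurable.lintegral_prod_right' hm),
    lintegral_strip_kernel_eq hN hν hκ (measurable_supNorm hg'), two_mul]

/-- The pathwise integral is bounded in `L^∞(ℝᵈ)`, uniformly in `t ≤ T`. -/
lemma eLpNorm_compensatedIntegral_le (hd : 1 ≤ d) (hα : 0 < α) (hα2 : α ≤ 2) [SFinite ν]
    [IsSFiniteKernel κ] (hg' : Measurable[(markPredictable d c ℱ).prod inferInstance] g')
    {t T : ℝ≥0} (htT : t ≤ T) (ω : Ω) :
    eLpNorm (fun x => compensatedIntegral κ ν (convField α g' t x) t ω) ∞ volume ≤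
      pathBound κ ν g' T ω := by
  have hsup : Measurable fun z => supNorm g' (ω, z) :=
    (measurable_of_markPredictable (measurable_supNorm hg')).comp measurable_prodMk_left
  have hconv : Measurable fun q : (Mark d c × ℝ≥0) × Space d =>
      convField α g' t q.2 (ω, q.1) :=
    (measurable_convField_joint (measurable_of_markPredictable_prod hg')).comp
      (f := fun q : (Mark d c × ℝ≥0) × Space d => ((t, q.2, ω), q.1)) (by fun_prop)
  have hswap : ∀ (M : Measure (Mark d c × ℝ≥0)) [SFinite M], ∀ᵐ x : Space d, ∀ᵐ z ∂M,
      ‖convField α g' t x (ω, z)‖ₑ ≤ supNorm g' (ω, z) := fun M _ =>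
    (Measure.ae_ae_comm (μ := M) (ν := volume)
      (p := fun z x => ‖convField α g' t x (ω, z)‖ₑ ≤ supNorm g' (ω, z))
      (measurableSet_le hconv.enorm (hsup.comp measurable_fst))).1
        (ae_of_all _ fun z => enorm_convField_le hd hα hα2 t (ω, z))
  have hbound : ∀ᵐ x : Space d,
      ‖compensatedIntegral κ ν (convField α g' t x) t ω‖ₑ ≤ pathBound κ ν g' T ω := by
    filter_upwards [hswap (κ ω), hswap (ν.prod lebesgue)] with x h1 h2
    refine (enorm_compensatedIntegral_le _ t ω).trans (add_le_add ?_ ?_)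
    · exact (lintegral_mono_ae (ae_restrict_of_ae h1)).trans
        (lintegral_mono_set (strip_mono htT))
    · exact (lintegral_mono_ae (ae_restrict_of_ae h2)).trans
        (lintegral_mono_set (strip_mono htT))
  rw [eLpNorm_exponent_top]
  exact essSup_le_of_ae_le _ hbound

variable {g : ℝ≥0 → Mark d c → Space d → Ω → ℝ}

lemma lintegral_supNorm_eq_sourceNorm [IsProbabilityMeasure P] (hν : IsLevyMeasure ν)
    (hg : Measurable (fun p : ℝ≥0 × Mark d c × Space d × Ω => g p.1 p.2.1 p.2.2.1 p.2.2.2))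
    (hgg' : ∀ᵐ θ ∂(P.prod (ν.prod lebesgue)), ∀ᵐ x, g' (θ, x) = g θ.2.2 θ.2.1 x θ.1)
    (T : ℝ≥0) :
    ∫⁻ ω, ∫⁻ z in strip d c T, supNorm g' (ω, z) ∂(ν.prod lebesgue) ∂P =
      sourceNorm P ν g T := by
  have := hν.sigmaFinite
  have hae : ∀ᵐ ω ∂P, ∀ᵐ z ∂(ν.prod lebesgue), ∀ᵐ x, g' ((ω, z), x) = g z.2 z.1 x ω :=
    Measure.ae_ae_of_ae_prod hgg'
  refine lintegral_congr_ae ?_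
  filter_upwards [hae] with ω hω
  have hm : Measurable fun z : Mark d c × ℝ≥0 =>
      eLpNorm (fun x => g z.2 z.1 x ω) ∞ (volume : Measure (Space d)) :=
    measurable_eLpNorm_top_section volume
      (h := fun q : (Mark d c × ℝ≥0) × Space d => g q.1.2 q.1.1 q.2 ω)
      (hg.comp (g := fun p : ℝ≥0 × Mark d c × Space d × Ω => g p.1 p.2.1 p.2.2.1 p.2.2.2)
        (f := fun q : (Mark d c × ℝ≥0) × Space d => (q.1.2, q.1.1, q.2, ω)) (by fun_prop))
  rw [← lintegral_strip_eq_iterated (ν := ν) hm T]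
  refine lintegral_congr_ae (ae_restrict_of_ae ?_)
  filter_upwards [hω] with z hz
  exact eLpNorm_congr_ae hz

/-- Almost everywhere on `E × (0, t]` the convolution is taken at a positive time, hence depends
only on the class of `g` and is bounded by its norm. -/
lemma ae_heatConv_eq_convField (hd : 1 ≤ d) (hα : 0 < α) (hα2 : α ≤ 2) [SFinite P]
    (hν : IsLevyMeasure ν)
    (hgg' : ∀ᵐ θ ∂(P.prod (ν.prod lebesgue)), ∀ᵐ x, g' (θ, x) = g θ.2.2 θ.2.1 x θ.1)
    (t : ℝ≥0) (x : Space d) :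
    ∀ᵐ θ ∂(P.prod (ν.prod lebesgue)), θ.2 ∈ strip d c t →
      heatConv α (t - θ.2.2) (fun y => g θ.2.2 θ.2.1 y θ.1) x = convField α g' t x θ ∧
        ‖convField α g' t x θ‖ₑ ≤ supNorm g' θ := by
  have := hν.sigmaFinite
  have hne : ∀ᵐ θ ∂(P.prod (ν.prod lebesgue)), θ.2.2 ≠ t := by
    have h1 : ∀ᵐ r ∂lebesgue, r ≠ t := by simp [ae_iff]
    exact (Measure.quasiMeasurePreserving_snd.ae
      (Measure.quasiMeasurePreserving_snd.ae h1))
  filter_upwards [hne, hgg'] with θ h1 h2 h3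
  have hpos : t - θ.2.2 ≠ 0 := (tsub_pos_of_lt (lt_of_le_of_ne h3.2.2 h1)).ne'
  refine ⟨?_, enorm_heatConv_le hd hα hα2 hpos _ x⟩
  rw [convField, heatConv, heatConv, if_neg hpos, if_neg hpos]
  refine integral_congr_ae ?_
  filter_upwards [h2] with y hy
  rw [hy]

end Convolution

section Realization

variable {d : ℕ} {c α : ℝ} {Ω : Type*} {m : MeasurableSpace Ω} {P : Measure Ω}
  {ℱ : Filtration ℝ≥0 m} {ν : Measure (Mark d c)} {N : Ω → Measure (Mark d c × ℝ≥0)}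
  {κ : Kernel Ω (Mark d c × ℝ≥0)} {g' : (Ω × (Mark d c × ℝ≥0)) × Space d → ℝ}
  {g : ℝ≥0 → Mark d c → Space d → Ω → ℝ}

lemma measurable_pathwise [SFinite ν] [IsSFiniteKernel κ] (hg' : Measurable g') :
    Measurable fun p : ℝ≥0 × Space d × Ω =>
      compensatedIntegral κ ν (convField α g' p.1 p.2.1) p.1 p.2.2 :=
  measurable_compensatedIntegral_param (t := fun p : ℝ≥0 × Space d × Ω => p.1) measurable_fst
    (w := fun p : ℝ≥0 × Space d × Ω => p.2.2) (by fun_prop) (measurable_convField_joint hg')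

/-- A jointly measurable field is a realization if and only if, at each point, it agrees almost
surely with the pathwise integral. -/
lemma isRealization_iff (hd : 1 ≤ d) (hα : 0 < α) (hα2 : α ≤ 2) [IsProbabilityMeasure P]
    (hN : IsPoissonRandomMeasure P ℱ ν N) (hν : IsLevyMeasure ν) [IsSFiniteKernel κ]
    (hκ : ∀ᵐ ω ∂P, κ ω = N ω)
    (hg : Measurable (fun p : ℝ≥0 × Mark d c × Space d × Ω => g p.1 p.2.1 p.2.2.1 p.2.2.2))
    (hfin : ∀ T : ℝ≥0, sourceNorm P ν g T < ∞)
    (hg' : Measurable[(markPredictable d c ℱ).prod inferInstance] g')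
    (hgg' : ∀ᵐ θ ∂(P.prod (ν.prod lebesgue)), ∀ᵐ x, g' (θ, x) = g θ.2.2 θ.2.1 x θ.1)
    {u : ℝ≥0 → Space d → Ω → ℝ}
    (hu : Measurable (fun p : ℝ≥0 × Space d × Ω => u p.1 p.2.1 p.2.2)) :
    IsRealization P ℱ ν N α g u ↔
      ∀ t x, u t x =ᵐ[P] compensatedIntegral κ ν (convField α g' t x) t := by
  have := hν.sigmaFinite
  rw [IsRealization, and_iff_right hu]
  refine forall₂_congr fun t x => ?_
  have hae := ae_heatConv_eq_convField hd hα hα2 hν hgg' t x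
  refine isStochasticIntegral_iff hN hν hκ (measurable_convField hg' t x) ?_ ?_
    (hae.mono fun θ h hθ => (h hθ).1) ?_
  · refine lt_of_le_of_lt ?_ (hfin t)
    rw [← lintegral_supNorm_eq_sourceNorm hν hg hgg' t]
    have hae2 : ∀ᵐ ω ∂P, ∀ᵐ z ∂(ν.prod lebesgue), z ∈ strip d c t →
        ‖convField α g' t x (ω, z)‖ₑ ≤ supNorm g' (ω, z) :=
      Measure.ae_ae_of_ae_prod (hae.mono fun θ h hθ => (h hθ).2)
    refine lintegral_mono_ae (hae2.mono fun ω hω => lintegral_mono_ae ?_)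
    exact (ae_restrict_iff' (measurableSet_strip t)).2 hω
  · have hs : Measurable fun p : Ω × (Mark d c × ℝ≥0) => t - p.2.2 := by fun_prop
    have hG : Measurable fun p : (Ω × (Mark d c × ℝ≥0)) × Space d =>
        g p.1.2.2 p.1.2.1 p.2 p.1.1 :=
      hg.comp (g := fun p : ℝ≥0 × Mark d c × Space d × Ω => g p.1 p.2.1 p.2.2.1 p.2.2.2)
        (f := fun p : (Ω × (Mark d c × ℝ≥0)) × Space d => (p.1.2.2, p.1.2.1, p.2, p.1.1))
        (by fun_prop)
    exact measurable_heatConv α hs hG measurable_const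
  · exact (hu.comp (f := fun ω : Ω => (t, x, ω)) (by fun_prop)).aemeasurable

/-- By Fubini, two jointly measurable fields that agree almost surely at each point agree almost
surely for almost every time as elements of `L^∞(ℝᵈ)`. -/
lemma ae_ae_eLpNorm_eq [SFinite P] {u w : ℝ≥0 → Space d → Ω → ℝ}
    (hu : Measurable (fun p : ℝ≥0 × Space d × Ω => u p.1 p.2.1 p.2.2))
    (hw : Measurable (fun p : ℝ≥0 × Space d × Ω => w p.1 p.2.1 p.2.2))
    (huw : ∀ t x, u t x =ᵐ[P] w t x) :
    ∀ᵐ ω ∂P, ∀ᵐ t ∂lebesgue,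
      eLpNorm (fun x => u t x ω) ∞ volume = eLpNorm (fun x => w t x ω) ∞ volume := by
  have hset : MeasurableSet {q : (ℝ≥0 × Space d) × Ω | u q.1.1 q.1.2 q.2 = w q.1.1 q.1.2 q.2} :=
    measurableSet_eq_fun (hu.comp (f := fun q : (ℝ≥0 × Space d) × Ω => (q.1.1, q.1.2, q.2))
      (by fun_prop)) (hw.comp (f := fun q : (ℝ≥0 × Space d) × Ω => (q.1.1, q.1.2, q.2))
      (by fun_prop))
  have h1 : ∀ᵐ ω ∂P, ∀ᵐ q ∂(lebesgue.prod (volume : Measure (Space d))),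
      u q.1 q.2 ω = w q.1 q.2 ω :=
    (Measure.ae_ae_comm (μ := lebesgue.prod (volume : Measure (Space d))) (ν := P)
      (p := fun q ω => u q.1 q.2 ω = w q.1 q.2 ω) hset).1 (ae_of_all _ fun q => huw q.1 q.2)
  filter_upwards [h1] with ω hω
  filter_upwards [Measure.ae_ae_of_ae_prod hω] with t ht
  exact eLpNorm_congr_ae ht

end Realization

end PoissonHeat

end

theorem corollary3p1 :
    ∃ C : ℝ≥0, ∀ (d : ℕ) (_ : 1 ≤ d) (c : ℝ) (_ : 0 < c) (α : ℝ) (_ : 0 < α) (_ : α ≤ 2)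
      (Ω : Type*) (m : MeasurableSpace Ω) (P : Measure Ω) (_ : IsProbabilityMeasure P)
      (ℱ : Filtration ℝ≥0 m)
      (ν : Measure (PoissonHeat.Mark d c)) (_ : PoissonHeat.IsLevyMeasure ν)
      (N : Ω → Measure (PoissonHeat.Mark d c × ℝ≥0))
      (_ : PoissonHeat.IsPoissonRandomMeasure P ℱ ν N)
      (g : ℝ≥0 → PoissonHeat.Mark d c → PoissonHeat.Space d → Ω → ℝ)
      (_ : Measurable (fun p : ℝ≥0 × PoissonHeat.Mark d c × PoissonHeat.Space d × Ω =>
        g p.1 p.2.1 p.2.2.1 p.2.2.2))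
      (_ : ∀ t v x, AEStronglyMeasurable[ℱ t] (g t v x) P)
      (_ : ∀ T : ℝ≥0, PoissonHeat.sourceNorm P ν g T < ∞),
      (∃ u : ℝ≥0 → PoissonHeat.Space d → Ω → ℝ,
        PoissonHeat.IsRealization P ℱ ν N α g u ∧
        ∀ T : ℝ≥0,
          PoissonHeat.upperExpectation P
              (fun ω => ⨆ t ∈ Iic T, eLpNorm (fun x => u t x ω) ∞ volume) ≤
            C * PoissonHeat.sourceNorm P ν g T ∧
          C * PoissonHeat.sourceNorm P ν g T < ∞) ∧
      (∀ u : ℝ≥0 → PoissonHeat.Space d → Ω → ℝ,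
        PoissonHeat.IsRealization P ℱ ν N α g u →
        ∀ T : ℝ≥0,
          PoissonHeat.upperExpectation P
              (fun ω => essSup (fun t => eLpNorm (fun x => u t x ω) ∞ volume)
                (PoissonHeat.lebesgue.restrict (Iic T))) ≤
            C * PoissonHeat.sourceNorm P ν g T ∧
          C * PoissonHeat.sourceNorm P ν g T < ∞) := by
  refine ⟨2, fun d hd c _ α hα hα2 Ω m P _ ℱ ν hν N hN g hg had hfin => ?_⟩
  have := hν.sigmaFinite
  obtain ⟨κ, _, hκ⟩ := hN.exists_kernel hν
  obtain ⟨g', hg', hgg'⟩ := PoissonHeat.exists_predictable_version hν hg had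
  have hw := PoissonHeat.measurable_pathwise (α := α) (κ := κ) (ν := ν)
    (PoissonHeat.measurable_of_markPredictable_prod hg')
  have hbound : ∀ (T : ℝ≥0) (X : Ω → ℝ≥0∞),
      (∀ᵐ ω ∂P, X ω ≤ PoissonHeat.pathBound κ ν g' T ω) →
      PoissonHeat.upperExpectation P X ≤ ((2 : ℝ≥0) : ℝ≥0∞) * PoissonHeat.sourceNorm P ν g T ∧
        ((2 : ℝ≥0) : ℝ≥0∞) * PoissonHeat.sourceNorm P ν g T < ∞ := by
    intro T X hX
    refine ⟨?_, ENNReal.mul_lt_top ENNReal.coe_lt_top (hfin T)⟩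
    refine (PoissonHeat.upperExpectation_le (PoissonHeat.measurable_pathBound hg' T) hX).trans_eq
      ?_
    rw [PoissonHeat.lintegral_pathBound hN hν hκ hg',
      PoissonHeat.lintegral_supNorm_eq_sourceNorm hν hg hgg']
    rfl
  constructor
  · refine ⟨fun t x => PoissonHeat.compensatedIntegral κ ν (PoissonHeat.convField α g' t x) t,
      (PoissonHeat.isRealization_iff hd hα hα2 hN hν hκ hg hfin hg' hgg' hw).2
        fun t x => ae_eq_rfl, fun T => hbound T _ (ae_of_all _ fun ω => ?_)⟩
    exact iSup₂_le fun t ht => PoissonHeat.eLpNorm_compensatedIntegral_le hd hα hα2 hg' ht ω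
  · intro u hu T
    refine hbound T _ ?_
    have huw := (PoissonHeat.isRealization_iff hd hα hα2 hN hν hκ hg hfin hg' hgg' hu.1).1 hu
    filter_upwards [PoissonHeat.ae_ae_eLpNorm_eq hu.1 hw huw] with ω hω
    refine essSup_le_of_ae_le _ ((ae_restrict_iff' measurableSet_Iic).2 ?_)
    filter_upwards [hω] with t ht htT
    rw [ht]
    exact PoissonHeat.eLpNorm_compensatedIntegral_le hd hα hα2 hg' htT ω
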